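/- **Setting.** Let $Z$ be a real Hilbert space and let $A$ generate an exponentially stable analytic semigroup $e^{At}$ on $Z$. For $s\ge 0$ let $Z^{s}=\operatorname{ran}(-A)^{-s}$ with $\|\varphi\|_s=\|(-A)^s\varphi\|$, and let $Z^{-s}$ be the completion of $Z$ in the norm $\|\varphi\|_{-s}=\|(-A)^{-s}\varphi\|$. Input, disturbance and output are scalar. Let $\sigma,s_c\ge 0$ and $s_1>0$ with $s_c+\sigma<1$ and $s_1+\sigma<1$; let $B_{\rm in}v=v\,b_{\rm in}$ and $B_{\rm d}v=v\,b_{\rm d}$ with $b_{\rm in},b_{\rm d}\in Z^{-\sigma}$ (if $b_{\rm in}\in Z^{-s_b}$ and $b_{\rm d}\in Z^{-s_d}$, take $\sigma=\max\{s_b,s_d\}$), and let $C:Z^{s_c}\to\mathbb R$ be a bounded linear functional. Let $f:Z\to Z$ satisfy $f(0)=0$ and $\|f(\varphi_1)-f(\varphi_2)\|\le\epsilon\|\varphi_1-\varphi_2\|_{s_1}$ for $\varphi_1,\varphi_2\in Z^{s_1}$, with $\epsilon\ge 0$. Denote the extension of $A$ to $Z^{-\sigma}$ also by $A$, assume $G=C(-A)^{-1}B_{\rm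 in}\ne0$, and put $B=B_{\rm in}G^{-1}$, $I_0=I+BCA^{-1}$. Let $0<\beta<1$ and $A_\beta=A-\frac{1-\beta}{\beta}BC$ (an operator in $Z^{-\sigma}$), and assume that $A_\beta$ generates an exponentially stable semigroup $e^{A_\beta t}$ on $Z^{-\sigma}$. **Iteration.** Let $r,d\in C_b^2([0,\infty))$ (twice continuously differentiable, bounded together with their first two derivatives) and $z_0\in Z$. Let $z^0$ and $z^1$ be mild solutions on $[0,\infty)$, continuous on $(0,\infty)$ with values in $Z^{s_1}$, of $$\dot z^{0}=A_\beta z^0+I_0\big(f(z^0)+B_{\rm d}d\big)+\tfrac1\beta Br,\quad z^0(0)=z_0,$$ $$\dot z^{1}=A_\beta z^1+I_0\big(f(z^0+z^1)-f(z^0)\big)+\tfrac1\beta Be_0,\quad z^1(0)=0,$$ where $e_0=r-Cz^0$, and let $e_1=e_0-Cz^1$ be the error of the second iteration. **Constants.** Let $K(t)=-\frac1\beta CA_\beta^{-1}e^{A_\beta t}B$, $K_d(t)=-CA_\beta^{-1}e^{A_\beta t}I_0B_{\rm d}$, and $$D=\int_0^\infty|K|\,dt,\quad D_d=\int_0^\infty|K_d|\,dt,\quad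 D_H=\int_0^\infty\|Ce^{A_\beta t}I_0\|_{\mathcal L(Z,\mathbb R)}dt,$$ $$D_B=\int_0^\infty\big\|\tfrac1\beta e^{A_\beta t}B\big\|_{\mathcal L(\mathbb R,Z^{s_1})}dt,\quad D_{A_\beta}=\int_0^\infty\|e^{A_\beta t}I_0\|_{\mathcal L(Z,Z^{s_1})}dt,\quad D_{B_{\rm d}}=\int_0^\infty\|e^{A_\beta t}I_0B_{\rm d}\|_{\mathcal L(\mathbb R,Z^{s_1})}dt,$$ assume $\epsilon D_{A_\beta}<1$, and put $$\mathcal D=D_H\,\frac{D_B\,\epsilon}{1-\epsilon D_{A_\beta}},\qquad \mathcal D_d=D_H\,\frac{D_{B_{\rm d}}\,\epsilon}{1-\epsilon D_{A_\beta}}.$$ Write $\limsup\|\varphi\|_2=\limsup_{t\to\infty}\max_{0\le j\le2}|\varphi^{(j)}(t)|$. **Theorem.** Then $0<D+\mathcal D<\infty$, $D_d+\mathcal D_d<\infty$, and $$\limsup_{t\to\infty}|e_1(t)|\le (D+\mathcal D)^2\left[\limsup\|r\|_2+\frac{D_d+\mathcal D_d}{D+\mathcal D}\,\limsup\|d\|_2\right].$$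 -/

import Mathlib

open Set Filter Topology MeasureTheory
open scoped ENNReal NNReal

noncomputable section

/-! ### Complexification of a real Hilbert space -/

/-- The Hilbert space complexification `E + iE` of a real Hilbert space `E`, with
`‖x + iy‖² = ‖x‖² + ‖y‖²`. -/
def Complexify (E : Type*) : Type _ := WithLp 2 (E × E)

namespace Complexify

variable {E : Type*} [NormedAddCommGroup E] [InnerProductSpace ℝ E]

instance : NormedAddCommGroup (Complexify E) :=
  inferInstanceAs (NormedAddCommGroup (WithLp 2 (E × E)))

/-- The element `x + iy`. -/
def mk (x y : E) : Complexify E := WithLp.toLp 2 (x, y)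

/-- Real part of `x + iy`. -/
def re (p : Complexify E) : E := (WithLp.ofLp p).1

/-- Imaginary part of `x + iy`. -/
def im (p : Complexify E) : E := (WithLp.ofLp p).2

theorem ext' {p q : Complexify E} (h₁ : p.re = q.re) (h₂ : p.im = q.im) : p = q :=
  (WithLp.ofLp_injective 2) (Prod.ext h₁ h₂)

@[simp] theorem re_mk (x y : E) : (mk x y).re = x := rfl
@[simp] theorem im_mk (x y : E) : (mk x y).im = y := rfl
@[simp] theorem re_add (p q : Complexify E) : (p + q).re = p.re + q.re := rfl
@[simp] theorem im_add (p q : Complexify E) : (p + q).im = p.im + q.im := rfl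
@[simp] theorem re_zero : (0 : Complexify E).re = 0 := rfl
@[simp] theorem im_zero : (0 : Complexify E).im = 0 := rfl

/-- `(a + ib)(x + iy) = (ax - by) + i(bx + ay)`. -/
instance : SMul ℂ (Complexify E) :=
  ⟨fun c p => mk (c.re • p.re - c.im • p.im) (c.im • p.re + c.re • p.im)⟩

@[simp] theorem re_smul (c : ℂ) (p : Complexify E) :
    (c • p).re = c.re • p.re - c.im • p.im := rfl
@[simp] theorem im_smul (c : ℂ) (p : Complexify E) :
    (c • p).im = c.im • p.re + c.re • p.im := rfl

theorem norm_sq (p : Complexify E) : ‖p‖ ^ 2 = ‖p.re‖ ^ 2 + ‖p.im‖ ^ 2 :=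
  WithLp.prod_norm_sq_eq_of_L2 (α := E) (β := E) p

instance : Module ℂ (Complexify E) where
  one_smul p := by apply ext' <;> simp
  mul_smul a b p := by
    apply ext'
    · simp only [re_smul, im_smul, Complex.mul_re, Complex.mul_im]; module
    · simp only [re_smul, im_smul, Complex.mul_re, Complex.mul_im]; module
  smul_zero a := by apply ext' <;> simp
  smul_add a p q := by
    apply ext'
    · simp only [re_smul, re_add, im_add]; module
    · simp only [im_smul, re_add, im_add]; module
  add_smul a b p := by
    apply ext'
    · simp only [re_smul, re_add, Complex.add_re, Complex.add_im]; module
    · simp only [im_smul, im_add, Complex.add_re, Complex.add_im]; module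
  zero_smul p := by apply ext' <;> simp

instance : NormedSpace ℂ (Complexify E) where
  norm_smul_le c p := by
    have h : ‖c • p‖ ^ 2 = (‖c‖ * ‖p‖) ^ 2 := by
      rw [mul_pow, norm_sq, norm_sq, ← Complex.normSq_eq_norm_sq, Complex.normSq_apply,
        re_smul, im_smul, @norm_sub_sq ℝ, @norm_add_sq ℝ]
      simp only [norm_smul, inner_smul_left, inner_smul_right, Real.norm_eq_abs, mul_pow, sq_abs,
        RCLike.conj_to_real, RCLike.re_to_real]
      ring
    exact (pow_le_pow_iff_left₀ (norm_nonneg _) (by positivity) two_ne_zero).1 h.le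

end Complexify

/-! ### Semigroups and generators -/

/-- `T(t)`, `t ≥ 0`, is a strongly continuous semigroup (values at negative times are irrelevant). -/
structure IsC0Semigroup {E : Type*} [NormedAddCommGroup E] [NormedSpace ℝ E]
    (T : ℝ → E →L[ℝ] E) : Prop where
  map_zero : T 0 = ContinuousLinearMap.id ℝ E
  map_add : ∀ s t : ℝ, 0 ≤ s → 0 ≤ t → T (s + t) = (T s).comp (T t)
  tendsto_zero : ∀ x : E, Tendsto (fun t => T t x) (𝓝[>] 0) (𝓝 x)

/-- `A` (with its domain) is the infinitesimal generator of `T`. -/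
def IsGenerator {E : Type*} [NormedAddCommGroup E] [NormedSpace ℝ E]
    (A : E →ₗ.[ℝ] E) (T : ℝ → E →L[ℝ] E) : Prop :=
  ∀ x y : E, (x, y) ∈ A.graph ↔ Tendsto (fun h : ℝ => h⁻¹ • (T h x - x)) (𝓝[>] 0) (𝓝 y)

/-- `‖T(t)‖ ≤ M e^{-ωt}` for some `ω > 0`. -/
def IsExpStable {E : Type*} [NormedAddCommGroup E] [NormedSpace ℝ E]
    (T : ℝ → E →L[ℝ] E) : Prop :=
  ∃ M ω : ℝ, 0 < ω ∧ ∀ t : ℝ, 0 ≤ t → ‖T t‖ ≤ M * Real.exp (-ω * t)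

/-- A semigroup on a real Hilbert space is (bounded) analytic if its complexification extends to a
bounded holomorphic operator-valued function on a sector `{z ≠ 0 : |arg z| < θ}`.  (The semigroup
law on the sector follows from the one on the half-line by the identity theorem.) -/
def IsAnalyticSemigroup {E : Type*} [NormedAddCommGroup E] [InnerProductSpace ℝ E]
    (T : ℝ → E →L[ℝ] E) : Prop :=
  ∃ θ : ℝ, 0 < θ ∧ θ ≤ Real.pi / 2 ∧
    ∃ V : ℂ → (Complexify E →L[ℂ] Complexify E),
      DifferentiableOn ℂ V {z : ℂ | z ≠ 0 ∧ |z.arg| < θ} ∧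
      (∀ t : ℝ, 0 < t → ∀ x y : E, V (t : ℂ) (Complexify.mk x y) = Complexify.mk (T t x) (T t y)) ∧
      ∃ M : ℝ, ∀ z : ℂ, z ≠ 0 → |z.arg| < θ → ‖V z‖ ≤ M

/-- Evaluation of a partially defined operator, with the value `0` off its domain. -/
def LinearPMap.total {E F : Type*} [AddCommGroup E] [Module ℝ E] [AddCommGroup F] [Module ℝ F]
    (A : E →ₗ.[ℝ] F) (x : E) : F :=
  open Classical in if h : x ∈ A.domain then A ⟨x, h⟩ else 0

/-! ### The scale of spaces generated by `A` -/

/-- The fractional power `(-A)^{-s}`, `s ≥ 0`, where `A` generates the exponentially stable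
analytic semigroup `T`: `(-A)^{-s} = Γ(s)⁻¹ ∫₀^∞ t^{s-1} T(t) dt` for `s > 0`. -/
def negPow {Z : Type*} [NormedAddCommGroup Z] [NormedSpace ℝ Z]
    (T : ℝ → Z →L[ℝ] Z) (s : ℝ) : Z →L[ℝ] Z :=
  open Classical in
  if s = 0 then ContinuousLinearMap.id ℝ Z
  else (Real.Gamma s)⁻¹ • ∫ t in Ioi (0 : ℝ), t ^ (s - 1) • T t

/-- `ι : Z → X` exhibits the Banach space `X` as the space `Z^{-σ}`, the completion of `Z` for
the norm `‖φ‖_{-σ} = ‖(-A)^{-σ} φ‖`. -/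
structure IsNegSpace {Z X : Type*} [NormedAddCommGroup Z] [NormedSpace ℝ Z]
    [NormedAddCommGroup X] [NormedSpace ℝ X]
    (T : ℝ → Z →L[ℝ] Z) (σ : ℝ) (ι : Z →L[ℝ] X) : Prop where
  norm_eq : ∀ φ : Z, ‖ι φ‖ = ‖negPow T σ φ‖
  dense : DenseRange ι

/-- The space `Z^s = ran (-A)^{-s}`, `s ≥ 0`, as a subspace of `X = Z^{-σ}`. -/
def posSpace {Z X : Type*} [NormedAddCommGroup Z] [NormedSpace ℝ Z]
    [NormedAddCommGroup X] [NormedSpace ℝ X]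
    (T : ℝ → Z →L[ℝ] Z) (ι : Z →L[ℝ] X) (s : ℝ) : Submodule ℝ X :=
  LinearMap.range ((ι.comp (negPow T s)) : Z →ₗ[ℝ] X)

/-- The norm `‖x‖_s = ‖(-A)^s x‖` of `x ∈ Z^s ⊆ X`, `s ≥ 0`, with the value `∞` if `x ∉ Z^s`. -/
def posNorm {Z X : Type*} [NormedAddCommGroup Z] [NormedSpace ℝ Z]
    [NormedAddCommGroup X] [NormedSpace ℝ X]
    (T : ℝ → Z →L[ℝ] Z) (ι : Z →L[ℝ] X) (s : ℝ) (x : X) : ℝ≥0∞ :=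
  ⨅ (y : Z) (_ : ι (negPow T s y) = x), ‖y‖ₑ

/-! ### Signals -/

/-- `φ ∈ C_b^N([0,∞))`: `N` times continuously differentiable, bounded derivatives of orders
`0, …, N`. -/
def IsCb (N : ℕ) (φ : ℝ → ℝ) : Prop :=
  ContDiffOn ℝ N φ (Ici 0) ∧
    ∃ M : ℝ, ∀ j ≤ N, ∀ t : ℝ, 0 ≤ t → |iteratedDerivWithin j φ (Ici 0) t| ≤ M

/-- `limsup ‖φ‖_N = limsup_{t → ∞} max_{0 ≤ j ≤ N} |φ^{(j)}(t)|`. -/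
def limsupNorm (N : ℕ) (φ : ℝ → ℝ) : ℝ≥0∞ :=
  limsup (fun t : ℝ => (Finset.range (N + 1)).sup
    fun j => ‖iteratedDerivWithin j φ (Ici 0) t‖ₑ) atTop

/-! ### The regulated system -/

/-- The data of the nonlinear control system `z' = Az + f(z) + B_in u + B_d d`, `y = Cz`, with
scalar input, disturbance and output, together with the regularization parameter `β`.
`X` plays the role of the extrapolation space `Z^{-σ}`, which contains the vectors `b_in`, `b_d`
representing `B_in` and `B_d`; `S(t)` stands for `e^{A_β t}`.  The conditions that these data
satisfy are listed in `RegulatedSystem.Standing`. -/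
structure RegulatedSystem (Z X : Type*) [NormedAddCommGroup Z] [InnerProductSpace ℝ Z]
    [NormedAddCommGroup X] [NormedSpace ℝ X] where
  /-- the operator `A`, with its domain -/
  A : Z →ₗ.[ℝ] Z
  /-- the semigroup `e^{At}` -/
  T : ℝ → Z →L[ℝ] Z
  /-- `B_in, B_d ∈ Z^{-σ}` -/
  σ : ℝ
  /-- the inclusion `Z ⊆ Z^{-σ}` -/
  ι : Z →L[ℝ] X
  /-- the output operator acts on `Z^{s_c}` -/
  sc : ℝ
  /-- the output operator -/
  C : posSpace T ι sc →ₗ[ℝ] ℝ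
  /-- `B_in v = v b_in` -/
  bIn : X
  /-- `B_d v = v b_d` -/
  bd : X
  /-- the nonlinearity -/
  f : Z → Z
  /-- the nonlinearity is Lipschitz for the norm of `Z^{s₁}` -/
  s₁ : ℝ
  /-- the Lipschitz constant of the nonlinearity -/
  ε : ℝ≥0
  /-- the regularization parameter -/
  β : ℝ
  /-- the semigroup `e^{A_β t}` -/
  S : ℝ → X →L[ℝ] X

namespace RegulatedSystem

variable {Z X : Type*} [NormedAddCommGroup Z] [InnerProductSpace ℝ Z]
  [NormedAddCommGroup X] [NormedSpace ℝ X] (P : RegulatedSystem Z X)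

/-- The norm `‖x‖_s`, `s ≥ 0`. -/
def snorm (s : ℝ) (x : X) : ℝ≥0∞ := posNorm P.T P.ι s x

/-- `C x` for `x ∈ Z^{s_c}` (and `0` for other `x`). -/
def Cx (x : X) : ℝ := LinearPMap.total (⟨posSpace P.T P.ι P.sc, P.C⟩ : X →ₗ.[ℝ] ℝ) x

/-- The extension of `A` to a closed operator in `X = Z^{-σ}`: the graph is the closure of the
graph of `A`. -/
def AX : X →ₗ.[ℝ] X :=
  ((P.A.graph.map ((P.ι.prodMap P.ι) : Z × Z →ₗ[ℝ] X × X)).topologicalClosure).toLinearPMap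

/-- `A⁻¹` on `X`. -/
def AInv (x : X) : X := P.AX.inverse.total x

/-- `G = C (-A)⁻¹ B_in`. -/
def G : ℝ := -P.Cx (P.AInv P.bIn)

/-- The vector `b` with `B v = v b`, where `B = B_in G⁻¹`. -/
def b : X := P.G⁻¹ • P.bIn

/-- `I₀ = I + B C A⁻¹`. -/
def I₀ (x : X) : X := x + P.Cx (P.AInv x) • P.b

/-- `A_β = A - ((1-β)/β) B C`, an operator in `X`. -/
def Aβ : X →ₗ.[ℝ] X :=
  P.AX - ((1 - P.β) / P.β) •
    (⟨posSpace P.T P.ι P.sc, P.C.smulRight P.b⟩ : X →ₗ.[ℝ] X)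

/-- `A_β⁻¹` on `X`. -/
def AβInv (x : X) : X := P.Aβ.inverse.total x

/-- The standing assumptions. -/
structure Standing : Prop where
  /-- `A` generates the exponentially stable analytic semigroup `T` on `Z`. -/
  semigroup : IsC0Semigroup P.T
  generator : IsGenerator P.A P.T
  analytic : IsAnalyticSemigroup P.T
  stable : IsExpStable P.T
  /-- the exponents -/
  σ_nonneg : 0 ≤ P.σ
  sc_nonneg : 0 ≤ P.sc
  s₁_pos : 0 < P.s₁
  sc_add_σ : P.sc + P.σ < 1
  s₁_add_σ : P.s₁ + P.σ < 1
  /-- `X` is the space `Z^{-σ}`. -/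
  negSpace : IsNegSpace P.T P.σ P.ι
  /-- `C` is bounded on `Z^{s_c}`. -/
  C_bounded : ∃ c : ℝ≥0, ∀ φ : posSpace P.T P.ι P.sc, ‖P.C φ‖ₑ ≤ c * P.snorm P.sc φ
  /-- `f` vanishes at the equilibrium and `‖f(φ₁) - f(φ₂)‖ ≤ ε ‖φ₁ - φ₂‖_{s₁}` on `Z^{s₁}`. -/
  f_zero : P.f 0 = 0
  f_lipschitz : ∀ φ₁ φ₂ : Z, P.ι φ₁ ∈ posSpace P.T P.ι P.s₁ → P.ι φ₂ ∈ posSpace P.T P.ι P.s₁ →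
    ‖P.f φ₁ - P.f φ₂‖ₑ ≤ P.ε * P.snorm P.s₁ (P.ι (φ₁ - φ₂))
  /-- `G` is invertible. -/
  G_ne_zero : P.G ≠ 0
  /-- `0 < β < 1` and `S(t) = e^{A_β t}` is exponentially stable. -/
  β_pos : 0 < P.β
  β_lt_one : P.β < 1
  semigroup_β : IsC0Semigroup P.S
  generator_β : IsGenerator P.Aβ P.S
  stable_β : IsExpStable P.S

/-! #### The constants of the error estimate -/

/-- `K(t) = -(1/β) C A_β⁻¹ e^{A_β t} B`. -/
def K (t : ℝ) : ℝ := -(1 / P.β) * P.Cx (P.AβInv (P.S t P.b))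

/-- `K_d(t) = -C A_β⁻¹ e^{A_β t} I₀ B_d`. -/
def Kd (t : ℝ) : ℝ := -P.Cx (P.AβInv (P.S t (P.I₀ P.bd)))

/-- `D = ∫₀^∞ ‖K(t)‖ dt`. -/
def D : ℝ≥0∞ := ∫⁻ t in Ioi (0 : ℝ), ‖P.K t‖ₑ

/-- `D_d = ∫₀^∞ ‖K_d(t)‖ dt`. -/
def Dd : ℝ≥0∞ := ∫⁻ t in Ioi (0 : ℝ), ‖P.Kd t‖ₑ

/-- `D_H = ∫₀^∞ ‖C e^{A_β t} I₀‖ dt`, with the norm of `L(Z, ℝ)`. -/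
def DH : ℝ≥0∞ :=
  ∫⁻ t in Ioi (0 : ℝ), ⨆ (φ : Z) (_ : ‖φ‖ ≤ 1), ‖P.Cx (P.S t (P.I₀ (P.ι φ)))‖ₑ

/-- `D_B = ∫₀^∞ ‖(1/β) e^{A_β t} B‖ dt`, with the norm of `L(ℝ, Z^{s₁})`. -/
def DB : ℝ≥0∞ := ∫⁻ t in Ioi (0 : ℝ), P.snorm P.s₁ ((1 / P.β) • P.S t P.b)

/-- `D_{A_β} = ∫₀^∞ ‖e^{A_β t} I₀‖ dt`, with the norm of `L(Z, Z^{s₁})`. -/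
def DA : ℝ≥0∞ :=
  ∫⁻ t in Ioi (0 : ℝ), ⨆ (φ : Z) (_ : ‖φ‖ ≤ 1), P.snorm P.s₁ (P.S t (P.I₀ (P.ι φ)))

/-- `D_{B_d} = ∫₀^∞ ‖e^{A_β t} I₀ B_d‖ dt`, with the norm of `L(ℝ, Z^{s₁})`. -/
def DBd : ℝ≥0∞ := ∫⁻ t in Ioi (0 : ℝ), P.snorm P.s₁ (P.S t (P.I₀ P.bd))

/-- `𝒟 = D_H D_B ε / (1 - ε D_{A_β})`. -/
def calD : ℝ≥0∞ := P.DH * (P.DB * P.ε / (1 - P.ε * P.DA))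

/-- `𝒟_d = D_H D_{B_d} ε / (1 - ε D_{A_β})`. -/
def calDd : ℝ≥0∞ := P.DH * (P.DBd * P.ε / (1 - P.ε * P.DA))

/-! #### The iteration -/

/-- `z` is a mild solution on `[0, ∞)` of `z' = A_β z + g`, `z(0) = z₀` (variation of parameters
formula in `X`), which for `t > 0` is a continuous function with values in `Z^{s₁}`. -/
structure IsMildSolution (z₀ : Z) (g : ℝ → X) (z : ℝ → Z) : Prop where
  mem : ∀ t : ℝ, 0 < t → P.ι (z t) ∈ posSpace P.T P.ι P.s₁
  continuous : ∀ t : ℝ, 0 < t →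
    Tendsto (fun τ => P.snorm P.s₁ (P.ι (z τ - z t))) (𝓝 t) (𝓝 0)
  integrable : ∀ t : ℝ, 0 ≤ t → IntervalIntegrable g volume 0 t
  eq : ∀ t : ℝ, 0 ≤ t → P.ι (z t) = P.S t (P.ι z₀) + ∫ τ in (0 : ℝ)..t, P.S (t - τ) (g τ)

/-- The first system of the iteration:
`(z⁰)' = A_β z⁰ + I₀ (f(z⁰) + B_d d) + (1/β) B r`, `z⁰(0) = z₀`. -/
def IsStepZero (r d : ℝ → ℝ) (z₀ : Z) (z : ℝ → Z) : Prop :=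
  P.IsMildSolution z₀
    (fun t => P.I₀ (P.ι (P.f (z t)) + d t • P.bd) + (1 / P.β) • (r t • P.b)) z

/-- The error `e₀ = r - C z⁰`. -/
def e₀ (r : ℝ → ℝ) (z : ℝ → Z) (t : ℝ) : ℝ := r t - P.Cx (P.ι (z t))

/-- The second system of the iteration:
`(z¹)' = A_β z¹ + I₀ F₁ + (1/β) B e₀`, `z¹(0) = 0`, where `F₁ = f(z⁰ + z¹) - f(z⁰)`. -/
def IsStepOne (r : ℝ → ℝ) (z w : ℝ → Z) : Prop :=
  P.IsMildSolution 0
    (fun t => P.I₀ (P.ι (P.f (z t + w t) - P.f (z t))) + (1 / P.β) • (P.e₀ r z t • P.b)) w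

/-- The error `e₁ = e₀ - C z¹`. -/
def e₁ (r : ℝ → ℝ) (z w : ℝ → Z) (t : ℝ) : ℝ := P.e₀ r z t - P.Cx (P.ι (w t))

end RegulatedSystem

end

/-!
The operator `A_β` differs from `A` by a rank one operator, so its semigroup satisfies a weakly
singular Volterra equation and smooths: `e^{A_β t} = Q R(t)` for `t > 0`, where `R(t)` maps
`Z^{-σ}` to `Z` with norm at most `M (t^{-a} + 1) e^{-ωt}` for some `a < 1` and `ω > 0`, and the
functional `C` is bounded after composition with `Q`. Hence all constants are integrals of gains of
bounded operators.

In the variation of constants formula for `z⁰`, integration by parts moves the `t`-derivative from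
`e^{A_β t}` to `r` and `d`. By the choice of `B` the boundary term of `r` cancels `r` in
`e₀ = r - C z⁰`, and by the choice of `I₀` the boundary term of `d` vanishes, since
`C A_β⁻¹ I₀ = 0`. The small-gain condition `ε D_{A_β} < 1` bounds the state by the inputs, and this
gives `limsup |e₀| ≤ L` with `L = (D + 𝒟) limsup ‖r‖ + (D_d + 𝒟_d) limsup ‖d‖`.

The second iteration has the same form with `r` replaced by `e₀`, which is merely continuous. The
difference quotients of `z⁰` satisfy an equation of the same form driven by those of `r` and `d`, so
the difference quotients of `e₀` are also bounded by `L` in the limit. They are the derivatives of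
the averages of `e₀` over short intervals; these averages approximate `e₀` and play its role in the
integration by parts, which yields `limsup |e₁| ≤ (D + 𝒟) L`.
-/

noncomputable section

/-! ### Strongly continuous and analytic semigroups -/

namespace IsC0Semigroup

variable {E F : Type*} [NormedAddCommGroup E] [NormedSpace ℝ E] [NormedAddCommGroup F]
  [NormedSpace ℝ F] {T : ℝ → E →L[ℝ] E} (hT : IsC0Semigroup T)
include hT

theorem map_add_apply {s t : ℝ} (hs : 0 ≤ s) (ht : 0 ≤ t) (x : E) :
    T (s + t) x = T s (T t x) :=
  DFunLike.congr_fun (hT.map_add s t hs ht) x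

theorem map_zero_apply (x : E) : T 0 x = x :=
  DFunLike.congr_fun hT.map_zero x

theorem comm_apply {s t : ℝ} (hs : 0 ≤ s) (ht : 0 ≤ t) (x : E) : T s (T t x) = T t (T s x) := by
  rw [← hT.map_add_apply hs ht, ← hT.map_add_apply ht hs, add_comm]

theorem tendsto_abs_sub (x : E) (t : ℝ) : Tendsto (fun s => T |s - t| x) (𝓝 t) (𝓝 x) := by
  have right_continuous : Tendsto (fun h => T h x) (𝓝[≥] 0) (𝓝 x) := by
    have : ContinuousWithinAt (fun h => T h x) (Ioi 0) 0 := by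
      simpa only [ContinuousWithinAt, hT.map_zero_apply] using hT.tendsto_zero x
    simpa only [ContinuousWithinAt, hT.map_zero_apply] using continuousWithinAt_Ioi_iff_Ici.1 this
  refine right_continuous.comp
    (tendsto_nhdsWithin_iff.2 ⟨?_, .of_forall fun s => mem_Ici.2 (abs_nonneg _)⟩)
  have : Continuous fun s : ℝ => |s - t| := by fun_prop
  simpa only [sub_self, abs_zero] using this.tendsto t

theorem norm_apply_sub_apply_le {M : ℝ} (hM : ∀ t, 0 ≤ t → ‖T t‖ ≤ M) {s t : ℝ}
    (hs : 0 ≤ s) (ht : 0 ≤ t) (x : E) : ‖T s x - T t x‖ ≤ M * ‖T |s - t| x - x‖ := by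
  wlog h : t ≤ s generalizing s t with H
  · rw [norm_sub_rev, abs_sub_comm]
    exact H ht hs (le_of_not_ge h)
  have factor : T s x = T t (T |s - t| x) := by
    rw [abs_of_nonneg (sub_nonneg.2 h), ← hT.map_add_apply ht (sub_nonneg.2 h),
      add_sub_cancel]
  rw [factor, ← map_sub]
  exact (T t).le_of_opNorm_le (hM t ht) _

theorem continuousOn {M : ℝ} (hM : ∀ t, 0 ≤ t → ‖T t‖ ≤ M) (x : E) :
    ContinuousOn (fun t => T t x) (Ici 0) := by
  intro t ht
  rw [ContinuousWithinAt, tendsto_iff_norm_sub_tendsto_zero]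
  have bound_tendsto : Tendsto (fun s => M * ‖T |s - t| x - x‖) (𝓝[Ici 0] t) (𝓝 0) := by
    simpa only [mul_zero] using
      ((tendsto_iff_norm_sub_tendsto_zero.1 (hT.tendsto_abs_sub x t)).mono_left
        nhdsWithin_le_nhds).const_mul M
  refine squeeze_zero' (.of_forall fun s => norm_nonneg _) ?_ bound_tendsto
  filter_upwards [self_mem_nhdsWithin] with s hs
  exact hT.norm_apply_sub_apply_le hM hs ht x

theorem continuousOn_uncurry {M : ℝ} (hM : ∀ t, 0 ≤ t → ‖T t‖ ≤ M) :
    ContinuousOn (fun p : ℝ × E => T p.1 p.2) (Ici 0 ×ˢ univ) := by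
  refine continuousOn_prod_of_continuousOn_lipschitzOnWith' _ M.toNNReal (fun t ht => ?_)
    fun x _ => hT.continuousOn hM x
  exact ((T t).lipschitz.weaken (Real.le_toNNReal_iff_coe_le
    ((norm_nonneg _).trans (hM t ht)) |>.2 (hM t ht))).lipschitzOnWith

end IsC0Semigroup

theorem IsExpStable.exists_bound {E : Type*} [NormedAddCommGroup E] [NormedSpace ℝ E]
    {T : ℝ → E →L[ℝ] E} (h : IsExpStable T) :
    ∃ M ω : ℝ, 0 < M ∧ 0 < ω ∧ (∀ t : ℝ, 0 ≤ t → ‖T t‖ ≤ M * Real.exp (-ω * t)) ∧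
      ∀ t : ℝ, 0 ≤ t → ‖T t‖ ≤ M := by
  obtain ⟨M, ω, hω, hM⟩ := h
  have decay (t : ℝ) (ht : 0 ≤ t) : ‖T t‖ ≤ max M 1 * Real.exp (-ω * t) :=
    (hM t ht).trans (by gcongr; exact le_max_left _ _)
  refine ⟨max M 1, ω, by positivity, hω, decay, fun t ht => (decay t ht).trans ?_⟩
  exact mul_le_of_le_one_right (by positivity) (Real.exp_le_one_iff.2 (by nlinarith))

/-- `W` lifts the family `S` through `Q` at positive times: `S(t) = Q W(t)` for `t > 0`. With `Q`
the inclusion of a space of smoother vectors, this expresses that `S` is smoothing. -/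
def IsSmoothingLift {E F : Type*} [NormedAddCommGroup E] [NormedSpace ℝ E]
    [NormedAddCommGroup F] [NormedSpace ℝ F] (Q : F →L[ℝ] E) (S : ℝ → E →L[ℝ] E)
    (W : ℝ → E →L[ℝ] F) : Prop :=
  ∀ t, 0 < t → ∀ x, Q (W t x) = S t x

namespace IsSmoothingLift

variable {E F : Type*} [NormedAddCommGroup E] [NormedSpace ℝ E] [NormedAddCommGroup F]
  [NormedSpace ℝ F] {Q : F →L[ℝ] E} {S : ℝ → E →L[ℝ] E} {W : ℝ → E →L[ℝ] F}
  (hW : IsSmoothingLift Q S W) (hQ : Function.Injective Q) (hS : IsC0Semigroup S)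
include hW hQ hS

theorem map_add_apply {s t : ℝ} (hs : 0 < s) (ht : 0 ≤ t) (x : E) :
    W (s + t) x = W s (S t x) :=
  hQ <| by rw [hW s hs, hW _ (by linarith), hS.map_add_apply hs.le ht]

theorem continuousOn_uncurry {M : ℝ} (hM : ∀ t, 0 ≤ t → ‖S t‖ ≤ M) :
    ContinuousOn (fun p : ℝ × E => W p.1 p.2) (Ioi 0 ×ˢ univ) := by
  rintro ⟨t, x⟩ ⟨ht : 0 < t, -⟩
  have shifted : ContinuousAt (fun p : ℝ × E => W (t / 2) (S (p.1 - t / 2) p.2)) (t, x) := by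
    have hSt : ContinuousAt (fun p : ℝ × E => S p.1 p.2) (t - t / 2, x) :=
      (hS.continuousOn_uncurry hM).continuousAt
        (prod_mem_nhds (Ici_mem_nhds (by linarith)) univ_mem)
    exact (W (t / 2)).continuous.continuousAt.comp <|
      ContinuousAt.comp (g := fun p : ℝ × E => S p.1 p.2)
        (f := fun p : ℝ × E => (p.1 - t / 2, p.2)) (x := (t, x)) hSt (by fun_prop)
  refine (shifted.congr ?_).continuousWithinAt
  filter_upwards [prod_mem_nhds (Ioi_mem_nhds (half_lt_self ht)) univ_mem] with p hp
  have hp : t / 2 < p.1 := hp.1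
  rw [← hW.map_add_apply hQ hS (half_pos ht) (by linarith), add_sub_cancel]

end IsSmoothingLift

namespace Complexify

variable {E : Type*} [NormedAddCommGroup E] [InnerProductSpace ℝ E]

theorem norm_re_le (p : Complexify E) : ‖p.re‖ ≤ ‖p‖ := by
  refine le_of_sq_le_sq ?_ (norm_nonneg _)
  rw [norm_sq]
  exact le_add_of_nonneg_right (sq_nonneg _)

theorem norm_mk_zero (x : E) : ‖mk x 0‖ = ‖x‖ := by
  rw [← pow_left_inj₀ (norm_nonneg _) (norm_nonneg _) two_ne_zero, norm_sq]
  simp only [re_mk, im_mk, norm_zero, ne_eq, two_ne_zero, not_false_eq_true, zero_pow, add_zero]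

/-- The real part as a bounded real linear map. -/
def reCLM : Complexify E →L[ℝ] E :=
  LinearMap.mkContinuous
    { toFun := re
      map_add' := re_add
      map_smul' := fun a p => by
        change ((a : ℂ) • p).re = a • p.re
        simp only [re_smul, Complex.ofReal_re, Complex.ofReal_im, zero_smul, sub_zero] }
    1 fun p => (one_mul ‖p‖).symm ▸ norm_re_le p

/-- The embedding `x ↦ x + i0` of the real space. -/
def ofRealLI : E →ₗᵢ[ℝ] Complexify E where
  toFun x := mk x 0
  map_add' x y := by apply ext' <;> simp
  map_smul' a x := by
    change mk (a • x) 0 = (a : ℂ) • mk x 0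
    apply ext' <;> simp only [re_smul, im_smul, re_mk, im_mk, Complex.ofReal_re,
      Complex.ofReal_im, smul_zero, zero_smul, sub_zero, add_zero]
  norm_map' := norm_mk_zero

/-- The real part `x ↦ re (V (x + i0))` of a complex linear operator `V`, as a real linear function
of `V`. -/
def reOp : (Complexify E →L[ℂ] Complexify E) →ₗ[ℝ] (E →L[ℝ] E) where
  toFun V := (reCLM (E := E)).comp
    ((V.restrictScalars ℝ).comp (ofRealLI (E := E)).toContinuousLinearMap)
  map_add' _ _ := by ext; exact map_add (reCLM (E := E)) _ _
  map_smul' _ _ := by ext; exact map_smul (reCLM (E := E)) _ _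

theorem reOp_apply (V : Complexify E →L[ℂ] Complexify E) (x : E) :
    reOp V x = (V (mk x 0)).re := rfl

theorem norm_reOp_apply_le (V : Complexify E →L[ℂ] Complexify E) : ‖reOp V‖ ≤ ‖V‖ := by
  refine ContinuousLinearMap.opNorm_le_bound _ (norm_nonneg _) fun x => ?_
  rw [← norm_mk_zero x]
  exact (norm_re_le _).trans (V.le_opNorm _)

end Complexify

theorem exists_closedBall_subset_sector {θ : ℝ} (hθ : 0 < θ) :
    ∃ ρ : ℝ, 0 < ρ ∧ ∀ t : ℝ, 0 < t →
      Metric.closedBall (t : ℂ) (ρ * t) ⊆ {z | z ≠ 0 ∧ |z.arg| < θ} := by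
  have near_one : ∀ᶠ z : ℂ in 𝓝 1, z ≠ 0 ∧ |z.arg| < θ := by
    refine Filter.Eventually.and (isOpen_ne.mem_nhds one_ne_zero) ?_
    exact (Complex.continuousAt_arg (by simp)).abs.eventually_lt continuousAt_const (by simpa)
  obtain ⟨ρ, hρ, h⟩ := Metric.nhds_basis_closedBall.eventually_iff.1 near_one
  refine ⟨ρ, hρ, fun t ht z hz => ?_⟩
  have ht' : (t : ℂ) ≠ 0 := by exact_mod_cast ht.ne'
  have scaled_mem : z / t ∈ Metric.closedBall (1 : ℂ) ρ := by
    rw [mem_closedBall_iff_norm] at hz ⊢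
    rwa [div_sub_one ht', norm_div, Complex.norm_real, Real.norm_of_nonneg ht.le,
      div_le_iff₀ ht]
  obtain ⟨scaled_ne, scaled_arg⟩ := h scaled_mem
  refine ⟨fun hz => scaled_ne (by simp [hz]), ?_⟩
  rwa [← mul_div_cancel₀ z ht', Complex.arg_real_mul _ ht]

theorem IsAnalyticSemigroup.exists_hasDerivAt {E : Type*} [NormedAddCommGroup E]
    [InnerProductSpace ℝ E] {T : ℝ → E →L[ℝ] E} (h : IsAnalyticSemigroup T) :
    ∃ (T' : ℝ → E →L[ℝ] E) (c : ℝ), 0 ≤ c ∧ (∀ t, 0 < t → HasDerivAt T (T' t) t) ∧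
      ∀ t, 0 < t → ‖T' t‖ ≤ c / t := by
  obtain ⟨θ, hθ, -, V, hV, hVT, M, hM⟩ := h
  obtain ⟨ρ, hρ, ball_subset⟩ := exists_closedBall_subset_sector hθ
  have hM0 : 0 ≤ M := (norm_nonneg _).trans (hM 1 one_ne_zero (by simpa using hθ))
  have eq_reOp (t : ℝ) (ht : 0 < t) : T t = Complexify.reOp (V t) := by
    ext x
    rw [Complexify.reOp_apply, hVT t ht, Complexify.re_mk]
  have diffContOnCl (t : ℝ) (ht : 0 < t) : DiffContOnCl ℂ V (Metric.ball (t : ℂ) (ρ * t)) :=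
    (hV.mono (Metric.closure_ball_subset_closedBall.trans (ball_subset t ht))).diffContOnCl
  let reOpCLM := Complexify.reOp.mkContinuous 1 fun V : Complexify E →L[ℂ] Complexify E =>
    (Complexify.norm_reOp_apply_le V).trans_eq (one_mul _).symm
  refine ⟨fun t => Complexify.reOp (deriv V t), M / ρ, by positivity, fun t ht => ?_,
    fun t ht => ?_⟩
  · have hasDerivAt_V : HasDerivAt V (deriv V t) (t : ℂ) :=
      ((diffContOnCl t ht).differentiableAt Metric.isOpen_ball
        (Metric.mem_ball_self (by positivity))).hasDerivAt
    have hasDerivAt_V_real : HasDerivAt (fun s : ℝ => V s) (deriv V t) t := by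
      simpa using! HasDerivAt.scomp (𝕜 := ℝ) t hasDerivAt_V
        (Complex.ofRealCLM.hasDerivAt (x := t))
    refine (reOpCLM.hasFDerivAt.comp_hasDerivAt t
      hasDerivAt_V_real).congr_of_eventuallyEq ?_
    filter_upwards [lt_mem_nhds ht] with s hs using eq_reOp s hs
  · calc ‖Complexify.reOp (deriv V t)‖ ≤ ‖deriv V t‖ := Complexify.norm_reOp_apply_le _
      _ ≤ M / (ρ * t) :=
        Complex.norm_deriv_le_of_forall_mem_sphere_norm_le (by positivity) (diffContOnCl t ht)
          fun z hz =>
            have hz := ball_subset t ht (Metric.sphere_subset_closedBall hz)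
            hM z hz.1 hz.2
      _ = M / ρ / t := (div_div ..).symm

/-! ### Fractional powers -/

theorem integral_rpow_mul_sub_rpow {a b x : ℝ} (ha : 0 < a) (hb : 0 < b) (hx : 0 < x) :
    ∫ t in (0 : ℝ)..x, t ^ (a - 1) * (x - t) ^ (b - 1) =
      x ^ (a + b - 1) * (Real.Gamma a * Real.Gamma b / Real.Gamma (a + b)) := by
  have beta_eq : Complex.betaIntegral a b =
      ((Real.Gamma a * Real.Gamma b / Real.Gamma (a + b) : ℝ) : ℂ) := by
    rw [Complex.betaIntegral_eq_Gamma_mul_div _ _ (by simpa) (by simpa), ← Complex.ofReal_add]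
    simp only [Complex.Gamma_ofReal, Complex.ofReal_mul, Complex.ofReal_div]
  have rhs_cast : ((x ^ (a + b - 1) *
        (Real.Gamma a * Real.Gamma b / Real.Gamma (a + b)) : ℝ) : ℂ) =
      (x : ℂ) ^ ((a : ℂ) + b - 1) * Complex.betaIntegral a b := by
    rw [beta_eq, Complex.ofReal_mul, Complex.ofReal_cpow hx.le, Complex.ofReal_sub,
      Complex.ofReal_add, Complex.ofReal_one]
  apply Complex.ofReal_injective
  rw [← intervalIntegral.integral_ofReal, rhs_cast, ← Complex.betaIntegral_scaled a b hx]
  refine intervalIntegral.integral_congr fun t ht => ?_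
  rw [uIcc_of_le hx.le] at ht
  rw [Complex.ofReal_mul, Complex.ofReal_cpow ht.1, Complex.ofReal_cpow (sub_nonneg.2 ht.2),
    Complex.ofReal_sub, Complex.ofReal_sub, Complex.ofReal_sub, Complex.ofReal_one]

theorem integrableOn_rpow_mul_exp_neg {s ω : ℝ} (hs : -1 < s) (hω : 0 < ω) :
    IntegrableOn (fun t : ℝ => t ^ s * Real.exp (-ω * t)) (Ioi 0) := by
  simpa only [Real.rpow_one] using integrableOn_rpow_mul_exp_neg_mul_rpow (p := 1) hs one_pos hω

theorem integrableOn_rpow_neg_mul_inv_add {a t : ℝ} (ha : 0 < a) (ha1 : a < 1) (ht : 0 < t) :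
    IntegrableOn (fun u : ℝ => u ^ (-a) * (t + u)⁻¹) (Ioi 0) := by
  have continuousOn : ContinuousOn (fun u : ℝ => u ^ (-a) * (t + u)⁻¹) (Ioi 0) := by
    intro u (hu : 0 < u)
    exact ((continuousAt_id.rpow_const (.inl hu.ne')).mul
      ((continuousAt_const.add continuousAt_id).inv₀ (add_pos ht hu).ne')).continuousWithinAt
  rw [← Ioc_union_Ioi_eq_Ioi zero_le_one, integrableOn_union]
  constructor
  · have dominating : IntegrableOn (fun u : ℝ => u ^ (-a) * t⁻¹) (Ioc 0 1) :=
      ((intervalIntegrable_iff_integrableOn_Ioc_of_le zero_le_one).1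
        (intervalIntegral.intervalIntegrable_rpow' (by linarith))).mul_const _
    refine dominating.mono' ((continuousOn.mono Ioc_subset_Ioi_self).aestronglyMeasurable
      measurableSet_Ioc) (ae_restrict_of_forall_mem measurableSet_Ioc fun u hu => ?_)
    have hu : 0 < u := hu.1
    rw [Real.norm_of_nonneg (by positivity)]
    gcongr
    linarith
  · have dominating : IntegrableOn (fun u : ℝ => u ^ (-a - 1)) (Ioi 1) :=
      integrableOn_Ioi_rpow_of_lt (by linarith) zero_lt_one
    refine dominating.mono' ((continuousOn.mono
      (Ioi_subset_Ioi zero_le_one)).aestronglyMeasurable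
      measurableSet_Ioi) (ae_restrict_of_forall_mem measurableSet_Ioi fun u hu => ?_)
    have hu : 0 < u := zero_lt_one.trans hu
    rw [Real.norm_of_nonneg (by positivity), Real.rpow_sub_one hu.ne', div_eq_mul_inv]
    gcongr
    linarith

theorem integral_rpow_neg_mul_inv_add (a : ℝ) {t : ℝ} (ht : 0 < t) :
    ∫ u in Ioi (0 : ℝ), u ^ (-a) * (t + u)⁻¹ =
      (∫ v in Ioi (0 : ℝ), v ^ (-a) * (1 + v)⁻¹) * t ^ (-a) := by
  have substitution := integral_comp_mul_left_Ioi (fun u : ℝ => u ^ (-a) * (t + u)⁻¹) 0 ht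
  have scaled : ∫ v in Ioi (0 : ℝ), (t * v) ^ (-a) * (t + t * v)⁻¹ =
      ∫ v in Ioi (0 : ℝ), (t ^ (-a) * t⁻¹) * (v ^ (-a) * (1 + v)⁻¹) := by
    refine setIntegral_congr_fun measurableSet_Ioi fun v (hv : 0 < v) => ?_
    simp only [Real.mul_rpow ht.le hv.le]
    rw [show t + t * v = t * (1 + v) by ring, mul_inv]
    ring
  rw [scaled, integral_const_mul, mul_zero, smul_eq_mul] at substitution
  rw [eq_inv_mul_iff_mul_eq₀ ht.ne', ← mul_assoc, mul_left_comm, mul_inv_cancel₀ ht.ne',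
    mul_one] at substitution
  rw [← substitution, mul_comm]

theorem IsAnalyticSemigroup.continuousOn {Z : Type*} [NormedAddCommGroup Z]
    [InnerProductSpace ℝ Z] {T : ℝ → Z →L[ℝ] Z} (ha : IsAnalyticSemigroup T) :
    ContinuousOn T (Ioi 0) := by
  obtain ⟨T', c, -, h, -⟩ := ha.exists_hasDerivAt
  exact fun t ht => (h t ht).continuousAt.continuousWithinAt

/-- `N` maps into the domain of the generator `A` of the semigroup `T`, and `A N x = -x`: it is a
right inverse of `-A`. -/
def IsNegGeneratorRightInverse {E : Type*} [NormedAddCommGroup E] [NormedSpace ℝ E]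
    (T : ℝ → E →L[ℝ] E) (N : E →L[ℝ] E) : Prop :=
  ∀ x, Tendsto (fun h : ℝ => h⁻¹ • (T h (N x) - N x)) (𝓝[>] 0) (𝓝 (-x))

section NegPow

variable {Z : Type*} [NormedAddCommGroup Z] [NormedSpace ℝ Z] {T : ℝ → Z →L[ℝ] Z}

theorem negPow_zero : negPow T 0 = ContinuousLinearMap.id ℝ Z := if_pos rfl

theorem negPow_of_pos {s : ℝ} (hs : 0 < s) :
    negPow T s = (Real.Gamma s)⁻¹ • ∫ t in Ioi (0 : ℝ), t ^ (s - 1) • T t :=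
  if_neg hs.ne'

theorem integrableOn_rpow_smul_semigroup (hs : IsExpStable T) (hc : ContinuousOn T (Ioi 0))
    {s : ℝ} (h0 : 0 < s) : IntegrableOn (fun t : ℝ => t ^ (s - 1) • T t) (Ioi 0) := by
  obtain ⟨M, ω, -, hω, hT, -⟩ := hs.exists_bound
  have dominating := (integrableOn_rpow_mul_exp_neg (s := s - 1) (by linarith) hω).const_mul M
  refine dominating.mono' (ContinuousOn.aestronglyMeasurable (fun t ht => ?_) measurableSet_Ioi)
    (ae_restrict_of_forall_mem measurableSet_Ioi fun t (ht : 0 < t) => ?_)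
  · exact (continuousAt_id.rpow_const (.inl (ne_of_gt ht))).continuousWithinAt.smul (hc t ht)
  · rw [norm_smul, Real.norm_of_nonneg (by positivity), mul_left_comm]
    exact mul_le_mul_of_nonneg_left (hT t ht.le) (by positivity)

theorem negPow_apply (hs : IsExpStable T) (hc : ContinuousOn T (Ioi 0)) {s : ℝ} (h0 : 0 < s)
    (x : Z) : negPow T s x = (Real.Gamma s)⁻¹ • ∫ t in Ioi (0 : ℝ), t ^ (s - 1) • T t x := by
  rw [negPow_of_pos h0, smul_apply,
    ContinuousLinearMap.integral_apply (integrableOn_rpow_smul_semigroup hs hc h0)]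
  rfl

theorem negPow_one_apply (hs : IsExpStable T) (hc : ContinuousOn T (Ioi 0)) (x : Z) :
    negPow T 1 x = ∫ t in Ioi (0 : ℝ), T t x := by
  simp only [negPow_apply hs hc one_pos, Real.Gamma_one, inv_one, one_smul, sub_self,
    Real.rpow_zero]

theorem integrableOn_semigroup_apply (hs : IsExpStable T) (hc : ContinuousOn T (Ioi 0)) (x : Z) :
    IntegrableOn (fun t : ℝ => T t x) (Ioi 0) := by
  simpa only [IntegrableOn, sub_self, Real.rpow_zero, one_smul] using
    (integrableOn_rpow_smul_semigroup hs hc one_pos).apply_continuousLinearMap x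

variable [CompleteSpace Z]

theorem negPow_add (hT : IsC0Semigroup T) (hs : IsExpStable T) (hc : ContinuousOn T (Ioi 0))
    {a b : ℝ} (ha : 0 ≤ a) (hb : 0 ≤ b) :
    negPow T (a + b) = (negPow T a).comp (negPow T b) := by
  rcases ha.eq_or_lt with rfl | ha
  · rw [zero_add, negPow_zero, ContinuousLinearMap.id_comp]
  rcases hb.eq_or_lt with rfl | hb
  · rw [add_zero, negPow_zero, ContinuousLinearMap.comp_id]
  have convolution := integral_posConvolution (integrableOn_rpow_smul_semigroup hs hc ha)
    (integrableOn_rpow_smul_semigroup hs hc hb) (ContinuousLinearMap.compL ℝ Z Z Z)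
  have beta : ∫ x : ℝ in Ioi 0, ∫ t : ℝ in 0..x, (ContinuousLinearMap.compL ℝ Z Z Z)
        (t ^ (a - 1) • T t) ((x - t) ^ (b - 1) • T (x - t)) =
      ∫ x : ℝ in Ioi 0, (Real.Gamma a * Real.Gamma b / Real.Gamma (a + b)) •
        (x ^ (a + b - 1) • T x) := by
    refine setIntegral_congr_fun measurableSet_Ioi fun x (hx : 0 < x) => ?_
    rw [smul_smul, mul_comm, ← integral_rpow_mul_sub_rpow ha hb hx,
      ← intervalIntegral.integral_smul_const (𝕜 := ℝ)
        (fun t => t ^ (a - 1) * (x - t) ^ (b - 1)) (T x)]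
    refine intervalIntegral.integral_congr fun t ht => ?_
    rw [uIcc_of_le hx.le] at ht
    simp only [ContinuousLinearMap.compL_apply, ContinuousLinearMap.smul_comp,
      ContinuousLinearMap.comp_smul]
    rw [← hT.map_add t (x - t) ht.1 (sub_nonneg.2 ht.2), smul_smul, add_sub_cancel, mul_comm]
  rw [beta, integral_smul, ContinuousLinearMap.compL_apply] at convolution
  rw [negPow_of_pos ha, negPow_of_pos hb, negPow_of_pos (add_pos ha hb),
    ContinuousLinearMap.smul_comp, ContinuousLinearMap.comp_smul, ← convolution, smul_smul,
    smul_smul]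
  congr 1
  field_simp

theorem negPow_negPow_apply (hT : IsC0Semigroup T) (hs : IsExpStable T)
    (hc : ContinuousOn T (Ioi 0)) {a b : ℝ} (ha : 0 ≤ a) (hb : 0 ≤ b) (x : Z) :
    negPow T a (negPow T b x) = negPow T (a + b) x := by
  rw [negPow_add hT hs hc ha hb, ContinuousLinearMap.comp_apply]

theorem semigroup_negPow_comm (hT : IsC0Semigroup T) (hs : IsExpStable T)
    (hc : ContinuousOn T (Ioi 0)) {a : ℝ} (ha : 0 ≤ a) {t : ℝ} (ht : 0 ≤ t) (x : Z) :
    T t (negPow T a x) = negPow T a (T t x) := by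
  rcases ha.eq_or_lt with rfl | ha
  · rw [negPow_zero, ContinuousLinearMap.id_apply, ContinuousLinearMap.id_apply]
  have integrable : IntegrableOn (fun t : ℝ => t ^ (a - 1) • T t x) (Ioi 0) :=
    (integrableOn_rpow_smul_semigroup hs hc ha).apply_continuousLinearMap x
  rw [negPow_apply hs hc ha, negPow_apply hs hc ha, map_smul,
    ← ContinuousLinearMap.integral_comp_comm _ integrable]
  congr 1
  refine setIntegral_congr_fun measurableSet_Ioi fun u hu => ?_
  simp only [map_smul]
  rw [hT.comm_apply ht (le_of_lt hu)]

theorem semigroup_negPow_one (hT : IsC0Semigroup T) (hs : IsExpStable T)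
    (hc : ContinuousOn T (Ioi 0)) {h : ℝ} (hh : 0 ≤ h) (x : Z) :
    T h (negPow T 1 x) = ∫ t in Ioi h, T t x := by
  have shift := (measurePreserving_add_right volume h).setIntegral_preimage_emb
    (measurableEmbedding_addRight h) (fun t => T t x) (Ioi h)
  rw [preimage_add_const_Ioi, sub_self] at shift
  rw [negPow_one_apply hs hc,
    ← ContinuousLinearMap.integral_comp_comm _ (integrableOn_semigroup_apply hs hc x), ← shift]
  exact setIntegral_congr_fun measurableSet_Ioi fun t ht => by
    rw [add_comm, hT.map_add_apply hh (le_of_lt ht)]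

theorem isNegGeneratorRightInverse_negPow_one (hT : IsC0Semigroup T) (hs : IsExpStable T)
    (hc : ContinuousOn T (Ioi 0)) : IsNegGeneratorRightInverse T (negPow T 1) := by
  intro x
  obtain ⟨M, ω, -, -, -, hTM⟩ := hs.exists_bound
  have integrable := integrableOn_semigroup_apply hs hc x
  have derivative : HasDerivWithinAt (fun h => ∫ t in (0 : ℝ)..h, T t x) x (Ioi 0) 0 := by
    have continuousOn := hT.continuousOn hTM x
    have := intervalIntegral.integral_hasDerivWithinAt_right (s := Ici 0) (t := Ioi 0)
      (.refl : IntervalIntegrable (fun t => T t x) volume 0 0)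
      ⟨Ioi 0, self_mem_nhdsWithin, integrable.aestronglyMeasurable⟩
      ((continuousOn 0 self_mem_Ici).mono Ioi_subset_Ici_self)
    simpa only [hT.map_zero_apply] using this.mono Ioi_subset_Ici_self
  rw [hasDerivWithinAt_iff_tendsto_slope' self_notMem_Ioi] at derivative
  refine derivative.neg.congr' ?_
  filter_upwards [self_mem_nhdsWithin] with h (hh : 0 < h)
  rw [slope_def_module, intervalIntegral.integral_same, sub_zero, sub_zero, ← smul_neg,
    semigroup_negPow_one hT hs hc hh.le, negPow_one_apply hs hc,
    ← intervalIntegral.integral_Ioi_sub_Ioi integrable hh.le, neg_sub]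

theorem negPow_one_injective (hT : IsC0Semigroup T) (hs : IsExpStable T)
    (hc : ContinuousOn T (Ioi 0)) : Function.Injective (negPow T 1) := by
  rw [injective_iff_map_eq_zero]
  intro x hx
  have h := isNegGeneratorRightInverse_negPow_one hT hs hc x
  simp only [hx, map_zero, sub_zero, smul_zero] at h
  exact neg_eq_zero.1 (tendsto_nhds_unique h tendsto_const_nhds)

theorem negPow_injective (hT : IsC0Semigroup T) (hs : IsExpStable T)
    (hc : ContinuousOn T (Ioi 0)) {a : ℝ} (ha : 0 ≤ a) (ha1 : a ≤ 1) :
    Function.Injective (negPow T a) := by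
  refine Function.Injective.of_comp (f := negPow T (1 - a)) ?_
  convert negPow_one_injective hT hs hc using 1
  funext x
  rw [Function.comp_apply, negPow_negPow_apply hT hs hc (sub_nonneg.2 ha1) ha, sub_add_cancel]

theorem negPow_denseRange (hT : IsC0Semigroup T) (hs : IsExpStable T)
    (hc : ContinuousOn T (Ioi 0)) {a : ℝ} (ha : 0 ≤ a) (ha1 : a ≤ 1) :
    DenseRange (negPow T a) := by
  intro x
  have approximation := (isNegGeneratorRightInverse_negPow_one hT hs hc x).neg
  rw [neg_neg] at approximation
  refine mem_closure_of_tendsto approximation ?_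
  filter_upwards [self_mem_nhdsWithin] with t ht
  refine ⟨negPow T (1 - a) (-(t⁻¹ • (T t x - x))), ?_⟩
  rw [negPow_negPow_apply hT hs hc ha (sub_nonneg.2 ha1), add_sub_cancel, map_neg, map_smul,
    map_sub, semigroup_negPow_comm hT hs hc zero_le_one (le_of_lt ht)]

theorem IsGenerator.mem_graph_iff {A : Z →ₗ.[ℝ] Z} (hA : IsGenerator A T) (hT : IsC0Semigroup T)
    (hs : IsExpStable T) (hc : ContinuousOn T (Ioi 0)) (x y : Z) :
    (x, y) ∈ A.graph ↔ x = -negPow T 1 y := by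
  rw [hA]
  constructor
  · intro h
    have tendsto_neg := isNegGeneratorRightInverse_negPow_one hT hs hc x
    have tendsto_negPow := ((negPow T 1).continuous.tendsto y).comp h
    rw [← neg_eq_iff_eq_neg]
    refine tendsto_nhds_unique tendsto_neg (tendsto_negPow.congr' ?_)
    filter_upwards [self_mem_nhdsWithin] with t ht
    rw [Function.comp_apply, map_smul, map_sub,
      semigroup_negPow_comm hT hs hc zero_le_one (le_of_lt ht)]
  · rintro rfl
    have tendsto_self := (isNegGeneratorRightInverse_negPow_one hT hs hc y).neg
    rw [neg_neg] at tendsto_self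
    refine tendsto_self.congr fun t => ?_
    rw [← smul_neg, map_neg, neg_sub, neg_sub_neg]

section Derivative

variable {T' : ℝ → Z →L[ℝ] Z}

omit [CompleteSpace Z] in
theorem semigroup_comp_deriv (hT : IsC0Semigroup T)
    (hT' : ∀ t, 0 < t → HasDerivAt T (T' t) t) {t u : ℝ} (ht : 0 < t) (hu : 0 ≤ u) :
    (T u).comp (T' t) = T' (t + u) := by
  have deriv_comp : HasDerivAt (fun s => (T u).comp (T s)) ((T u).comp (T' t)) t :=
    (ContinuousLinearMap.compL ℝ Z Z Z (T u)).hasFDerivAt.comp_hasDerivAt t (hT' t ht)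
  have deriv_shift : HasDerivAt (fun s => T (s + u)) (T' (t + u)) t :=
    (hT' (t + u) (by linarith)).comp_add_const t u
  refine deriv_comp.unique (deriv_shift.congr_of_eventuallyEq ?_)
  filter_upwards [lt_mem_nhds ht] with s hs
  rw [← hT.map_add u s hu hs.le, add_comm]

theorem negPow_one_deriv_apply (hT : IsC0Semigroup T) (hs : IsExpStable T)
    (hc : ContinuousOn T (Ioi 0)) (hT' : ∀ t, 0 < t → HasDerivAt T (T' t) t) {t : ℝ}
    (ht : 0 < t) (x : Z) : negPow T 1 (T' t x) = -T t x := by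
  have slope_tendsto : Tendsto (fun h : ℝ => h⁻¹ • (T (t + h) x - T t x)) (𝓝[>] 0)
      (𝓝 (T' t x)) :=
    HasDerivAt.tendsto_slope_zero_right (f := fun s => T s x)
      ((ContinuousLinearMap.apply ℝ Z x).hasFDerivAt.comp_hasDerivAt t (hT' t ht))
  refine tendsto_nhds_unique ((((negPow T 1).continuous.tendsto _).comp slope_tendsto).congr' ?_)
    (isNegGeneratorRightInverse_negPow_one hT hs hc (T t x))
  filter_upwards [self_mem_nhdsWithin] with h (hh : 0 < h)
  rw [Function.comp_apply, map_smul, map_sub,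
    semigroup_negPow_comm hT hs hc zero_le_one hh.le, ← hT.map_add_apply hh.le ht.le, add_comm]

theorem negPow_comp_deriv (hT : IsC0Semigroup T) (hs : IsExpStable T)
    (hc : ContinuousOn T (Ioi 0)) (hT' : ∀ t, 0 < t → HasDerivAt T (T' t) t) {s t : ℝ}
    (h0 : 0 < s) (ht : 0 < t) :
    (negPow T s).comp (T' t) =
      (Real.Gamma s)⁻¹ • ∫ u in Ioi (0 : ℝ), u ^ (s - 1) • T' (t + u) := by
  have comp_integral := ((ContinuousLinearMap.compL ℝ Z Z Z).flip (T' t)).integral_comp_comm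
    (integrableOn_rpow_smul_semigroup hs hc h0)
  rw [negPow_of_pos h0, ContinuousLinearMap.smul_comp]
  congr 1
  refine comp_integral.symm.trans
    (setIntegral_congr_fun measurableSet_Ioi fun u (hu : 0 < u) => ?_)
  simp only [ContinuousLinearMap.flip_apply, ContinuousLinearMap.compL_apply,
    ContinuousLinearMap.smul_comp, semigroup_comp_deriv hT hT' ht hu.le]

theorem norm_negPow_comp_deriv_le (hT : IsC0Semigroup T) (hs : IsExpStable T)
    (hc : ContinuousOn T (Ioi 0)) (hT' : ∀ t, 0 < t → HasDerivAt T (T' t) t) {c : ℝ}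
    (hbound : ∀ t, 0 < t → ‖T' t‖ ≤ c / t) {a t : ℝ} (ha : 0 < a) (ha1 : a < 1) (ht : 0 < t) :
    ‖(negPow T (1 - a)).comp (T' t)‖ ≤
      (Real.Gamma (1 - a))⁻¹ * (c * ∫ v in Ioi (0 : ℝ), v ^ (-a) * (1 + v)⁻¹) * t ^ (-a) := by
  rw [negPow_comp_deriv hT hs hc hT' (sub_pos.2 ha1) ht, norm_smul,
    Real.norm_of_nonneg (inv_nonneg.2 (Real.Gamma_pos_of_pos (sub_pos.2 ha1)).le),
    mul_assoc, mul_assoc, ← integral_rpow_neg_mul_inv_add a ht,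
    ← integral_const_mul]
  refine mul_le_mul_of_nonneg_left ?_
    (inv_nonneg.2 (Real.Gamma_pos_of_pos (sub_pos.2 ha1)).le)
  refine norm_integral_le_of_norm_le ((integrableOn_rpow_neg_mul_inv_add ha ha1 ht).const_mul c)
    (ae_restrict_of_forall_mem measurableSet_Ioi fun u (hu : 0 < u) => ?_)
  rw [sub_sub_cancel_left, norm_smul, Real.norm_of_nonneg (by positivity), mul_left_comm]
  exact mul_le_mul_of_nonneg_left (hbound _ (by linarith)) (by positivity)

theorem exists_isSmoothingLift_negPow (hT : IsC0Semigroup T) (hs : IsExpStable T)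
    (hT' : ∀ t, 0 < t → HasDerivAt T (T' t) t) {c : ℝ}
    (hbound : ∀ t, 0 < t → ‖T' t‖ ≤ c / t) {a : ℝ} (ha : 0 < a) (ha1 : a < 1) :
    ∃ (W : ℝ → Z →L[ℝ] Z) (M : ℝ), 0 ≤ M ∧ IsSmoothingLift (negPow T a) T W ∧
      ∀ t, 0 < t → ‖W t‖ ≤ M * t ^ (-a) := by
  have hc : ContinuousOn T (Ioi 0) := fun t ht => (hT' t ht).continuousAt.continuousWithinAt
  have norm_le := fun t (ht : 0 < t) => norm_negPow_comp_deriv_le hT hs hc hT' hbound ha ha1 ht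
  refine ⟨fun t => -(negPow T (1 - a)).comp (T' t),
    (Real.Gamma (1 - a))⁻¹ * (c * ∫ v in Ioi (0 : ℝ), v ^ (-a) * (1 + v)⁻¹), ?_,
    fun t ht x => ?_, fun t ht => ?_⟩
  · simpa only [Real.one_rpow, mul_one] using (norm_nonneg _).trans (norm_le 1 one_pos)
  · rw [neg_apply, map_neg, ContinuousLinearMap.comp_apply,
      negPow_negPow_apply hT hs hc ha.le (sub_nonneg.2 ha1.le), add_sub_cancel,
      negPow_one_deriv_apply hT hs hc hT' ht, neg_neg]
  · rw [norm_neg]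
    exact norm_le t ht

end Derivative

end NegPow

/-! ### Rank one perturbations of a smoothing semigroup -/

section SingularKernels

variable {a x : ℝ}

theorem exists_integral_rpow_neg_mul_sub_rpow_neg (ha : a < 1) :
    ∃ κ : ℝ, 0 < κ ∧ ∀ x : ℝ, 0 < x →
      ∫ t in (0 : ℝ)..x, t ^ (-a) * (x - t) ^ (-a) = κ * x ^ (1 - a) * x ^ (-a) := by
  have h1 : 0 < 1 - a := sub_pos.2 ha
  refine ⟨Real.Gamma (1 - a) * Real.Gamma (1 - a) / Real.Gamma (1 - a + (1 - a)), ?_,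
    fun x hx => ?_⟩
  · have := Real.Gamma_pos_of_pos h1
    have := Real.Gamma_pos_of_pos (add_pos h1 h1)
    positivity
  · have h := integral_rpow_mul_sub_rpow h1 h1 hx
    rw [show 1 - a - 1 = -a by ring] at h
    rw [h, mul_assoc, ← Real.rpow_add hx, mul_comm]
    congr 2
    ring

theorem intervalIntegrable_rpow_neg_mul_sub_rpow_neg (ha : a < 1) (hx : 0 < x) :
    IntervalIntegrable (fun t : ℝ => t ^ (-a) * (x - t) ^ (-a)) volume 0 x := by
  obtain ⟨κ, hκ, h⟩ := exists_integral_rpow_neg_mul_sub_rpow_neg ha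
  refine intervalIntegral.intervalIntegrable_of_integral_ne_zero (ne_of_gt ?_)
  rw [h x hx]
  positivity

variable {E : Type*} [NormedAddCommGroup E] [NormedSpace ℝ E] {η : ℝ → ℝ} {w : ℝ → E} {t K B : ℝ}

theorem ae_norm_smul_sub_le (hη : ∀ τ ∈ Ioo 0 t, |η τ| ≤ K * τ ^ (-a))
    (hw : ∀ τ ∈ Ioo 0 t, ‖w τ‖ ≤ B * τ ^ (-a)) :
    ∀ᵐ τ, τ ∈ Ioc 0 t → ‖η τ • w (t - τ)‖ ≤ K * B * (τ ^ (-a) * (t - τ) ^ (-a)) := by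
  filter_upwards [compl_mem_ae_iff.2 (measure_singleton t)] with τ hne hτ
  have hτt : τ < t := lt_of_le_of_ne hτ.2 hne
  have bound := hη τ ⟨hτ.1, hτt⟩
  calc ‖η τ • w (t - τ)‖ = |η τ| * ‖w (t - τ)‖ := by rw [norm_smul, Real.norm_eq_abs]
    _ ≤ (K * τ ^ (-a)) * (B * (t - τ) ^ (-a)) :=
        mul_le_mul bound (hw _ ⟨sub_pos.2 hτt, sub_lt_self t hτ.1⟩) (norm_nonneg _)
          ((abs_nonneg _).trans bound)
    _ = K * B * (τ ^ (-a) * (t - τ) ^ (-a)) := by ring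

theorem intervalIntegrable_smul_sub_of_le_rpow_neg (ha : a < 1) (ht : 0 < t)
    (hηc : ContinuousOn η (Ioo 0 t)) (hwc : ContinuousOn w (Ioo 0 t))
    (hη : ∀ τ ∈ Ioo 0 t, |η τ| ≤ K * τ ^ (-a)) (hw : ∀ τ ∈ Ioo 0 t, ‖w τ‖ ≤ B * τ ^ (-a)) :
    IntervalIntegrable (fun τ => η τ • w (t - τ)) volume 0 t := by
  have dominating := (intervalIntegrable_rpow_neg_mul_sub_rpow_neg ha ht).const_mul (K * B)
  rw [intervalIntegrable_iff_integrableOn_Ioc_of_le ht.le] at dominating ⊢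
  refine dominating.mono' ?_ ((ae_restrict_iff' measurableSet_Ioc).2 (ae_norm_smul_sub_le hη hw))
  rw [← restrict_Ioo_eq_restrict_Ioc]
  refine ContinuousOn.aestronglyMeasurable (hηc.smul (hwc.comp ?_ ?_)) measurableSet_Ioo
  · exact (continuous_const.sub continuous_id).continuousOn
  · exact fun τ hτ => ⟨sub_pos.2 hτ.2, sub_lt_self t hτ.1⟩

theorem norm_integral_smul_sub_le (ha : a < 1) (ht : 0 < t)
    (hη : ∀ τ ∈ Ioo 0 t, |η τ| ≤ K * τ ^ (-a)) (hw : ∀ τ ∈ Ioo 0 t, ‖w τ‖ ≤ B * τ ^ (-a)) :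
    ‖∫ τ in (0 : ℝ)..t, η τ • w (t - τ)‖ ≤
      K * B * ∫ τ in (0 : ℝ)..t, τ ^ (-a) * (t - τ) ^ (-a) := by
  rw [← intervalIntegral.integral_const_mul]
  exact intervalIntegral.norm_integral_le_of_norm_le ht.le (ae_norm_smul_sub_le hη hw)
    ((intervalIntegrable_rpow_neg_mul_sub_rpow_neg ha ht).const_mul _)

/-- If `K τ^{-a}` is the best bound for `y` on `(0, t₀]`, then the improved bound at the point where
it is attained shows that `K ≤ A + K / 2`. -/
theorem abs_le_rpow_neg_of_bootstrap {y : ℝ → ℝ} {A δ t₀ : ℝ} (ha : 0 < a) (ha1 : a < 1)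
    (hA : 0 ≤ A) (hδ : 0 ≤ δ) (ht₀ : 0 < t₀) (hsmall : δ * t₀ ^ (1 - a) ≤ 1 / 2)
    (hy : ContinuousOn y (Icc 0 t₀))
    (improve : ∀ s ∈ Ioc 0 t₀, ∀ K, (∀ τ ∈ Ioc 0 s, |y τ| ≤ K * τ ^ (-a)) →
      |y s| ≤ (A + K * (δ * s ^ (1 - a))) * s ^ (-a)) :
    ∀ t ∈ Ioc 0 t₀, |y t| ≤ 2 * A * t ^ (-a) := by
  obtain ⟨s, hs, hmax⟩ := isCompact_Icc.exists_isMaxOn (nonempty_Icc.2 ht₀.le)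
    (f := fun τ => τ ^ a * |y τ|) ((Real.continuous_rpow_const ha.le).continuousOn.mul hy.abs)
  set K := s ^ a * |y s| with hK
  have best (t) (ht : t ∈ Ioc 0 t₀) : |y t| ≤ K * t ^ (-a) := by
    have ht0 : 0 < t := ht.1
    rw [Real.rpow_neg ht0.le, ← div_eq_mul_inv, le_div_iff₀ (by positivity), mul_comm]
    exact hmax (a := t) ⟨ht0.le, ht.2⟩
  suffices hKA : K ≤ 2 * A by
    exact fun t ht => (best t ht).trans
      (mul_le_mul_of_nonneg_right hKA (Real.rpow_nonneg ht.1.le _))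
  rcases hs.1.eq_or_lt with rfl | hs0
  · rw [hK, Real.zero_rpow ha.ne', zero_mul]
    positivity
  have improved := improve s ⟨hs0, hs.2⟩ K fun τ hτ => best τ ⟨hτ.1, hτ.2.trans hs.2⟩
  rw [Real.rpow_neg hs0.le, ← div_eq_mul_inv, le_div_iff₀ (by positivity), mul_comm,
    ← hK] at improved
  have small : δ * s ^ (1 - a) ≤ 1 / 2 :=
    (mul_le_mul_of_nonneg_left
      (Real.rpow_le_rpow hs0.le hs.2 (sub_pos.2 ha1).le) hδ).trans hsmall
  have hK0 : 0 ≤ K := by positivity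
  nlinarith

theorem exists_mul_rpow_le (ha : a < 1) (δ : ℝ) :
    ∃ t₀ : ℝ, 0 < t₀ ∧ δ * t₀ ^ (1 - a) ≤ 1 / 2 := by
  have tendsto_zero : Tendsto (fun t : ℝ => δ * t ^ (1 - a)) (𝓝[>] 0) (𝓝 0) := by
    have := ((Real.continuous_rpow_const (sub_pos.2 ha).le).const_mul δ).tendsto 0
    rw [Real.zero_rpow (sub_pos.2 ha).ne', mul_zero] at this
    exact this.mono_left nhdsWithin_le_nhds
  obtain ⟨t, hsmall, hpos⟩ := ((tendsto_zero.eventually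
    (ge_mem_nhds (show (0 : ℝ) < 1 / 2 by norm_num))).and self_mem_nhdsWithin).exists
  exact ⟨t, hpos, hsmall⟩

end SingularKernels

theorem tendsto_sub_nhdsGT (τ : ℝ) : Tendsto (fun s => s - τ) (𝓝[>] τ) (𝓝[>] 0) := by
  refine tendsto_nhdsWithin_iff.2 ⟨?_, ?_⟩
  · exact ((continuous_sub_right τ).tendsto' τ 0 (sub_self τ)).mono_left nhdsWithin_le_nhds
  · filter_upwards [self_mem_nhdsWithin] with s (hs : τ < s)
    exact sub_pos.2 hs

namespace IsC0Semigroup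

variable {X : Type*} [NormedAddCommGroup X] [NormedSpace ℝ X] {U S : ℝ → X →L[ℝ] X}
  (hU : IsC0Semigroup U) (hS : IsC0Semigroup S) {M t : ℝ} {x : X}
include hU hS

theorem hasDerivWithinAt_comp (hM : ∀ t, 0 ≤ t → ‖U t‖ ≤ M) {τ : ℝ} {g : X} (h0 : 0 ≤ τ)
    (h1 : τ < t)
    (hg : Tendsto (fun h : ℝ => h⁻¹ • (S h (S τ x) - U h (S τ x))) (𝓝[>] 0) (𝓝 g)) :
    HasDerivWithinAt (fun τ => U (t - τ) (S τ x)) (U (t - τ) g) (Ioi τ) τ := by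
  rw [hasDerivWithinAt_iff_tendsto_slope' self_notMem_Ioi]
  have time_tendsto : Tendsto (fun s : ℝ => t - s) (𝓝[>] τ) (𝓝 (t - τ)) :=
    ((continuous_const.sub continuous_id).tendsto τ).mono_left nhdsWithin_le_nhds
  have apply_continuousAt : ContinuousAt (fun q : ℝ × X => U q.1 q.2) (t - τ, g) :=
    (hU.continuousOn_uncurry hM).continuousAt
      (prod_mem_nhds (Ici_mem_nhds (sub_pos.2 h1)) univ_mem)
  refine (Tendsto.comp (g := fun q : ℝ × X => U q.1 q.2) apply_continuousAt
    (time_tendsto.prodMk_nhds (hg.comp (tendsto_sub_nhdsGT τ)))).congr' ?_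
  filter_upwards [self_mem_nhdsWithin, mem_nhdsWithin_of_mem_nhds (Iio_mem_nhds h1)]
    with s (hs : τ < s) (hst : s < t)
  rw [Function.comp_apply, slope_def_module, Function.comp_apply, map_smul, map_sub]
  congr 2
  · rw [← hS.map_add_apply (sub_nonneg.2 hs.le) h0, sub_add_cancel]
  · rw [← hU.map_add_apply (sub_nonneg.2 hst.le) (sub_nonneg.2 hs.le), sub_add_sub_cancel]

theorem apply_sub_apply_eq_integral [CompleteSpace X] (hM : ∀ t, 0 ≤ t → ‖U t‖ ≤ M) {M' : ℝ}
    (hM' : ∀ t, 0 ≤ t → ‖S t‖ ≤ M') (ht : 0 ≤ t) {g : ℝ → X} (hgc : ContinuousOn g (Icc 0 t))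
    (hg : ∀ τ, 0 ≤ τ →
      Tendsto (fun h : ℝ => h⁻¹ • (S h (S τ x) - U h (S τ x))) (𝓝[>] 0) (𝓝 (g τ))) :
    S t x - U t x = ∫ τ in (0 : ℝ)..t, U (t - τ) (g τ) := by
  have continuousOn_apply {y : ℝ → X} (hy : ContinuousOn y (Icc 0 t)) :
      ContinuousOn (fun τ => U (t - τ) (y τ)) (uIcc 0 t) := by
    rw [uIcc_of_le ht]
    exact (hU.continuousOn_uncurry hM).comp (g := fun q : ℝ × X => U q.1 q.2)
      ((continuous_const.sub continuous_id).continuousOn.prodMk hy)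
      fun τ hτ => ⟨mem_Ici.2 (sub_nonneg.2 hτ.2), mem_univ _⟩
  rw [intervalIntegral.integral_eq_sub_of_hasDeriv_right (f := fun τ => U (t - τ) (S τ x))
    (continuousOn_apply ((hS.continuousOn hM' x).mono fun τ hτ => hτ.1)) (fun τ hτ => ?_)
    (continuousOn_apply hgc).intervalIntegrable, sub_self, sub_zero, hU.map_zero_apply,
    hS.map_zero_apply]
  rw [min_eq_left ht, max_eq_right ht] at hτ
  exact hU.hasDerivWithinAt_comp hS hM hτ.1.le hτ.2 (hg τ hτ.1.le)

end IsC0Semigroup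

section RankOneInverse

variable {Z X : Type*} [NormedAddCommGroup Z] [NormedSpace ℝ Z] [NormedAddCommGroup X]
  [NormedSpace ℝ X] {N : X →L[ℝ] X} {V : X →L[ℝ] Z} {c : Z →L[ℝ] ℝ} {b : X} {β : ℝ}

/-- The operator `N (I - (1 - β) b ⊗ cV)`. If `N = (-A)⁻¹`, `cV = C(-A)⁻¹` and `C(-A)⁻¹b = 1`, this
is the inverse of `-A_β`, where `A_β = A - ((1 - β)/β) b ⊗ C`. -/
def rankOneInverse (N : X →L[ℝ] X) (V : X →L[ℝ] Z) (c : Z →L[ℝ] ℝ) (b : X) (β : ℝ) : X →L[ℝ] X :=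
  N.comp (ContinuousLinearMap.id ℝ X - ((1 - β) • c.comp V).smulRight b)

theorem rankOneInverse_apply (x : X) :
    rankOneInverse N V c b β x = N (x - ((1 - β) * c (V x)) • b) := rfl

theorem denseRange_rankOneInverse (hN : DenseRange N) (hb : c (V b) = 1) (hβ : β ≠ 0) :
    DenseRange (rankOneInverse N V c b β) := by
  refine Dense.mono ?_ hN
  rintro _ ⟨q, rfl⟩
  refine ⟨q + ((1 - β) / β * c (V q)) • b, ?_⟩
  have coefficient : (1 - β) * c (V (q + ((1 - β) / β * c (V q)) • b)) = (1 - β) / β * c (V q) := by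
    rw [map_add, map_smul, map_add, map_smul, hb, smul_eq_mul, mul_one]
    field_simp
    ring
  rw [rankOneInverse_apply, coefficient, add_sub_cancel_right]

end RankOneInverse

/-- A semigroup `S` on `X` whose generator is a rank one perturbation of the generator of a
semigroup `U` that smooths into the range of `Q`: the generators of `U` and `S` have the inverses
`-N` and `-N (I - (1 - β) b ⊗ cV)`. In the application, `Q` is the inclusion of the domain of the
unbounded functional `c`, so that `cV = c Q⁻¹ N`. -/
structure RankOnePerturbation {Z X : Type*} [NormedAddCommGroup Z] [NormedSpace ℝ Z]
    [NormedAddCommGroup X] [NormedSpace ℝ X] (U : ℝ → X →L[ℝ] X) (N : X →L[ℝ] X) (Q : Z →L[ℝ] X)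
    (W : ℝ → X →L[ℝ] Z) (V : X →L[ℝ] Z) (c : Z →L[ℝ] ℝ) (b : X) (β a : ℝ)
    (S : ℝ → X →L[ℝ] X) : Prop where
  semigroup : IsC0Semigroup U
  bounded : ∃ M, ∀ t, 0 ≤ t → ‖U t‖ ≤ M
  rightInverse : IsNegGeneratorRightInverse U N
  injective : Function.Injective Q
  lift : IsSmoothingLift Q U W
  lift_bound : ∃ M, 0 ≤ M ∧ ∀ t, 0 < t → ‖W t‖ ≤ M * t ^ (-a)
  factor : ∀ x, Q (V x) = N x
  dense : DenseRange N
  normalized : c (V b) = 1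
  β_pos : 0 < β
  a_pos : 0 < a
  a_lt_one : a < 1
  perturbed_semigroup : IsC0Semigroup S
  perturbed_stable : IsExpStable S
  perturbed_rightInverse : IsNegGeneratorRightInverse S (rankOneInverse N V c b β)
  perturbed_comm : ∀ t, 0 ≤ t → ∀ x,
    S t (rankOneInverse N V c b β x) = rankOneInverse N V c b β (S t x)

theorem exists_lift_of_denseRange {X Y Y' Z : Type*} [NormedAddCommGroup X] [NormedSpace ℝ X]
    [NormedAddCommGroup Y] [NormedSpace ℝ Y] [AddCommGroup Y'] [Module ℝ Y']
    [NormedAddCommGroup Z] [NormedSpace ℝ Z] [CompleteSpace Z] {Q : Z →L[ℝ] X}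
    (hQ : Function.Injective Q) (S : Y →L[ℝ] X) {i : Y' →ₗ[ℝ] Y} (hi : DenseRange i) {K : ℝ}
    (hK : 0 ≤ K) (h : ∀ p, ∃ y, Q y = S (i p) ∧ ‖y‖ ≤ K * ‖i p‖) :
    ∃ R : Y →L[ℝ] Z, (∀ x, Q (R x) = S x) ∧ ‖R‖ ≤ K := by
  choose g hg hgK using h
  let f : Y' →ₗ[ℝ] Z :=
    { toFun := g
      map_add' := fun x y => hQ (by simp only [hg, map_add])
      map_smul' := fun r x => hQ (by simp only [hg, map_smul, RingHom.id_apply]) }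
  refine ⟨f.extendOfNorm i, fun x => ?_, LinearMap.opNorm_extendOfNorm_le hi hK hgK⟩
  refine hi.induction_on (p := fun x => Q (f.extendOfNorm i x) = S x) x
    (isClosed_eq (by fun_prop) (by fun_prop)) fun p => ?_
  rw [LinearMap.extendOfNorm_eq hi ⟨K, hgK⟩]
  exact hg p

/-- A smoothing lift up to time `t₀` is prolonged by `R(t) = R(t₀) S(t - t₀)`. -/
theorem exists_isSmoothingLift_of_le {X Z : Type*} [NormedAddCommGroup X] [NormedSpace ℝ X]
    [NormedAddCommGroup Z] [NormedSpace ℝ Z] {Q : Z →L[ℝ] X} {S : ℝ → X →L[ℝ] X}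
    (hS : IsC0Semigroup S) (hs : IsExpStable S) {a t₀ M : ℝ} (ht₀ : 0 < t₀) (hM : 0 ≤ M)
    (h : ∀ t, 0 < t → t ≤ t₀ → ∃ R : X →L[ℝ] Z, (∀ x, Q (R x) = S t x) ∧ ‖R‖ ≤ M * t ^ (-a)) :
    ∃ (R : ℝ → X →L[ℝ] Z) (M ω : ℝ), 0 < ω ∧ IsSmoothingLift Q S R ∧
      ∀ t, 0 < t → ‖R t‖ ≤ M * ((t ^ (-a) + 1) * Real.exp (-ω * t)) := by
  obtain ⟨M', ω, -, hω, hM', -⟩ := hs.exists_bound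
  obtain ⟨R₀, hR₀, -⟩ := h t₀ ht₀ le_rfl
  choose! R hR hRM using h
  set D := max M (‖R₀‖ * M') * Real.exp (ω * t₀) with hD
  have bound {t m k : ℝ} (hm' : m ≤ max M (‖R₀‖ * M')) (hk : 0 ≤ k)
      (hk' : k ≤ t ^ (-a) + 1) :
      m * k * Real.exp (-ω * (t - t₀)) ≤ D * ((t ^ (-a) + 1) * Real.exp (-ω * t)) := by
    calc m * k * Real.exp (-ω * (t - t₀))
        ≤ max M (‖R₀‖ * M') * (t ^ (-a) + 1) * Real.exp (-ω * (t - t₀)) := by gcongr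
      _ = D * ((t ^ (-a) + 1) * Real.exp (-ω * t)) := by
          rw [hD, show -ω * (t - t₀) = ω * t₀ + -ω * t by ring, Real.exp_add]
          ring
  refine ⟨fun t => if t ≤ t₀ then R t else R₀.comp (S (t - t₀)), D, ω, hω,
    fun t ht x => ?_, fun t ht => ?_⟩
  · beta_reduce
    split_ifs with hle
    · exact hR t ht hle x
    · rw [ContinuousLinearMap.comp_apply, hR₀, ← hS.map_add_apply ht₀.le (by linarith),
        add_sub_cancel]
  · beta_reduce
    have hpow : 0 < t ^ (-a) := by positivity
    split_ifs with hle
    · refine (hRM t ht hle).trans (le_trans (le_mul_of_one_le_right (by positivity) ?_)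
        (bound (le_max_left _ _) hpow.le (by linarith)))
      exact Real.one_le_exp (by nlinarith)
    · calc ‖R₀.comp (S (t - t₀))‖ ≤ ‖R₀‖ * (M' * Real.exp (-ω * (t - t₀))) :=
            (ContinuousLinearMap.opNorm_comp_le _ _).trans
              (mul_le_mul_of_nonneg_left (hM' _ (by linarith)) (norm_nonneg _))
        _ = ‖R₀‖ * M' * 1 * Real.exp (-ω * (t - t₀)) := by ring
        _ ≤ _ := bound (le_max_right _ _) zero_le_one (by linarith)

namespace RankOnePerturbation

variable {Z X : Type*} [NormedAddCommGroup Z] [NormedSpace ℝ Z] [NormedAddCommGroup X]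
  [NormedSpace ℝ X] {U : ℝ → X →L[ℝ] X} {N : X →L[ℝ] X} {Q : Z →L[ℝ] X} {W : ℝ → X →L[ℝ] Z}
  {V : X →L[ℝ] Z} {c : Z →L[ℝ] ℝ} {b : X} {β a : ℝ} {S : ℝ → X →L[ℝ] X}

theorem abs_coefficient_le {s K : ℝ} {p : X}
    (hK : ∀ τ ∈ Ioc 0 s, |c (V (S τ p))| ≤ K * τ ^ (-a)) :
    ∀ τ ∈ Ioo 0 s, |(1 - β) * c (V (S τ p))| ≤ |1 - β| * K * τ ^ (-a) := by
  intro τ hτ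
  rw [abs_mul, mul_assoc]
  exact mul_le_mul_of_nonneg_left (hK τ ⟨hτ.1, hτ.2.le⟩) (abs_nonneg _)

theorem norm_lift_apply_le {M τ : ℝ} (hM : ‖W τ‖ ≤ M * τ ^ (-a)) (y : X) :
    ‖W τ y‖ ≤ M * ‖y‖ * τ ^ (-a) :=
  ((W τ).le_of_opNorm_le hM y).trans_eq (by ring)

variable (H : RankOnePerturbation U N Q W V c b β a S)
include H

theorem continuousOn_output (p : X) : ContinuousOn (fun τ => c (V (S τ p))) (Ici 0) := by
  obtain ⟨M, ω, -, -, -, hM⟩ := H.perturbed_stable.exists_bound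
  exact (c.comp V).continuous.comp_continuousOn (H.perturbed_semigroup.continuousOn hM p)

theorem apply_eq_of_map_eq {s : ℝ} (hs : 0 ≤ s) {p : X} {u : Z}
    (hu : Q u = S s (rankOneInverse N V c b β p)) : c u = β * c (V (S s p)) := by
  rw [H.perturbed_comm s hs, rankOneInverse_apply, ← H.factor] at hu
  rw [H.injective hu, map_sub, map_sub, map_smul, map_smul, H.normalized, smul_eq_mul]
  ring

theorem tendsto_sub_semigroup (q : X) :
    Tendsto (fun h : ℝ => h⁻¹ • (S h (rankOneInverse N V c b β q) -
      U h (rankOneInverse N V c b β q))) (𝓝[>] 0) (𝓝 (-(((1 - β) * c (V q)) • b))) := by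
  have h := (H.perturbed_rightInverse q).sub (H.rightInverse (q - ((1 - β) * c (V q)) • b))
  rw [show -q - -(q - ((1 - β) * c (V q)) • b) = -(((1 - β) * c (V q)) • b) by abel] at h
  refine h.congr fun h => ?_
  rw [rankOneInverse_apply, ← smul_sub, sub_sub_sub_cancel_right]

theorem duhamel [CompleteSpace X] {t : ℝ} (ht : 0 ≤ t) (p : X) :
    S t (rankOneInverse N V c b β p) = U t (rankOneInverse N V c b β p) -
      ∫ τ in (0 : ℝ)..t, ((1 - β) * c (V (S τ p))) • U (t - τ) b := by
  obtain ⟨M, hM⟩ := H.bounded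
  obtain ⟨M', ω, -, -, -, hM'⟩ := H.perturbed_stable.exists_bound
  have continuousOn : ContinuousOn (fun τ => -(((1 - β) * c (V (S τ p))) • b)) (Icc 0 t) :=
    ((((H.continuousOn_output p).const_smul (1 - β)).smul continuousOn_const).neg).mono
      Icc_subset_Ici_self
  have h := H.semigroup.apply_sub_apply_eq_integral H.perturbed_semigroup hM hM' ht continuousOn
    (x := rankOneInverse N V c b β p) fun τ hτ => by
      rw [H.perturbed_comm τ hτ]
      exact H.tendsto_sub_semigroup (S τ p)
  simp only [map_neg, map_smul, intervalIntegral.integral_neg] at h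
  rw [sub_eq_iff_eq_add.1 h]
  abel

variable [CompleteSpace Z] [CompleteSpace X]

theorem map_lift_sub_integral {s K : ℝ} {p : X} (hs : 0 < s)
    (hK : ∀ τ ∈ Ioc 0 s, |c (V (S τ p))| ≤ K * τ ^ (-a)) :
    Q (W s (rankOneInverse N V c b β p) -
        ∫ τ in (0 : ℝ)..s, ((1 - β) * c (V (S τ p))) • W (s - τ) b) =
      S s (rankOneInverse N V c b β p) := by
  obtain ⟨MU, hMU⟩ := H.bounded
  obtain ⟨M, -, hM⟩ := H.lift_bound
  have coefficient_continuousOn : ContinuousOn (fun τ => (1 - β) * c (V (S τ p))) (Ioo 0 s) :=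
    (continuousOn_const.mul (H.continuousOn_output p)).mono fun τ hτ => hτ.1.le
  have lift_continuousOn : ContinuousOn (fun τ => W τ b) (Ioo 0 s) :=
    (H.lift.continuousOn_uncurry H.injective H.semigroup hMU).comp
      (g := fun q : ℝ × X => W q.1 q.2) (f := fun τ => (τ, b)) (by fun_prop)
      fun τ hτ => ⟨hτ.1, mem_univ _⟩
  have integrable := intervalIntegrable_smul_sub_of_le_rpow_neg H.a_lt_one hs
    coefficient_continuousOn lift_continuousOn (abs_coefficient_le hK)
    fun τ hτ => norm_lift_apply_le (hM τ hτ.1) b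
  rw [map_sub, H.lift s hs, H.duhamel hs.le,
    ← ContinuousLinearMap.intervalIntegral_comp_comm Q integrable]
  congr 1
  refine intervalIntegral.integral_congr_ae ?_
  filter_upwards [compl_mem_ae_iff.2 (measure_singleton s)] with τ hne hτ
  rw [uIoc_of_le hs.le] at hτ
  rw [map_smul, H.lift _ (sub_pos.2 (lt_of_le_of_ne hτ.2 hne))]

theorem exists_lift_of_output_le : ∃ L : ℝ, 0 ≤ L ∧ ∀ s, 0 < s → ∀ p K,
    (∀ τ ∈ Ioc 0 s, |c (V (S τ p))| ≤ K * τ ^ (-a)) →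
      ∃ u : Z, Q u = S s (rankOneInverse N V c b β p) ∧
        ‖u‖ ≤ L * (‖rankOneInverse N V c b β p‖ + K * s ^ (1 - a)) * s ^ (-a) := by
  obtain ⟨M, hM0, hM⟩ := H.lift_bound
  obtain ⟨κ, hκ, hκI⟩ := exists_integral_rpow_neg_mul_sub_rpow_neg H.a_lt_one
  refine ⟨M + |1 - β| * (M * ‖b‖) * κ, by positivity, fun s hs p K hK =>
    ⟨_, H.map_lift_sub_integral hs hK, ?_⟩⟩
  set x := rankOneInverse N V c b β p
  have integral_le := norm_integral_smul_sub_le (w := fun τ => W τ b) H.a_lt_one hs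
    (abs_coefficient_le (β := β) hK) fun τ hτ => norm_lift_apply_le (hM τ hτ.1) b
  rw [hκI s hs] at integral_le
  have hK0 : 0 ≤ K * s ^ (-a) := (abs_nonneg _).trans (hK s ⟨hs, le_rfl⟩)
  have cross_terms_nonneg : 0 ≤ M * (K * s ^ (-a)) * s ^ (1 - a) +
      |1 - β| * (M * ‖b‖) * κ * ‖x‖ * s ^ (-a) := by positivity
  refine (norm_sub_le _ _).trans
    ((add_le_add (norm_lift_apply_le (hM s hs) x) integral_le).trans ?_)
  linarith

theorem exists_lift_of_small_time : ∃ t₀ M : ℝ, 0 < t₀ ∧ 0 ≤ M ∧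
    ∀ t, 0 < t → t ≤ t₀ → ∀ p, ∃ u : Z, Q u = S t (rankOneInverse N V c b β p) ∧
      ‖u‖ ≤ M * t ^ (-a) * ‖rankOneInverse N V c b β p‖ := by
  obtain ⟨L, hL0, hL⟩ := H.exists_lift_of_output_le
  have hβ := H.β_pos
  set δ := β⁻¹ * (‖c‖ * L) with hδ
  have hδ0 : 0 ≤ δ := by positivity
  obtain ⟨t₀, ht₀, hsmall⟩ := exists_mul_rpow_le H.a_lt_one δ
  refine ⟨t₀, 2 * L, ht₀, by positivity, fun t ht htt p => ?_⟩
  set x := rankOneInverse N V c b β p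
  have output_le := abs_le_rpow_neg_of_bootstrap (y := fun τ => c (V (S τ p))) (A := δ * ‖x‖)
    H.a_pos H.a_lt_one (by positivity) hδ0 ht₀ hsmall
    ((H.continuousOn_output p).mono Icc_subset_Ici_self) fun s hs K hK => by
      obtain ⟨u, hu, hu_le⟩ := hL s hs.1 p K hK
      calc |c (V (S s p))| = β⁻¹ * |c u| := by
            rw [H.apply_eq_of_map_eq hs.1.le hu, abs_mul, abs_of_pos hβ,
              inv_mul_cancel_left₀ hβ.ne']
        _ ≤ β⁻¹ * (‖c‖ * (L * (‖x‖ + K * s ^ (1 - a)) * s ^ (-a))) := by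
            gcongr
            exact c.le_opNorm_of_le hu_le
        _ = (δ * ‖x‖ + K * (δ * s ^ (1 - a))) * s ^ (-a) := by rw [hδ]; ring
  obtain ⟨u, hu, hu_le⟩ := hL t ht p _ fun τ hτ => output_le τ ⟨hτ.1, hτ.2.trans htt⟩
  refine ⟨u, hu, hu_le.trans ?_⟩
  have small : δ * t ^ (1 - a) ≤ 1 / 2 := (mul_le_mul_of_nonneg_left
    (Real.rpow_le_rpow ht.le htt (sub_pos.2 H.a_lt_one).le) hδ0).trans hsmall
  calc L * (‖x‖ + 2 * (δ * ‖x‖) * t ^ (1 - a)) * t ^ (-a)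
      = L * (‖x‖ * (1 + 2 * (δ * t ^ (1 - a)))) * t ^ (-a) := by ring
    _ ≤ L * (‖x‖ * (1 + 2 * (1 / 2))) * t ^ (-a) := by gcongr
    _ = 2 * L * t ^ (-a) * ‖x‖ := by ring

theorem exists_isSmoothingLift : ∃ (R : ℝ → X →L[ℝ] Z) (M ω : ℝ), 0 < ω ∧
    IsSmoothingLift Q S R ∧ ∀ t, 0 < t → ‖R t‖ ≤ M * ((t ^ (-a) + 1) * Real.exp (-ω * t)) := by
  obtain ⟨t₀, M, ht₀, hM0, hM⟩ := H.exists_lift_of_small_time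
  refine exists_isSmoothingLift_of_le H.perturbed_semigroup H.perturbed_stable ht₀ hM0
    fun t ht htt => ?_
  exact exists_lift_of_denseRange H.injective (S t)
    (i := (rankOneInverse N V c b β : X →ₗ[ℝ] X))
    (denseRange_rankOneInverse H.dense H.normalized H.β_pos.ne') (by positivity) (hM t ht htt)

omit [CompleteSpace Z] [CompleteSpace X] in
theorem hasDerivWithinAt_output {R : ℝ → X →L[ℝ] Z} (hR : IsSmoothingLift Q S R) {t : ℝ}
    (ht : 0 < t) (x : X) :
    HasDerivWithinAt (fun t => β * c (V (S t x))) (-(c (R t x))) (Ioi t) t := by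
  rw [hasDerivWithinAt_iff_tendsto_slope' self_notMem_Ioi]
  have output_eq (h : ℝ) (hh : 0 ≤ h) :
      β * c (V (S (t + h) x)) = c (R t (S h (rankOneInverse N V c b β x))) :=
    (H.apply_eq_of_map_eq (by positivity) <| by
      rw [hR t ht, ← H.perturbed_semigroup.map_add_apply ht.le hh]).symm
  have quotient_tendsto := ((c.comp (R t)).continuous.tendsto _).comp
    ((H.perturbed_rightInverse x).comp (tendsto_sub_nhdsGT t))
  rw [ContinuousLinearMap.comp_apply, map_neg, map_neg] at quotient_tendsto
  refine quotient_tendsto.congr' ?_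
  filter_upwards [self_mem_nhdsWithin] with s (hs : t < s)
  have at_s := output_eq (s - t) (sub_nonneg.2 hs.le)
  have at_t := output_eq 0 le_rfl
  rw [add_sub_cancel] at at_s
  rw [add_zero, H.perturbed_semigroup.map_zero_apply] at at_t
  rw [slope_def_module, at_s, at_t]
  simp only [Function.comp_apply, ContinuousLinearMap.comp_apply, map_smul, map_sub]

end RankOnePerturbation

/-! ### Partially defined operators with a bounded inverse -/

section PartialInverse

variable {E F : Type*} [AddCommGroup E] [Module ℝ E] [AddCommGroup F] [Module ℝ F]

theorem total_eq_of_mem_graph {A : E →ₗ.[ℝ] F} {x : E} {y : F} (h : (x, y) ∈ A.graph) :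
    A.total x = y := by
  obtain ⟨z, rfl : (z : E) = x, hy : A z = y⟩ := A.mem_graph_iff.1 h
  rw [LinearPMap.total, dif_pos z.2]
  exact hy

theorem inverse_total_eq {A : E →ₗ.[ℝ] F} {N : F →ₗ[ℝ] E}
    (h : ∀ x y, (x, y) ∈ A.graph ↔ x = -N y) (y : F) : A.inverse.total y = -N y := by
  have ker_eq_bot : LinearMap.ker A.toFun = ⊥ := by
    refine LinearMap.ker_eq_bot'.2 fun x (hx : A x = 0) => Subtype.ext ?_
    exact ((h x (A x)).1 (A.mem_graph x)).trans (by rw [hx, map_zero, neg_zero]; rfl)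
  refine total_eq_of_mem_graph ?_
  rw [LinearPMap.inverse_graph ker_eq_bot]
  exact ⟨(-N y, y), (h _ _).2 rfl, rfl⟩

end PartialInverse

section GraphClosure

variable {E F : Type*} [NormedAddCommGroup E] [NormedSpace ℝ E] [NormedAddCommGroup F]
  [NormedSpace ℝ F] {A : E →ₗ.[ℝ] E} {M : E →L[ℝ] E} {N : F →L[ℝ] F} {ι : E →L[ℝ] F}

theorem mem_topologicalClosure_map_graph_iff (hι : DenseRange ι)
    (hA : ∀ x y, (x, y) ∈ A.graph ↔ x = -M y) (hN : ∀ y, N (ι y) = ι (M y)) (q : F × F) :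
    q ∈ (A.graph.map (ι.prodMap ι : E × E →ₗ[ℝ] F × F)).topologicalClosure ↔ q.1 = -N q.2 := by
  constructor
  · have isClosed : IsClosed {q : F × F | q.1 = -N q.2} := isClosed_eq (by fun_prop) (by fun_prop)
    refine fun hq => closure_minimal ?_ isClosed hq
    rintro _ ⟨⟨x, y⟩, hxy, rfl⟩
    change ι x = -N (ι y)
    rw [(hA x y).1 hxy, map_neg, hN]
  · intro hq
    have continuous : Continuous fun p => (-N p, p) := by fun_prop
    have mem_closure : (-N q.2, q.2) ∈ closure ((fun p => (-N p, p)) '' range ι) :=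
      image_closure_subset_closure_image continuous ⟨q.2, hι q.2, rfl⟩
    rw [show q = (-N q.2, q.2) from Prod.ext hq rfl]
    refine closure_mono ?_ mem_closure
    rintro _ ⟨_, ⟨y, rfl⟩, rfl⟩
    refine ⟨(-M y, y), (hA _ _).2 rfl, ?_⟩
    change (ι (-M y), ι y) = (-N (ι y), ι y)
    rw [map_neg, hN]

theorem mem_graph_topologicalClosure_map_graph_iff (hι : DenseRange ι)
    (hA : ∀ x y, (x, y) ∈ A.graph ↔ x = -M y) (hN : ∀ y, N (ι y) = ι (M y))
    (hinj : Function.Injective N) (x p : F) :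
    (x, p) ∈ ((A.graph.map
      (ι.prodMap ι : E × E →ₗ[ℝ] F × F)).topologicalClosure).toLinearPMap.graph ↔ x = -N p := by
  rw [Submodule.toLinearPMap_graph_eq, mem_topologicalClosure_map_graph_iff hι hA hN]
  intro q hq hq1
  rw [mem_topologicalClosure_map_graph_iff hι hA hN, hq1, zero_eq_neg] at hq
  exact (injective_iff_map_eq_zero N).1 hinj _ hq

end GraphClosure

theorem IsGenerator.map_mem_graph {E : Type*} [NormedAddCommGroup E] [NormedSpace ℝ E]
    {A : E →ₗ.[ℝ] E} {S : ℝ → E →L[ℝ] E} (hA : IsGenerator A S) (hS : IsC0Semigroup S) {t : ℝ}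
    (ht : 0 ≤ t) {x y : E} (h : (x, y) ∈ A.graph) : (S t x, S t y) ∈ A.graph := by
  rw [hA] at h ⊢
  refine (((S t).continuous.tendsto y).comp h).congr' ?_
  filter_upwards [self_mem_nhdsWithin] with h hh
  rw [Function.comp_apply, map_smul, map_sub, hS.comm_apply ht (le_of_lt hh)]

section Conjugation

variable {Z X : Type*} [NormedAddCommGroup Z] [NormedSpace ℝ Z] [NormedAddCommGroup X]
  [NormedSpace ℝ X] {T : ℝ → Z →L[ℝ] Z}

theorem IsC0Semigroup.conj (hT : IsC0Semigroup T) (J : Z ≃L[ℝ] X) :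
    IsC0Semigroup fun t => J.conjContinuousAlgEquiv (T t) where
  map_zero := by
    rw [hT.map_zero]
    exact map_one _
  map_add s t hs ht := by
    rw [hT.map_add s t hs ht]
    exact map_mul _ _ _
  tendsto_zero x := by
    have tendsto_map := (J.continuous.tendsto _).comp (hT.tendsto_zero (J.symm x))
    rwa [J.apply_symm_apply] at tendsto_map

theorem IsNegGeneratorRightInverse.conj {N : Z →L[ℝ] Z} (h : IsNegGeneratorRightInverse T N)
    (J : Z ≃L[ℝ] X) :
    IsNegGeneratorRightInverse (fun t => J.conjContinuousAlgEquiv (T t))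
      (J.conjContinuousAlgEquiv N) := by
  intro x
  have tendsto_map := (J.continuous.tendsto _).comp (h (J.symm x))
  rw [map_neg, J.apply_symm_apply] at tendsto_map
  refine tendsto_map.congr fun t => ?_
  simp only [Function.comp_apply, ContinuousLinearEquiv.conjContinuousAlgEquiv_apply_apply,
    map_smul, map_sub, J.symm_apply_apply]

theorem denseRange_conj {N : Z →L[ℝ] Z} (h : DenseRange N) (J : Z ≃L[ℝ] X) :
    DenseRange (J.conjContinuousAlgEquiv N) :=
  DenseRange.comp (g := J) (f := N ∘ J.symm) J.surjective.denseRange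
    (DenseRange.comp h J.symm.surjective.denseRange N.continuous) J.continuous

theorem IsSmoothingLift.conj {Q : Z →L[ℝ] Z} {W : ℝ → Z →L[ℝ] Z} (h : IsSmoothingLift Q T W)
    (J : Z ≃L[ℝ] X) :
    IsSmoothingLift ((J : Z →L[ℝ] X).comp Q) (fun t => J.conjContinuousAlgEquiv (T t))
      fun t => (W t).comp (J.symm : X →L[ℝ] Z) :=
  fun t ht x => congrArg J (h t ht (J.symm x))

theorem exists_norm_conj_le {M : ℝ} (hM : ∀ t, 0 ≤ t → ‖T t‖ ≤ M) (J : Z ≃L[ℝ] X) :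
    ∃ M', ∀ t, 0 ≤ t → ‖J.conjContinuousAlgEquiv (T t)‖ ≤ M' := by
  refine ⟨‖(J : Z →L[ℝ] X)‖ * (M * ‖(J.symm : X →L[ℝ] Z)‖), fun t ht => ?_⟩
  refine (ContinuousLinearMap.opNorm_comp_le _ _).trans ?_
  gcongr
  exact ((T t).opNorm_comp_le _).trans (by gcongr; exact hM t ht)

end Conjugation

/-! ### The regulated system in terms of bounded operators -/

theorem posNorm_apply {Z X : Type*} [NormedAddCommGroup Z] [NormedSpace ℝ Z]
    [NormedAddCommGroup X] [NormedSpace ℝ X] {T : ℝ → Z →L[ℝ] Z} {ι : Z →L[ℝ] X} {s : ℝ}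
    (h : Function.Injective fun y => ι (negPow T s y)) (y : Z) :
    posNorm T ι s (ι (negPow T s y)) = ‖y‖ₑ := by
  refine le_antisymm (iInf₂_le (f := fun y' (_ : ι (negPow T s y') = ι (negPow T s y)) => ‖y'‖ₑ)
    y rfl) (le_iInf₂ fun y' hy' => ?_)
  rw [h hy']

namespace RegulatedSystem

variable {Z X : Type*} [NormedAddCommGroup Z] [InnerProductSpace ℝ Z] [NormedAddCommGroup X]
  [NormedSpace ℝ X]

/-- Bounded operators that represent the unbounded operators `A` and `C` of the regulated system:
`N = (-A)⁻¹` on `X`, and `c = C Q` for a map `Q : Z → Z^{s_c}` through which `N = Q V` factors. -/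
structure IsRepresentedBy (P : RegulatedSystem Z X) (N : X →L[ℝ] X) (Q : Z →L[ℝ] X)
    (V : X →L[ℝ] Z) (c : Z →L[ℝ] ℝ) : Prop where
  mem_graph_AX_iff : ∀ x p, (x, p) ∈ P.AX.graph ↔ x = -N p
  factor : ∀ x, Q (V x) = N x
  mem_posSpace : ∀ y, Q y ∈ posSpace P.T P.ι P.sc
  Cx_apply : ∀ y, P.Cx (Q y) = c y

namespace IsRepresentedBy

variable {P : RegulatedSystem Z X} {N : X →L[ℝ] X} {Q : Z →L[ℝ] X} {V : X →L[ℝ] Z}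
  {c : Z →L[ℝ] ℝ} (h : P.IsRepresentedBy N Q V c)
include h

theorem Cx_neg (x : X) : P.Cx (-N x) = -c (V x) := by
  rw [← h.factor, ← map_neg, h.Cx_apply, map_neg]

theorem neg_mem_posSpace (x : X) : -N x ∈ posSpace P.T P.ι P.sc := by
  rw [← h.factor, ← map_neg]
  exact h.mem_posSpace _

theorem C_neg (x : X) (hx : -N x ∈ posSpace P.T P.ι P.sc) : P.C ⟨-N x, hx⟩ = -c (V x) := by
  have hC := h.Cx_neg x
  rwa [Cx, LinearPMap.total, dif_pos hx] at hC

theorem AInv_apply (x : X) : P.AInv x = -N x := 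
  inverse_total_eq (N := (N : X →ₗ[ℝ] X)) h.mem_graph_AX_iff x

theorem I₀_apply (x : X) : P.I₀ x = x - c (V x) • P.b := by
  rw [I₀, h.AInv_apply, h.Cx_neg, neg_smul, sub_eq_add_neg]

theorem normalized (hG : P.G ≠ 0) : c (V P.b) = 1 := by
  have G_eq : P.G = c (V P.bIn) := by rw [G, h.AInv_apply, h.Cx_neg, neg_neg]
  rw [b, map_smul, map_smul, ← G_eq, smul_eq_mul, inv_mul_cancel₀ hG]

theorem mem_graph_Aβ_iff_exists (x p : X) :
    (x, p) ∈ P.Aβ.graph ↔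
      ∃ q, x = -N q ∧ p = q + ((1 - P.β) / P.β * c (V q)) • P.b := by
  have perturbation_apply (q : X) (hA : -N q ∈ P.AX.domain) (hC : -N q ∈ posSpace P.T P.ι P.sc)
      (hq : P.AX ⟨-N q, hA⟩ = q) :
      P.Aβ ⟨-N q, hA, hC⟩ = q + ((1 - P.β) / P.β * c (V q)) • P.b := by
    change P.AX ⟨-N q, hA⟩ - ((1 - P.β) / P.β) • (P.C ⟨-N q, hC⟩ • P.b) = _
    rw [hq, h.C_neg, neg_smul, smul_neg, sub_neg_eq_add, smul_smul]
  rw [LinearPMap.mem_graph_iff]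
  constructor
  · rintro ⟨⟨y, hA, hC⟩, rfl, rfl⟩
    obtain ⟨q, hq⟩ : ∃ q, P.AX ⟨y, hA⟩ = q := ⟨_, rfl⟩
    have hy : y = -N q := (h.mem_graph_AX_iff y q).1 (hq ▸ P.AX.mem_graph ⟨y, hA⟩)
    subst hy
    exact ⟨q, rfl, perturbation_apply q hA hC hq⟩
  · rintro ⟨q, rfl, rfl⟩
    obtain ⟨⟨y, hA⟩, rfl : y = -N q, hq⟩ :=
      P.AX.mem_graph_iff.1 ((h.mem_graph_AX_iff (-N q) q).2 rfl)
    exact ⟨_, rfl, perturbation_apply q hA (h.neg_mem_posSpace q) hq⟩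

theorem mem_graph_Aβ_iff (hG : P.G ≠ 0) (hβ : P.β ≠ 0) (x p : X) :
    (x, p) ∈ P.Aβ.graph ↔ x = -rankOneInverse N V c P.b P.β p := by
  have hb := h.normalized hG
  rw [h.mem_graph_Aβ_iff_exists, rankOneInverse_apply]
  constructor
  · rintro ⟨q, rfl, rfl⟩
    have coefficient : (1 - P.β) * c (V (q + ((1 - P.β) / P.β * c (V q)) • P.b)) =
        (1 - P.β) / P.β * c (V q) := by
      rw [map_add, map_smul, map_add, map_smul, hb, smul_eq_mul]
      field_simp
      ring
    rw [coefficient, add_sub_cancel_right]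
  · rintro rfl
    refine ⟨_, rfl, ?_⟩
    have coefficient : (1 - P.β) / P.β * c (V (p - ((1 - P.β) * c (V p)) • P.b)) =
        (1 - P.β) * c (V p) := by
      rw [map_sub, map_smul, map_sub, map_smul, hb, smul_eq_mul]
      field_simp
      ring
    rw [coefficient, sub_add_cancel]

theorem Cx_AβInv (hG : P.G ≠ 0) (hβ : P.β ≠ 0) (x : X) :
    P.Cx (P.AβInv x) = -(P.β * c (V x)) := by
  rw [AβInv, inverse_total_eq (N := (rankOneInverse N V c P.b P.β : X →ₗ[ℝ] X))
    (h.mem_graph_Aβ_iff hG hβ) x]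
  change P.Cx (-rankOneInverse N V c P.b P.β x) = _
  rw [rankOneInverse_apply, h.Cx_neg, map_sub, map_smul, map_sub, map_smul, h.normalized hG,
    smul_eq_mul]
  ring

end IsRepresentedBy

/-- The regulated system in terms of bounded operators: `e^{A_β t} = Q R(t)` for `t > 0`, where
`Q : Z → Z^{s₁}` satisfies `C Q = c` and `E = (-A)^{s₁} Q`, and `ℓ = -C A⁻¹`. -/
structure Realization (P : RegulatedSystem Z X) where
  ℓ : X →L[ℝ] ℝ
  c : Z →L[ℝ] ℝ
  Q : Z →L[ℝ] X
  E : Z →L[ℝ] Z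
  R : ℝ → X →L[ℝ] Z
  a : ℝ
  M : ℝ
  ω : ℝ
  a_pos : 0 < a
  a_lt_one : a < 1
  ω_pos : 0 < ω
  Q_injective : Function.Injective Q
  Q_eq : ∀ y, P.ι (negPow P.T P.s₁ (E y)) = Q y
  Cx_Q : ∀ y, P.Cx (Q y) = c y
  lift : IsSmoothingLift Q P.S R
  lift_bound : ∀ t, 0 < t → ‖R t‖ ≤ M * ((t ^ (-a) + 1) * Real.exp (-ω * t))
  I₀_eq : ∀ x, P.I₀ x = x - ℓ x • P.b
  ℓ_b : ℓ P.b = 1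
  K_eq : ∀ t, P.K t = ℓ (P.S t P.b)
  Kd_eq : ∀ t, P.Kd t = P.β * ℓ (P.S t (P.I₀ P.bd))
  deriv : ∀ t, 0 < t → ∀ x,
    HasDerivWithinAt (fun t => P.β * ℓ (P.S t x)) (-(c (R t x))) (Ioi t) t

namespace Standing

variable {P : RegulatedSystem Z X} (hP : P.Standing)
include hP

theorem continuousOn : ContinuousOn P.T (Ioi 0) := hP.analytic.continuousOn

theorem σ_lt_one : P.σ < 1 := by linarith [hP.s₁_add_σ, hP.s₁_pos]

variable [CompleteSpace Z]

theorem negPow_injective {s : ℝ} (hs : 0 ≤ s) (hs1 : s ≤ 1) :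
    Function.Injective (negPow P.T s) :=
  _root_.negPow_injective hP.semigroup hP.stable hP.continuousOn hs hs1

theorem negPow_negPow_apply {s t : ℝ} (hs : 0 ≤ s) (ht : 0 ≤ t) (y : Z) :
    negPow P.T s (negPow P.T t y) = negPow P.T (s + t) y :=
  _root_.negPow_negPow_apply hP.semigroup hP.stable hP.continuousOn hs ht y

theorem ι_injective : Function.Injective P.ι := by
  rw [injective_iff_map_eq_zero]
  intro φ hφ
  have norm_eq := hP.negSpace.norm_eq φ
  rw [hφ, norm_zero] at norm_eq
  exact (injective_iff_map_eq_zero _).1 (hP.negPow_injective hP.σ_nonneg hP.σ_lt_one.le) φ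
    (norm_eq_zero.1 norm_eq.symm)

theorem ι_negPow_injective {s : ℝ} (hs : 0 ≤ s) (hs1 : s ≤ 1) :
    Function.Injective fun y => P.ι (negPow P.T s y) :=
  hP.ι_injective.comp (hP.negPow_injective hs hs1)

theorem ι_negPow_s₁_injective : Function.Injective fun y => P.ι (negPow P.T P.s₁ y) :=
  hP.ι_negPow_injective hP.s₁_pos.le (by linarith [hP.s₁_add_σ, hP.σ_nonneg])

theorem exists_output : ∃ c : Z →L[ℝ] ℝ, ∀ y, P.Cx (P.ι (negPow P.T P.sc y)) = c y := by
  obtain ⟨k, hk⟩ := hP.C_bounded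
  have injective := hP.ι_negPow_injective hP.sc_nonneg (by linarith [hP.sc_add_σ, hP.σ_nonneg])
  let e : Z →ₗ[ℝ] posSpace P.T P.ι P.sc :=
    LinearMap.rangeRestrict (P.ι.comp (negPow P.T P.sc) : Z →ₗ[ℝ] X)
  refine ⟨LinearMap.mkContinuous (P.C ∘ₗ e) k fun y => ?_, fun y => ?_⟩
  · have enorm_le := hk (e y)
    rw [show P.snorm P.sc (e y) = ‖y‖ₑ from posNorm_apply injective y] at enorm_le
    have nnnorm_le : ‖P.C (e y)‖₊ ≤ k * ‖y‖₊ := by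
      rwa [← ENNReal.coe_le_coe, ENNReal.coe_mul]
    exact_mod_cast nnnorm_le
  · rw [Cx, LinearPMap.total,
      dif_pos (show P.ι (negPow P.T P.sc y) ∈ posSpace P.T P.ι P.sc from ⟨y, rfl⟩)]
    rfl

variable {J : Z ≃L[ℝ] X} (hJ : ∀ φ, J (negPow P.T P.σ φ) = P.ι φ)

include hJ in
theorem mem_graph_AX_iff (x p : X) :
    (x, p) ∈ P.AX.graph ↔ x = -J.conjContinuousAlgEquiv (negPow P.T 1) p := by
  refine mem_graph_topologicalClosure_map_graph_iff hP.negSpace.dense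
    (hP.generator.mem_graph_iff hP.semigroup hP.stable hP.continuousOn) (fun y => ?_)
    (J.injective.comp ((hP.negPow_injective zero_le_one le_rfl).comp J.symm.injective)) x p
  rw [ContinuousLinearEquiv.conjContinuousAlgEquiv_apply_apply, ← hJ, J.symm_apply_apply, ← hJ,
    hP.negPow_negPow_apply zero_le_one hP.σ_nonneg, hP.negPow_negPow_apply hP.σ_nonneg zero_le_one,
    add_comm]

variable {a : ℝ}

include hJ in
theorem ι_negPow_negPow_sub {s : ℝ} (hs : 0 ≤ s) (hsa : s + P.σ ≤ a) (y : Z) :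
    P.ι (negPow P.T s (negPow P.T (a - (s + P.σ)) y)) = J (negPow P.T a y) := by
  rw [← hJ, hP.negPow_negPow_apply hs (sub_nonneg.2 hsa),
    hP.negPow_negPow_apply hP.σ_nonneg (add_nonneg hs (sub_nonneg.2 hsa))]
  congr 3
  ring

include hJ in
theorem isRepresentedBy (ha : P.sc + P.σ ≤ a) (ha1 : a ≤ 1) {c : Z →L[ℝ] ℝ}
    (hc : ∀ y, P.Cx (P.ι (negPow P.T P.sc y)) = c y) :
    P.IsRepresentedBy (J.conjContinuousAlgEquiv (negPow P.T 1))
      ((J : Z →L[ℝ] X).comp (negPow P.T a)) ((negPow P.T (1 - a)).comp (J.symm : X →L[ℝ] Z))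
      (c.comp (negPow P.T (a - (P.sc + P.σ)))) where
  mem_graph_AX_iff := hP.mem_graph_AX_iff hJ
  factor x := congrArg J <|
    (hP.negPow_negPow_apply (by linarith [hP.sc_nonneg, hP.σ_nonneg]) (sub_nonneg.2 ha1) _).trans
      (by rw [add_sub_cancel]; rfl)
  mem_posSpace y := ⟨negPow P.T (a - (P.sc + P.σ)) y, hP.ι_negPow_negPow_sub hJ hP.sc_nonneg ha y⟩
  Cx_apply y := by
    rw [ContinuousLinearMap.comp_apply, ContinuousLinearMap.comp_apply, ← hc,
      hP.ι_negPow_negPow_sub hJ hP.sc_nonneg ha]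
    rfl

theorem rankOnePerturbation {V : X →L[ℝ] Z} {c : Z →L[ℝ] ℝ}
    (h : P.IsRepresentedBy (J.conjContinuousAlgEquiv (negPow P.T 1))
      ((J : Z →L[ℝ] X).comp (negPow P.T a)) V c) (ha : 0 < a) (ha1 : a < 1)
    {W : ℝ → Z →L[ℝ] Z} (hW : IsSmoothingLift (negPow P.T a) P.T W) {M : ℝ} (hM : 0 ≤ M)
    (hWM : ∀ t, 0 < t → ‖W t‖ ≤ M * t ^ (-a)) :
    RankOnePerturbation (fun t => J.conjContinuousAlgEquiv (P.T t))
      (J.conjContinuousAlgEquiv (negPow P.T 1)) ((J : Z →L[ℝ] X).comp (negPow P.T a))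
      (fun t => (W t).comp (J.symm : X →L[ℝ] Z)) V c P.b P.β a P.S where
  semigroup := hP.semigroup.conj J
  bounded := by
    obtain ⟨M, ω, -, -, -, hM⟩ := hP.stable.exists_bound
    exact exists_norm_conj_le hM J
  rightInverse :=
    (isNegGeneratorRightInverse_negPow_one hP.semigroup hP.stable hP.continuousOn).conj J
  injective := J.injective.comp (hP.negPow_injective ha.le ha1.le)
  lift := hW.conj J
  lift_bound := by
    refine ⟨M * ‖(J.symm : X →L[ℝ] Z)‖, by positivity, fun t ht => ?_⟩
    rw [mul_right_comm]
    exact ((W t).opNorm_comp_le _).trans (by gcongr; exact hWM t ht)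
  factor := h.factor
  dense := denseRange_conj
    (negPow_denseRange hP.semigroup hP.stable hP.continuousOn zero_le_one le_rfl) J
  normalized := h.normalized hP.G_ne_zero
  β_pos := hP.β_pos
  a_pos := ha
  a_lt_one := ha1
  perturbed_semigroup := hP.semigroup_β
  perturbed_stable := hP.stable_β
  perturbed_rightInverse x := by
    have mem_graph := (h.mem_graph_Aβ_iff hP.G_ne_zero hP.β_pos.ne' _ x).2 rfl
    refine ((hP.generator_β _ _).1 mem_graph).neg.congr fun t => ?_
    rw [← smul_neg, map_neg, neg_sub_neg, neg_sub]
  perturbed_comm t ht x := by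
    have mem_graph := (h.mem_graph_Aβ_iff hP.G_ne_zero hP.β_pos.ne' _ x).2 rfl
    have map_mem := hP.generator_β.map_mem_graph hP.semigroup_β ht mem_graph
    rw [h.mem_graph_Aβ_iff hP.G_ne_zero hP.β_pos.ne', map_neg] at map_mem
    exact neg_injective map_mem

variable [CompleteSpace X]

/-- The identification of `Z` with `Z^{-σ}` extends `(-A)^σ`. -/
theorem exists_equiv : ∃ J : Z ≃L[ℝ] X, ∀ φ, J (negPow P.T P.σ φ) = P.ι φ := by
  have dense_ι : DenseRange (P.ι : Z →ₗ[ℝ] X) := hP.negSpace.dense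
  have dense_negPow : DenseRange (negPow P.T P.σ : Z →ₗ[ℝ] Z) :=
    negPow_denseRange hP.semigroup hP.stable hP.continuousOn hP.σ_nonneg hP.σ_lt_one.le
  have norm_le (φ : Z) : ‖(negPow P.T P.σ : Z →ₗ[ℝ] Z) φ‖ ≤ 1 * ‖(P.ι : Z →ₗ[ℝ] X) φ‖ :=
    ((hP.negSpace.norm_eq φ).symm.trans (one_mul _).symm).le
  have norm_ge (φ : Z) : ‖(P.ι : Z →ₗ[ℝ] X) φ‖ ≤ 1 * ‖(negPow P.T P.σ : Z →ₗ[ℝ] Z) φ‖ :=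
    ((hP.negSpace.norm_eq φ).trans (one_mul _).symm).le
  exact ⟨(LinearEquiv.refl ℝ Z).extend _ _ dense_negPow ⟨1, norm_ge⟩ dense_ι ⟨1, norm_le⟩,
    LinearEquiv.extend_eq _ _ _ dense_negPow _ dense_ι _⟩

theorem nonempty_realization : Nonempty P.Realization := by
  obtain ⟨J, hJ⟩ := hP.exists_equiv
  obtain ⟨c₀, hc₀⟩ := hP.exists_output
  obtain ⟨T', k, -, hT', hk⟩ := hP.analytic.exists_hasDerivAt
  set a := max (P.s₁ + P.σ) (P.sc + P.σ)
  have ha : 0 < a := lt_max_of_lt_left (add_pos_of_pos_of_nonneg hP.s₁_pos hP.σ_nonneg)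
  have ha1 : a < 1 := max_lt hP.s₁_add_σ hP.sc_add_σ
  have hG := hP.G_ne_zero
  have hβ := hP.β_pos.ne'
  obtain ⟨W, MW, hMW, hW, hWM⟩ :=
    exists_isSmoothingLift_negPow hP.semigroup hP.stable hT' hk ha ha1
  have represented := hP.isRepresentedBy hJ (le_max_right _ _) ha1.le hc₀
  have H := hP.rankOnePerturbation represented ha ha1 hW hMW hWM
  obtain ⟨R, M, ω, hω, hR, hRM⟩ := H.exists_isSmoothingLift
  exact ⟨{
    ℓ := (c₀.comp (negPow P.T (a - (P.sc + P.σ)))).comp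
      ((negPow P.T (1 - a)).comp (J.symm : X →L[ℝ] Z))
    c := c₀.comp (negPow P.T (a - (P.sc + P.σ)))
    Q := (J : Z →L[ℝ] X).comp (negPow P.T a)
    E := negPow P.T (a - (P.s₁ + P.σ))
    R, a, M, ω
    a_pos := ha
    a_lt_one := ha1
    ω_pos := hω
    Q_injective := H.injective
    Q_eq := hP.ι_negPow_negPow_sub hJ hP.s₁_pos.le (le_max_left _ _)
    Cx_Q := represented.Cx_apply
    lift := hR
    lift_bound := hRM
    I₀_eq := represented.I₀_apply
    ℓ_b := H.normalized
    K_eq := fun t => by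
      rw [K, represented.Cx_AβInv hG hβ]
      field_simp
      rfl
    Kd_eq := fun t => by
      rw [Kd, represented.Cx_AβInv hG hβ, neg_neg]
      rfl
    deriv := fun t ht x => H.hasDerivWithinAt_output hR ht x }⟩

end Standing

end RegulatedSystem

/-! ### Limits superior and convolution inequalities in `[0, ∞]` -/

theorem limsup_enn_le_iff_forall_pos {u : ℝ → ℝ≥0∞} {L : ℝ≥0∞} :
    limsup u atTop ≤ L ↔ ∀ δ : ℝ≥0, 0 < δ → ∀ᶠ t in atTop, u t ≤ L + δ := by
  refine ⟨fun h δ hδ => ?_, fun h => ENNReal.le_of_forall_pos_le_add fun δ hδ _ =>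
    limsup_le_of_le (h := h δ hδ)⟩
  rcases eq_or_ne L ⊤ with rfl | hL
  · simp
  have hlt : limsup u atTop < L + δ :=
    h.trans_lt (ENNReal.lt_add_right hL (by exact_mod_cast hδ.ne'))
  exact (eventually_lt_of_limsup_lt hlt).mono fun t ht => ht.le

theorem limsup_enn_add_le_of_le {u v : ℝ → ℝ≥0∞} {U V : ℝ≥0∞} (hu : limsup u atTop ≤ U)
    (hv : limsup v atTop ≤ V) : limsup (fun t => u t + v t) atTop ≤ U + V := by
  rw [limsup_enn_le_iff_forall_pos] at hu hv ⊢
  intro δ hδ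
  filter_upwards [hu (δ / 2) (half_pos hδ), hv (δ / 2) (half_pos hδ)] with t hut hvt
  refine (add_le_add hut hvt).trans_eq ?_
  rw [add_add_add_comm, ← ENNReal.coe_add, add_halves]

theorem limsup_enn_const_mul_le_of_le {u : ℝ → ℝ≥0∞} {U c : ℝ≥0∞} (hc : c ≠ ⊤)
    (hu : limsup u atTop ≤ U) : limsup (fun t => c * u t) atTop ≤ c * U :=
  (ENNReal.limsup_const_mul_of_ne_top hc).trans_le (by gcongr)

theorem limsup_le_of_eventually_le_of_le {u v : ℝ → ℝ≥0∞} {V : ℝ≥0∞}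
    (huv : ∀ᶠ t in atTop, u t ≤ v t) (hv : limsup v atTop ≤ V) : limsup u atTop ≤ V :=
  (limsup_le_limsup huv).trans hv

theorem exists_nnreal_bound_of_limsup_ne_top {u : ℝ → ℝ≥0∞} {t₀ : ℝ}
    (hloc : ∀ t₁, ∃ B : ℝ≥0, ∀ τ ∈ Icc t₀ t₁, u τ ≤ B) (hlim : limsup u atTop ≠ ⊤) :
    ∃ B : ℝ≥0, ∀ τ, t₀ ≤ τ → u τ ≤ B := by
  obtain ⟨L, hlimL, hLtop⟩ := exists_between hlim.lt_top
  lift L to ℝ≥0 using hLtop.ne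
  obtain ⟨T, htail⟩ := eventually_atTop.1 (eventually_lt_of_limsup_lt hlimL)
  obtain ⟨B, hB⟩ := hloc T
  refine ⟨max B L, fun τ hτ => ?_⟩
  rcases le_total τ T with h | h
  · exact (hB τ ⟨hτ, h⟩).trans (by exact_mod_cast le_max_left B L)
  · exact (htail τ h).le.trans (by exact_mod_cast le_max_right B L)

theorem exists_enorm_bound_Icc_of_continuousOn {E : Type*} [NormedAddCommGroup E] {t₀ : ℝ}
    {u : ℝ → E} (hu : ContinuousOn u (Ici t₀)) (t₁ : ℝ) :
    ∃ B : ℝ≥0, ∀ τ ∈ Icc t₀ t₁, ‖u τ‖ₑ ≤ B := by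
  obtain ⟨B, hB⟩ := isCompact_Icc.exists_bound_of_continuousOn
    (hu.mono (Icc_subset_Ici_self : Icc t₀ t₁ ⊆ Ici t₀))
  refine ⟨B.toNNReal, fun τ hτ => ?_⟩
  rw [← ofReal_norm]
  exact ENNReal.ofReal_le_ofReal (hB τ hτ)

theorem exists_enorm_bound_of_limsup_ne_top {E : Type*} [NormedAddCommGroup E] {t₀ : ℝ}
    {u : ℝ → E} (hu : ContinuousOn u (Ici t₀)) (hlim : limsup (fun t => ‖u t‖ₑ) atTop ≠ ⊤) :
    ∃ B : ℝ≥0, ∀ τ, t₀ ≤ τ → ‖u τ‖ₑ ≤ B :=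
  exists_nnreal_bound_of_limsup_ne_top (exists_enorm_bound_Icc_of_continuousOn hu) hlim

theorem tendsto_setLIntegral_Ioi_atTop {f : ℝ → ℝ≥0∞} {a : ℝ} (hf : ∫⁻ s in Ioi a, f s ≠ ⊤) :
    Tendsto (fun x => ∫⁻ s in Ioi x, f s) atTop (𝓝 0) := by
  have hlim := tendsto_measure_iInter_atTop (μ := volume.withDensity f) (s := fun x : ℝ => Ioi x)
    (fun x => measurableSet_Ioi.nullMeasurableSet) antitone_Ioi
    ⟨a, by rwa [withDensity_apply f measurableSet_Ioi]⟩
  have hempty : ⋂ x : ℝ, Ioi x = ∅ := iInter_eq_empty_iff.2 fun x => ⟨x, self_notMem_Ioi⟩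
  rw [hempty, measure_empty] at hlim
  exact hlim.congr fun x => withDensity_apply f measurableSet_Ioi

/-- The convolution `∫_{t₀}^t k(t - τ) φ(τ) dτ` of nonnegative functions, written in the variable
`s = t - τ`; it is the right-hand side of the convolution inequalities below. -/
def volterraIntegral (k : ℝ → ℝ≥0∞) (t₀ : ℝ) (φ : ℝ → ℝ≥0∞) (t : ℝ) : ℝ≥0∞ :=
  ∫⁻ s in Ioc 0 (t - t₀), k s * φ (t - s)

theorem volterraIntegral_le {k φ : ℝ → ℝ≥0∞} {t₀ t : ℝ} {B : ℝ≥0}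
    (hφ : ∀ τ ∈ Icc t₀ t, φ τ ≤ B) :
    volterraIntegral k t₀ φ t ≤ (∫⁻ s in Ioi 0, k s) * B :=
  calc volterraIntegral k t₀ φ t ≤ ∫⁻ s in Ioc 0 (t - t₀), k s * B := by
        refine setLIntegral_mono' measurableSet_Ioc fun s hs => ?_
        gcongr
        exact hφ _ ⟨by linarith [hs.2], by linarith [hs.1]⟩
    _ = (∫⁻ s in Ioc 0 (t - t₀), k s) * B := lintegral_mul_const' _ _ ENNReal.coe_ne_top
    _ ≤ (∫⁻ s in Ioi 0, k s) * B := by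
        gcongr
        exact Ioc_subset_Ioi_self

theorem volterraIntegral_le_add {k φ : ℝ → ℝ≥0∞} {t₀ t T : ℝ} {L B : ℝ≥0}
    (hL : ∀ τ, T ≤ τ → φ τ ≤ L) (hB : ∀ τ, t₀ ≤ τ → φ τ ≤ B) :
    volterraIntegral k t₀ φ t ≤
      (∫⁻ s in Ioi 0, k s) * L + (∫⁻ s in Ioi (t - T), k s) * B := by
  have hcover : Ioc 0 (t - t₀) ⊆ Ioc 0 (t - T) ∪ (Ioi (t - T) ∩ Ioc 0 (t - t₀)) := fun s hs =>
    (le_or_gt s (t - T)).imp (fun h => ⟨hs.1, h⟩) fun h => ⟨h, hs⟩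
  refine (lintegral_mono_set hcover).trans ((lintegral_union_le _ _ _).trans (add_le_add ?_ ?_))
  · exact volterraIntegral_le (t₀ := T) fun τ hτ => hL τ hτ.1
  · calc ∫⁻ s in Ioi (t - T) ∩ Ioc 0 (t - t₀), k s * φ (t - s)
        ≤ ∫⁻ s in Ioi (t - T) ∩ Ioc 0 (t - t₀), k s * B := by
          refine setLIntegral_mono' (measurableSet_Ioi.inter measurableSet_Ioc) fun s hs => ?_
          gcongr
          exact hB _ (by linarith [hs.2.2])
      _ = (∫⁻ s in Ioi (t - T) ∩ Ioc 0 (t - t₀), k s) * B :=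
          lintegral_mul_const' _ _ ENNReal.coe_ne_top
      _ ≤ (∫⁻ s in Ioi (t - T), k s) * B := by
          gcongr
          exact inter_subset_left

theorem limsup_volterraIntegral_le {k φ : ℝ → ℝ≥0∞} (hk : ∫⁻ s in Ioi 0, k s ≠ ⊤) {t₀ : ℝ}
    {B : ℝ≥0} (hB : ∀ τ, t₀ ≤ τ → φ τ ≤ B) :
    limsup (volterraIntegral k t₀ φ) atTop ≤ (∫⁻ s in Ioi 0, k s) * limsup φ atTop := by
  have hlim_le : limsup φ atTop ≤ B := limsup_le_of_le (h := (eventually_ge_atTop t₀).mono hB)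
  have hle : ∀ L : ℝ≥0, limsup φ atTop < L →
      limsup (volterraIntegral k t₀ φ) atTop ≤ (∫⁻ s in Ioi 0, k s) * L := by
    intro L hL
    obtain ⟨T, hT⟩ := eventually_atTop.1 (eventually_lt_of_limsup_lt hL)
    have htail : Tendsto (fun t => (∫⁻ s in Ioi (t - T), k s) * B) atTop (𝓝 0) := by
      simpa [sub_eq_add_neg] using ENNReal.Tendsto.mul_const
        ((tendsto_setLIntegral_Ioi_atTop hk).comp
          (tendsto_atTop_add_const_right atTop (-T) tendsto_id)) (Or.inr ENNReal.coe_ne_top)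
    have hsum : limsup (fun t => (∫⁻ s in Ioi 0, k s) * L + (∫⁻ s in Ioi (t - T), k s) * B)
        atTop ≤ (∫⁻ s in Ioi 0, k s) * L + 0 :=
      limsup_enn_add_le_of_le (limsup_const _).le htail.limsup_eq.le
    rw [add_zero] at hsum
    exact (limsup_le_limsup (Eventually.of_forall fun t =>
      volterraIntegral_le_add (fun τ hτ => (hT τ hτ).le) hB)).trans hsum
  have hlim : limsup φ atTop ≠ ⊤ := ne_top_of_le_ne_top ENNReal.coe_ne_top hlim_le
  generalize limsup φ atTop = ℓ at hle hlim
  lift ℓ to ℝ≥0 using hlim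
  have htend : Tendsto (fun L : ℝ≥0 => (∫⁻ s in Ioi 0, k s) * (L : ℝ≥0∞)) (𝓝[>] ℓ)
      (𝓝 ((∫⁻ s in Ioi 0, k s) * ℓ)) :=
    (ENNReal.Tendsto.const_mul (ENNReal.tendsto_coe.2 tendsto_id) (Or.inr hk)).mono_left
      nhdsWithin_le_nhds
  refine ge_of_tendsto htend ?_
  filter_upwards [self_mem_nhdsWithin] with L hL
  exact hle L (ENNReal.coe_lt_coe.2 hL)

theorem limsup_volterraIntegral_enorm_le {E : Type*} [NormedAddCommGroup E] {k : ℝ → ℝ≥0∞}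
    (hk : ∫⁻ s in Ioi 0, k s ≠ ⊤) {t₀ : ℝ} {u : ℝ → E} (hu : ContinuousOn u (Ici t₀)) {L : ℝ≥0∞}
    (hlim : limsup (fun t => ‖u t‖ₑ) atTop ≤ L) (hL : L ≠ ⊤) :
    limsup (volterraIntegral k t₀ fun τ => ‖u τ‖ₑ) atTop ≤ (∫⁻ s in Ioi 0, k s) * L := by
  obtain ⟨B, hB⟩ := exists_enorm_bound_of_limsup_ne_top hu (ne_top_of_le_ne_top hL hlim)
  exact (limsup_volterraIntegral_le hk hB).trans (by gcongr)

theorem le_div_one_sub_of_le_add_mul {m q κ : ℝ≥0∞} (hm : m ≠ ⊤) (hκ : κ < 1)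
    (h : m ≤ q + κ * m) : m ≤ q / (1 - κ) := by
  rw [ENNReal.le_div_iff_mul_le (Or.inl (tsub_pos_of_lt hκ).ne')
    (Or.inl (ENNReal.sub_ne_top ENNReal.one_ne_top)), ENNReal.mul_sub fun _ _ => hm, mul_one,
    tsub_le_iff_right, mul_comm m]
  exact h

section SmallGain

variable {k y g : ℝ → ℝ≥0∞} {t₀ : ℝ} (hk : ∫⁻ s in Ioi 0, k s < 1)
  (hloc : ∀ t₁, ∃ B : ℝ≥0, ∀ τ ∈ Icc t₀ t₁, y τ ≤ B)
  (hle : ∀ t, t₀ < t → y t ≤ g t + volterraIntegral k t₀ y t)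
  (hg : limsup g atTop ≠ ⊤)

include hk hloc hle hg

theorem exists_bound_of_le_add_volterraIntegral : ∃ B : ℝ≥0, ∀ τ, t₀ ≤ τ → y τ ≤ B := by
  obtain ⟨G, hGlim, hGtop⟩ := exists_between hg.lt_top
  obtain ⟨T₀, hT₀⟩ := eventually_atTop.1 (eventually_lt_of_limsup_lt hGlim)
  let T := max T₀ (t₀ + 1)
  obtain ⟨B₀, hB₀⟩ := hloc T
  have hq : (B₀ + G) / (1 - ∫⁻ s in Ioi 0, k s) ≠ ⊤ :=
    ENNReal.div_ne_top (ENNReal.add_ne_top.2 ⟨ENNReal.coe_ne_top, hGtop.ne⟩)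
      (tsub_pos_of_lt hk).ne'
  lift (B₀ + G) / (1 - ∫⁻ s in Ioi 0, k s) to ℝ≥0 using hq with B hB
  refine ⟨B, fun t₁ ht₁ => ?_⟩
  let m := ⨆ τ ∈ Icc t₀ t₁, y τ
  have hle_m : ∀ τ ∈ Icc t₀ t₁, y τ ≤ m := fun τ hτ => le_iSup₂ (f := fun τ _ => y τ) τ hτ
  have hm : m ≠ ⊤ := by
    obtain ⟨b, hb⟩ := hloc t₁
    exact ne_top_of_le_ne_top ENNReal.coe_ne_top (iSup₂_le hb)
  have hm_le : m ≤ B₀ + G + (∫⁻ s in Ioi 0, k s) * m := by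
    refine iSup₂_le fun t ht => ?_
    rcases le_total t T with htT | hTt
    · exact (hB₀ t ⟨ht.1, htT⟩).trans (by rw [add_assoc]; exact le_self_add)
    · have hT : T₀ ≤ t ∧ t₀ + 1 ≤ t := max_le_iff.1 hTt
      refine (hle t (by linarith)).trans (add_le_add ?_ ?_)
      · exact (hT₀ t hT.1).le.trans le_add_self
      · rw [← ENNReal.coe_toNNReal hm]
        exact volterraIntegral_le fun τ hτ =>
          (hle_m τ ⟨hτ.1, hτ.2.trans ht.2⟩).trans_eq (ENNReal.coe_toNNReal hm).symm
  exact (hle_m t₁ ⟨ht₁, le_rfl⟩).trans ((le_div_one_sub_of_le_add_mul hm hk hm_le).trans_eq hB.symm)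

theorem limsup_le_of_le_add_volterraIntegral :
    limsup y atTop ≤ limsup g atTop / (1 - ∫⁻ s in Ioi 0, k s) := by
  obtain ⟨B, hB⟩ := exists_bound_of_le_add_volterraIntegral hk hloc hle hg
  have hy : limsup y atTop ≤ B := limsup_le_of_le (h := (eventually_ge_atTop t₀).mono hB)
  refine le_div_one_sub_of_le_add_mul (ne_top_of_le_ne_top ENNReal.coe_ne_top hy) hk ?_
  exact limsup_le_of_eventually_le_of_le ((eventually_gt_atTop t₀).mono hle)
    (limsup_enn_add_le_of_le le_rfl (limsup_volterraIntegral_le hk.ne_top hB))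

end SmallGain

/-- The reverse Fatou lemma along `t → ∞`, restricted to sequences. -/
theorem limsup_setLIntegral_le {φ : ℝ → ℝ → ℝ≥0∞} {B : ℝ≥0} {T h : ℝ} {L : ℝ≥0∞}
    (hm : ∀ t, Measurable (φ t)) (hB : ∀ t, T ≤ t → ∀ s, 0 < s → φ t s ≤ B)
    (hL : ∀ s ∈ Ioc 0 h, limsup (fun t => φ t s) atTop ≤ L) :
    limsup (fun t => ∫⁻ s in Ioc 0 h, φ t s) atTop ≤ L * ENNReal.ofReal h := by
  refine le_of_forall_lt_imp_le_of_dense fun c hc => ?_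
  have hfreq : ∃ᶠ t in atTop, T ≤ t ∧ c < ∫⁻ s in Ioc 0 h, φ t s :=
    ((frequently_lt_of_lt_limsup (h := hc)).and_eventually (eventually_ge_atTop T)).mono
      fun t ht => ht.symm
  obtain ⟨τ, hτ, hτc⟩ := exists_seq_forall_of_frequently hfreq
  calc c ≤ limsup (fun n => ∫⁻ s in Ioc 0 h, φ (τ n) s) atTop :=
        le_limsup_of_frequently_le (Frequently.of_forall fun n => (hτc n).2.le)
    _ ≤ ∫⁻ s in Ioc 0 h, limsup (fun n => φ (τ n) s) atTop := by
        refine limsup_lintegral_le (fun _ => B) (fun n => hm _) (fun n => ?_) ?_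
        · exact (ae_restrict_iff' measurableSet_Ioc).2
            (ae_of_all _ fun s hs => hB _ (hτc n).1 s hs.1)
        · rw [setLIntegral_const]
          exact ENNReal.mul_ne_top ENNReal.coe_ne_top (by simp)
    _ ≤ ∫⁻ _ in Ioc 0 h, L := by
        refine setLIntegral_mono' measurableSet_Ioc fun s hs => le_trans ?_ (hL s hs)
        exact limsup_le_limsup_of_le (f := map τ atTop) (g := atTop) (u := fun t => φ t s) hτ
    _ = L * ENNReal.ofReal h := by rw [setLIntegral_const, Real.volume_Ioc, sub_zero]

/-! ### Convolution with smoothing operators -/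

/-- A jointly continuous family of operators `W(s) : X → Z`, `s > 0`, possibly singular at `0`,
that is dominated in norm by an integrable function vanishing at infinity. -/
structure IsSmoothingKernel {Z X : Type*} [NormedAddCommGroup Z] [NormedSpace ℝ Z]
    [NormedAddCommGroup X] [NormedSpace ℝ X] (W : ℝ → X →L[ℝ] Z) (m : ℝ → ℝ) : Prop where
  continuousOn : ContinuousOn (fun p : ℝ × X => W p.1 p.2) (Ioi 0 ×ˢ univ)
  norm_le : ∀ s, 0 < s → ‖W s‖ ≤ m s
  integrableOn : IntegrableOn m (Ioi 0)
  tendsto : Tendsto m atTop (𝓝 0)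

/-- The convolution `∫_{t₀}^t W(t - τ) g(τ) dτ`, written in the variable `s = t - τ`. -/
def smoothingConv {Z X : Type*} [NormedAddCommGroup Z] [NormedSpace ℝ Z] [NormedAddCommGroup X]
    [NormedSpace ℝ X] (W : ℝ → X →L[ℝ] Z) (t₀ : ℝ) (g : ℝ → X) (t : ℝ) : Z :=
  ∫ s in (0 : ℝ)..(t - t₀), W s (g (t - s))

/-- The density of the gain of the convolution with `Φ W(·) A`; its integral over `(0, ∞)` bounds
the operator norm of that convolution on bounded signals. -/
def gainDensity {Z X U Y : Type*} [NormedAddCommGroup Z] [NormedSpace ℝ Z] [NormedAddCommGroup X]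
    [NormedSpace ℝ X] [NormedAddCommGroup U] [NormedSpace ℝ U] [NormedAddCommGroup Y]
    [NormedSpace ℝ Y] (Φ : Z →L[ℝ] Y) (W : ℝ → X →L[ℝ] Z) (A : U →L[ℝ] X) (s : ℝ) : ℝ≥0∞ :=
  ‖(Φ.comp (W s)).comp A‖ₑ

section SmoothingKernel

variable {Z X U Y : Type*} [NormedAddCommGroup Z] [NormedSpace ℝ Z] [NormedAddCommGroup X]
  [NormedSpace ℝ X] [NormedAddCommGroup U] [NormedSpace ℝ U] [NormedAddCommGroup Y]
  [NormedSpace ℝ Y] {W : ℝ → X →L[ℝ] Z} {m : ℝ → ℝ}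

theorem smoothingConv_comp_add_right (t₀ h : ℝ) (g : ℝ → X) (t : ℝ) :
    smoothingConv W t₀ (fun τ => g (τ + h)) t = smoothingConv W (t₀ + h) g (t + h) := by
  simp only [smoothingConv, add_sub_add_right_eq_sub, sub_add_eq_add_sub]

theorem gainDensity_toSpanSingleton (Φ : Z →L[ℝ] Y) (x : X) (s : ℝ) :
    gainDensity Φ W (ContinuousLinearMap.toSpanSingleton ℝ x) s = ‖Φ (W s x)‖ₑ := by
  rw [gainDensity, ContinuousLinearMap.comp_toSpanSingleton, ← ofReal_norm,
    ContinuousLinearMap.norm_toSpanSingleton, ofReal_norm]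
  rfl

theorem enorm_apply_le_gainDensity_mul (Φ : Z →L[ℝ] Y) (A : U →L[ℝ] X) (s : ℝ) (u : U) :
    ‖Φ (W s (A u))‖ₑ ≤ gainDensity Φ W A s * ‖u‖ₑ :=
  ((Φ.comp (W s)).comp A).le_opENorm u

namespace IsSmoothingKernel

variable (hW : IsSmoothingKernel W m)
include hW

theorem nonneg {s : ℝ} (hs : 0 < s) : 0 ≤ m s := (norm_nonneg _).trans (hW.norm_le s hs)

theorem norm_apply_le {s : ℝ} (hs : 0 < s) (x : X) : ‖W s x‖ ≤ m s * ‖x‖ :=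
  (W s).le_of_opNorm_le (hW.norm_le s hs) x

theorem lintegral_gainDensity_ne_top (Φ : Z →L[ℝ] Y) (A : U →L[ℝ] X) :
    ∫⁻ s in Ioi 0, gainDensity Φ W A s ≠ ⊤ := by
  have integrable := (hW.integrableOn.const_mul ‖Φ‖).mul_const ‖A‖
  refine ne_top_of_le_ne_top integrable.lintegral_lt_top.ne
    (setLIntegral_mono' measurableSet_Ioi fun s hs => ?_)
  rw [gainDensity, ← ofReal_norm]
  refine ENNReal.ofReal_le_ofReal ((ContinuousLinearMap.opNorm_comp_le _ _).trans ?_)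
  gcongr
  exact (Φ.opNorm_comp_le _).trans (by gcongr; exact hW.norm_le s hs)

theorem tendsto_enorm_apply_sub (Φ : Z →L[ℝ] Y) (x : X) (t₀ : ℝ) :
    Tendsto (fun t => ‖Φ (W (t - t₀) x)‖ₑ) atTop (𝓝 0) := by
  have tendsto_sub : Tendsto (fun t : ℝ => t - t₀) atTop atTop :=
    tendsto_atTop_add_const_right atTop (-t₀) tendsto_id
  have tendsto_bound := ((hW.tendsto.comp tendsto_sub).mul_const ‖x‖).const_mul ‖Φ‖
  rw [zero_mul, mul_zero] at tendsto_bound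
  refine tendsto_zero_iff_enorm_tendsto_zero.1 (squeeze_zero_norm' ?_ tendsto_bound)
  filter_upwards [eventually_gt_atTop t₀] with t ht
  exact (Φ.le_opNorm _).trans (by gcongr; exact hW.norm_apply_le (sub_pos.2 ht) x)

theorem continuousOn_apply_comp_sub {t₀ t : ℝ} {g : ℝ → X} (hg : ContinuousOn g (Ici t₀)) :
    ContinuousOn (fun s => W s (g (t - s))) (Ioc 0 (t - t₀)) := by
  refine hW.continuousOn.comp (f := fun s => (s, g (t - s))) (continuousOn_id.prodMk ?_)
    fun s hs => ⟨hs.1, mem_univ _⟩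
  exact hg.comp (by fun_prop) fun s hs => mem_Ici.2 (by linarith [hs.2])

theorem intervalIntegrable {t₀ t : ℝ} (ht : t₀ ≤ t) {g : ℝ → X} (hg : ContinuousOn g (Ici t₀)) :
    IntervalIntegrable (fun s => W s (g (t - s))) volume 0 (t - t₀) := by
  rw [intervalIntegrable_iff_integrableOn_Ioc_of_le (sub_nonneg.2 ht)]
  obtain ⟨B, hB⟩ := isCompact_Icc.exists_bound_of_continuousOn
    (hg.mono (Icc_subset_Ici_self : Icc t₀ t ⊆ Ici t₀))
  refine ((hW.integrableOn.mono_set Ioc_subset_Ioi_self).mul_const B).mono'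
    ((hW.continuousOn_apply_comp_sub hg).aestronglyMeasurable measurableSet_Ioc)
    ((ae_restrict_iff' measurableSet_Ioc).2 (ae_of_all _ fun s hs => ?_))
  have := hW.nonneg hs.1
  exact (hW.norm_apply_le hs.1 _).trans
    (by gcongr; exact hB _ ⟨by linarith [hs.2], by linarith [hs.1]⟩)

theorem conv_add {t₀ t : ℝ} (ht : t₀ ≤ t) {g h : ℝ → X} (hg : ContinuousOn g (Ici t₀))
    (hh : ContinuousOn h (Ici t₀)) :
    smoothingConv W t₀ (fun τ => g τ + h τ) t =
      smoothingConv W t₀ g t + smoothingConv W t₀ h t := by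
  simp only [smoothingConv, map_add]
  exact intervalIntegral.integral_add (hW.intervalIntegrable ht hg) (hW.intervalIntegrable ht hh)

theorem conv_smul_sub {t₀ t : ℝ} (ht : t₀ ≤ t) (c : ℝ) {g h : ℝ → X}
    (hg : ContinuousOn g (Ici t₀)) (hh : ContinuousOn h (Ici t₀)) :
    smoothingConv W t₀ (fun τ => c • (g τ - h τ)) t =
      c • (smoothingConv W t₀ g t - smoothingConv W t₀ h t) := by
  simp only [smoothingConv, map_smul, map_sub]
  rw [intervalIntegral.integral_smul, intervalIntegral.integral_sub
    (hW.intervalIntegrable ht hg) (hW.intervalIntegrable ht hh)]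

theorem aestronglyMeasurable_indicator {g : ℝ → X} (hg : Continuous g) (t : ℝ) :
    AEStronglyMeasurable ((Ioi 0).indicator fun s => W s (g (t - s))) := by
  rw [aestronglyMeasurable_indicator_iff measurableSet_Ioi]
  exact (hW.continuousOn.comp (f := fun s => (s, g (t - s))) (by fun_prop)
    fun s hs => ⟨hs, mem_univ _⟩).aestronglyMeasurable measurableSet_Ioi

theorem continuousOn_conv_of_continuous {g : ℝ → X} (hg : Continuous g) (t₀ : ℝ) :
    ContinuousOn (smoothingConv W t₀ g) (Ici t₀) := by
  intro t₁ ht₁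
  let F : ℝ → ℝ → Z := fun t => (Ioi 0).indicator fun s => W s (g (t - s))
  obtain ⟨B, hB⟩ := isCompact_Icc.exists_bound_of_continuousOn
    (hg.continuousOn : ContinuousOn g (Icc (t₀ - 2) (t₁ + 2)))
  have dominated : ∀ᶠ t in 𝓝 t₁, ∀ᵐ s ∂volume.restrict (uIoc (-1) (t₁ - t₀ + 1)),
      ‖F t s‖ ≤ (Ioi 0).indicator (fun s => m s * B) s := by
    filter_upwards [Ioo_mem_nhds (sub_one_lt t₁) (lt_add_one t₁)] with t ht
    filter_upwards [ae_restrict_mem measurableSet_uIoc] with s hs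
    rw [uIoc_of_le (by linarith [mem_Ici.1 ht₁])] at hs
    rw [norm_indicator_eq_indicator_norm]
    refine indicator_le_indicator' fun hs₀ => (hW.norm_apply_le hs₀ _).trans ?_
    have := hW.nonneg hs₀
    gcongr
    exact hB _ ⟨by linarith [ht.1, hs.2], by linarith [ht.2, mem_Ioi.1 hs₀]⟩
  have integrable : IntervalIntegrable ((Ioi 0).indicator fun s => m s * B) volume (-1)
      (t₁ - t₀ + 1) :=
    ((integrable_indicator_iff measurableSet_Ioi).2
      (hW.integrableOn.mul_const B)).intervalIntegrable
  have continuous (s : ℝ) : Continuous fun t => F t s := by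
    by_cases hs : s ∈ Ioi 0
    · simp only [F, indicator_of_mem hs]
      fun_prop
    · simp only [F, indicator_of_notMem hs]
      exact continuous_const
  have continuousAt := intervalIntegral.continuousAt_parametric_primitive_of_dominated _ _ _
    (fun t => (hW.aestronglyMeasurable_indicator hg t).restrict) dominated integrable
    (ae_of_all _ fun s => (continuous s).continuousAt)
    (⟨by norm_num, by linarith [mem_Ici.1 ht₁]⟩ : (0 : ℝ) ∈ Ioo (-1) (t₁ - t₀ + 1))
    ⟨by linarith [mem_Ici.1 ht₁], lt_add_one (t₁ - t₀)⟩ (measure_singleton _)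
  have continuousAt_comp : ContinuousAt (fun t => ∫ s in (0 : ℝ)..(t - t₀), F t s) t₁ :=
    continuousAt.comp (f := fun t => (t, t - t₀)) (by fun_prop)
  refine continuousAt_comp.continuousWithinAt.congr_of_mem (fun t ht => ?_) ht₁
  refine intervalIntegral.integral_congr_ae (ae_of_all _ fun s hs => ?_)
  rw [uIoc_of_le (sub_nonneg.2 ht)] at hs
  exact (indicator_of_mem (s := Ioi 0) hs.1 fun s => W s (g (t - s))).symm

theorem continuousOn_conv {t₀ : ℝ} {g : ℝ → X} (hg : ContinuousOn g (Ici t₀)) :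
    ContinuousOn (smoothingConv W t₀ g) (Ici t₀) := by
  have continuous : Continuous fun τ => g (max t₀ τ) :=
    hg.comp_continuous (by fun_prop) fun τ => mem_Ici.2 (le_max_left _ _)
  refine (hW.continuousOn_conv_of_continuous continuous t₀).congr fun t ht => ?_
  refine intervalIntegral.integral_congr fun s hs => ?_
  rw [uIcc_of_le (sub_nonneg.2 ht)] at hs
  exact congrArg (fun τ => W s (g τ)) (max_eq_right (by linarith [hs.2])).symm

variable [CompleteSpace Z]

theorem map_conv [CompleteSpace Y] (Φ : Z →L[ℝ] Y) {t₀ t : ℝ} (ht : t₀ ≤ t) {g : ℝ → X}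
    (hg : ContinuousOn g (Ici t₀)) :
    Φ (smoothingConv W t₀ g t) = ∫ s in (0 : ℝ)..(t - t₀), Φ (W s (g (t - s))) :=
  (Φ.intervalIntegral_comp_comm (hW.intervalIntegrable ht hg)).symm

theorem enorm_map_conv_le [CompleteSpace Y] (Φ : Z →L[ℝ] Y) (A : U →L[ℝ] X) {t₀ t : ℝ}
    (ht : t₀ ≤ t) {u : ℝ → U} (hu : ContinuousOn u (Ici t₀)) :
    ‖Φ (smoothingConv W t₀ (fun τ => A (u τ)) t)‖ₑ ≤
      volterraIntegral (gainDensity Φ W A) t₀ (fun τ => ‖u τ‖ₑ) t := by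
  have continuousOn_comp : ContinuousOn (fun τ => A (u τ)) (Ici t₀) :=
    A.continuous.comp_continuousOn hu
  rw [hW.map_conv Φ ht continuousOn_comp,
    intervalIntegral.integral_of_le (sub_nonneg.2 ht)]
  exact (enorm_integral_le_lintegral_enorm _).trans
    (lintegral_mono fun s => enorm_apply_le_gainDensity_mul Φ A s _)

end IsSmoothingKernel

end SmoothingKernel

theorem iSup_unitBall_enorm_apply {E F : Type*} [NormedAddCommGroup E] [NormedSpace ℝ E]
    [NormedAddCommGroup F] [NormedSpace ℝ F] (L : E →L[ℝ] F) :
    ⨆ (x : E) (_ : ‖x‖ ≤ 1), ‖L x‖ₑ = ‖L‖ₑ := by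
  have bddAbove : BddAbove ((‖L ·‖₊) '' Metric.closedBall 0 1) := ⟨‖L‖₊, forall_mem_image.2
    fun x hx => L.unit_le_opNorm x (mem_closedBall_zero_iff.1 hx)⟩
  rw [enorm_eq_nnnorm, ← L.sSup_unitClosedBall_eq_nnnorm, ENNReal.coe_sSup bddAbove, iSup_image]
  simp only [mem_closedBall_zero_iff, enorm_eq_nnnorm]

section Duhamel

variable {E : Type*} [NormedAddCommGroup E] [NormedSpace ℝ E] {T : ℝ → E →L[ℝ] E} {M : ℝ}
  {g : ℝ → E}

theorem IsC0Semigroup.intervalIntegrable_comp_sub (hT : IsC0Semigroup T)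
    (hM : ∀ t, 0 ≤ t → ‖T t‖ ≤ M) {a b t : ℝ} (hab : a ≤ b) (hb : b ≤ t)
    (hg : ContinuousOn g (Ioc a b)) (hi : IntervalIntegrable g volume a b) :
    IntervalIntegrable (fun τ => T (t - τ) (g τ)) volume a b := by
  rw [intervalIntegrable_iff_integrableOn_Ioc_of_le hab] at hi ⊢
  have continuousOn : ContinuousOn (fun τ => T (t - τ) (g τ)) (Ioc a b) :=
    (hT.continuousOn_uncurry hM).comp (f := fun τ => (t - τ, g τ))
      (ContinuousOn.prodMk (by fun_prop) hg)
      fun τ hτ => ⟨mem_Ici.2 (by linarith [hτ.2]), mem_univ _⟩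
  refine (hi.norm.const_mul M).mono' (continuousOn.aestronglyMeasurable measurableSet_Ioc)
    ((ae_restrict_iff' measurableSet_Ioc).2 (ae_of_all _ fun τ hτ => ?_))
  exact (T _).le_of_opNorm_le (hM _ (by linarith [hτ.2])) _

theorem IsC0Semigroup.apply_add_integral_restart [CompleteSpace E] (hT : IsC0Semigroup T)
    (hM : ∀ t, 0 ≤ t → ‖T t‖ ≤ M) {t₀ t : ℝ} (ht₀ : 0 ≤ t₀) (ht : t₀ ≤ t)
    (hg : ContinuousOn g (Ioi 0)) (hi : IntervalIntegrable g volume 0 t) (x : E) :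
    T t x + ∫ τ in (0 : ℝ)..t, T (t - τ) (g τ) =
      T (t - t₀) (T t₀ x + ∫ τ in (0 : ℝ)..t₀, T (t₀ - τ) (g τ)) +
        ∫ τ in t₀..t, T (t - τ) (g τ) := by
  have hi₀ : IntervalIntegrable g volume 0 t₀ := hi.mono_set <| by
    rw [uIcc_of_le ht₀, uIcc_of_le (ht₀.trans ht)]
    exact Icc_subset_Icc_right ht
  have hi₁ : IntervalIntegrable g volume t₀ t := hi.mono_set <| by
    rw [uIcc_of_le ht, uIcc_of_le (ht₀.trans ht)]
    exact Icc_subset_Icc_left ht₀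
  have hg₀ : ContinuousOn g (Ioc 0 t₀) := hg.mono Ioc_subset_Ioi_self
  have hg₁ : ContinuousOn g (Ioc t₀ t) := hg.mono fun τ hτ => ht₀.trans_lt hτ.1
  have map_integral : T (t - t₀) (∫ τ in (0 : ℝ)..t₀, T (t₀ - τ) (g τ)) =
      ∫ τ in (0 : ℝ)..t₀, T (t - τ) (g τ) := by
    rw [← ContinuousLinearMap.intervalIntegral_comp_comm _
      (hT.intervalIntegrable_comp_sub hM ht₀ le_rfl hg₀ hi₀)]
    refine intervalIntegral.integral_congr fun τ hτ => ?_
    rw [uIcc_of_le ht₀] at hτ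
    rw [← hT.map_add_apply (sub_nonneg.2 ht) (sub_nonneg.2 hτ.2), sub_add_sub_cancel]
  rw [ContinuousLinearMap.map_add, map_integral, ← hT.map_add_apply (sub_nonneg.2 ht) ht₀,
    sub_add_cancel, add_assoc,
    intervalIntegral.integral_add_adjacent_intervals
      (hT.intervalIntegrable_comp_sub hM ht₀ ht hg₀ hi₀)
      (hT.intervalIntegrable_comp_sub hM ht le_rfl hg₁ hi₁)]

end Duhamel

namespace RegulatedSystem.Realization

variable {Z X : Type*} [NormedAddCommGroup Z] [InnerProductSpace ℝ Z] [NormedAddCommGroup X]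
  [NormedSpace ℝ X] {P : RegulatedSystem Z X} (hP : P.Standing) (𝓡 : P.Realization)

/-- The bound `t ↦ M (t^{-a} + 1) e^{-ωt}` for the norm of the operators `R(t)`. -/
def majorant (s : ℝ) : ℝ := 𝓡.M * ((s ^ (-𝓡.a) + 1) * Real.exp (-𝓡.ω * s))

theorem integrableOn_majorant : IntegrableOn 𝓡.majorant (Ioi 0) := by
  have singular := integrableOn_rpow_mul_exp_neg (s := -𝓡.a) (by linarith [𝓡.a_lt_one]) 𝓡.ω_pos
  have regular := integrableOn_rpow_mul_exp_neg (s := 0) (by norm_num) 𝓡.ω_pos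
  refine ((singular.add regular).const_mul 𝓡.M).congr (ae_of_all _ fun s => ?_)
  simp only [majorant, Pi.add_apply, Real.rpow_zero, add_mul]

theorem tendsto_majorant : Tendsto 𝓡.majorant atTop (𝓝 0) := by
  have power : Tendsto (fun s : ℝ => s ^ (-𝓡.a) + 1) atTop (𝓝 (0 + 1)) :=
    (tendsto_rpow_neg_atTop 𝓡.a_pos).add_const 1
  have exponential : Tendsto (fun s : ℝ => Real.exp (-𝓡.ω * s)) atTop (𝓝 0) :=
    Real.tendsto_exp_atBot.comp (tendsto_id.const_mul_atTop_of_neg (neg_lt_zero.2 𝓡.ω_pos))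
  have product := (power.mul exponential).const_mul 𝓡.M
  rwa [mul_zero, mul_zero] at product

include hP in
theorem isSmoothingKernel : IsSmoothingKernel 𝓡.R 𝓡.majorant where
  continuousOn := by
    obtain ⟨M, ω, -, -, -, hM⟩ := hP.stable_β.exists_bound
    exact 𝓡.lift.continuousOn_uncurry 𝓡.Q_injective hP.semigroup_β hM
  norm_le := 𝓡.lift_bound
  integrableOn := 𝓡.integrableOn_majorant
  tendsto := 𝓡.tendsto_majorant

/-- `I₀` as a bounded operator on `X`. -/
def I₀L : X →L[ℝ] X := ContinuousLinearMap.id ℝ X - 𝓡.ℓ.smulRight P.b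

theorem I₀L_apply (x : X) : 𝓡.I₀L x = P.I₀ x := (𝓡.I₀_eq x).symm

theorem ℓ_I₀ (x : X) : 𝓡.ℓ (P.I₀ x) = 0 := by
  rw [𝓡.I₀_eq, map_sub, map_smul, 𝓡.ℓ_b, smul_eq_mul, mul_one, sub_self]

/-! ### The constants as integrals of gain densities -/

theorem Cx_semigroup {s : ℝ} (hs : 0 < s) (x : X) : P.Cx (P.S s x) = 𝓡.c (𝓡.R s x) := by
  rw [← 𝓡.lift s hs, 𝓡.Cx_Q]

include hP in
theorem snorm_semigroup [CompleteSpace Z] {s : ℝ} (hs : 0 < s) (x : X) :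
    P.snorm P.s₁ (P.S s x) = ‖𝓡.E (𝓡.R s x)‖ₑ := by
  rw [← 𝓡.lift s hs, ← 𝓡.Q_eq]
  exact posNorm_apply hP.ι_negPow_s₁_injective _

/-- The functional `β ℓ Q`, whose values along `R` are the boundary terms in the integration by
parts of the output. -/
def boundary : Z →L[ℝ] ℝ := P.β • 𝓡.ℓ.comp 𝓡.Q

theorem boundary_R {s : ℝ} (hs : 0 < s) (x : X) :
    𝓡.boundary (𝓡.R s x) = P.β * 𝓡.ℓ (P.S s x) := by
  rw [← 𝓡.lift s hs]
  rfl

/-- The operator `v ↦ (1/β) v b`, that is `(1/β) B`. -/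
def controlL (P : RegulatedSystem Z X) : ℝ →L[ℝ] X :=
  ContinuousLinearMap.toSpanSingleton ℝ ((1 / P.β) • P.b)

/-- The operator `v ↦ v I₀ b_d`, that is `I₀ B_d`. -/
def disturbanceL (P : RegulatedSystem Z X) : ℝ →L[ℝ] X :=
  ContinuousLinearMap.toSpanSingleton ℝ (P.I₀ P.bd)

theorem DH_eq : P.DH = ∫⁻ s in Ioi 0, gainDensity 𝓡.c 𝓡.R (𝓡.I₀L.comp P.ι) s :=
  setLIntegral_congr_fun measurableSet_Ioi fun s hs => by
    rw [gainDensity, ← iSup_unitBall_enorm_apply]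
    simp only [𝓡.Cx_semigroup hs, ContinuousLinearMap.comp_apply, I₀L_apply]

include hP in
theorem DA_eq [CompleteSpace Z] :
    P.DA = ∫⁻ s in Ioi 0, gainDensity 𝓡.E 𝓡.R (𝓡.I₀L.comp P.ι) s :=
  setLIntegral_congr_fun measurableSet_Ioi fun s hs => by
    rw [gainDensity, ← iSup_unitBall_enorm_apply]
    simp only [𝓡.snorm_semigroup hP hs, ContinuousLinearMap.comp_apply, I₀L_apply]

include hP in
theorem DB_eq [CompleteSpace Z] : P.DB = ∫⁻ s in Ioi 0, gainDensity 𝓡.E 𝓡.R (controlL P) s :=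
  setLIntegral_congr_fun measurableSet_Ioi fun s hs => by
    simp only [controlL, gainDensity_toSpanSingleton, ← map_smul (P.S s), 𝓡.snorm_semigroup hP hs]

include hP in
theorem DBd_eq [CompleteSpace Z] :
    P.DBd = ∫⁻ s in Ioi 0, gainDensity 𝓡.E 𝓡.R (disturbanceL P) s :=
  setLIntegral_congr_fun measurableSet_Ioi fun s hs => by
    simp only [disturbanceL, gainDensity_toSpanSingleton, 𝓡.snorm_semigroup hP hs]

include hP in
theorem D_eq : P.D = ∫⁻ s in Ioi 0, gainDensity 𝓡.boundary 𝓡.R (controlL P) s :=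
  setLIntegral_congr_fun measurableSet_Ioi fun s hs => by
    simp only [controlL, gainDensity_toSpanSingleton, 𝓡.boundary_R hs, map_smul, 𝓡.K_eq,
      smul_eq_mul, one_div_mul_eq_div, mul_div_cancel_left₀ _ hP.β_pos.ne']

theorem Dd_eq : P.Dd = ∫⁻ s in Ioi 0, gainDensity 𝓡.boundary 𝓡.R (disturbanceL P) s :=
  setLIntegral_congr_fun measurableSet_Ioi fun s hs => by
    simp only [disturbanceL, gainDensity_toSpanSingleton, 𝓡.boundary_R hs, 𝓡.Kd_eq]

include hP 𝓡

theorem D_ne_top : P.D ≠ ⊤ :=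
  𝓡.D_eq hP ▸ (𝓡.isSmoothingKernel hP).lintegral_gainDensity_ne_top _ _

theorem Dd_ne_top : P.Dd ≠ ⊤ :=
  𝓡.Dd_eq ▸ (𝓡.isSmoothingKernel hP).lintegral_gainDensity_ne_top _ _

theorem DH_ne_top : P.DH ≠ ⊤ :=
  𝓡.DH_eq ▸ (𝓡.isSmoothingKernel hP).lintegral_gainDensity_ne_top _ _

theorem DB_ne_top [CompleteSpace Z] : P.DB ≠ ⊤ :=
  𝓡.DB_eq hP ▸ (𝓡.isSmoothingKernel hP).lintegral_gainDensity_ne_top _ _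

theorem DBd_ne_top [CompleteSpace Z] : P.DBd ≠ ⊤ :=
  𝓡.DBd_eq hP ▸ (𝓡.isSmoothingKernel hP).lintegral_gainDensity_ne_top _ _

theorem D_pos : 0 < P.D := by
  have tendsto_K : Tendsto (fun s => |P.K s|) (𝓝[>] 0) (𝓝 1) := by
    have := ((𝓡.ℓ.continuous.tendsto _).comp (hP.semigroup_β.tendsto_zero P.b)).abs
    rw [𝓡.ℓ_b, abs_one] at this
    exact this.congr fun s => by rw [𝓡.K_eq]; rfl
  obtain ⟨η, hη : 0 < η, half_le⟩ := mem_nhdsGT_iff_exists_Ioc_subset.1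
    (tendsto_K.eventually (eventually_ge_nhds one_half_lt_one))
  calc (0 : ℝ≥0∞) < ENNReal.ofReal (1 / 2) * ENNReal.ofReal η :=
        ENNReal.mul_pos (by simp) (by simp [hη])
    _ = ∫⁻ _ in Ioc 0 η, ENNReal.ofReal (1 / 2) := by simp
    _ ≤ ∫⁻ s in Ioc 0 η, ‖P.K s‖ₑ := setLIntegral_mono' measurableSet_Ioc fun s hs => by
        rw [← ofReal_norm]
        exact ENNReal.ofReal_le_ofReal (half_le hs)
    _ ≤ P.D := lintegral_mono_set Ioc_subset_Ioi_self

end RegulatedSystem.Realization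

/-! ### Restarting mild solutions -/

namespace RegulatedSystem.Realization

variable {Z X : Type*} [NormedAddCommGroup Z] [InnerProductSpace ℝ Z]
  [NormedAddCommGroup X] [NormedSpace ℝ X] {P : RegulatedSystem Z X} (hP : P.Standing)
  (𝓡 : P.Realization)

include hP

theorem continuousOn_boundary_semigroup (x : X) :
    ContinuousOn (fun s => P.β * 𝓡.ℓ (P.S s x)) (Ici 0) := by
  obtain ⟨M, ω, -, -, -, hM⟩ := hP.stable_β.exists_bound
  exact continuousOn_const.mul
    (𝓡.ℓ.continuous.comp_continuousOn (hP.semigroup_β.continuousOn hM x))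

theorem continuousOn_restart {g : ℝ → X} {t₀ : ℝ} (hg : ContinuousOn g (Ici t₀)) (x : X) :
    ContinuousOn (fun t => 𝓡.R (t - t₀) x + smoothingConv 𝓡.R t₀ g t) (Ioi t₀) := by
  have hR := 𝓡.isSmoothingKernel hP
  refine ContinuousOn.add ?_ ((hR.continuousOn_conv hg).mono Ioi_subset_Ici_self)
  exact hR.continuousOn.comp (f := fun t => (t - t₀, x)) (by fun_prop)
    fun t (ht : t₀ < t) => ⟨sub_pos.2 ht, mem_univ _⟩

variable [CompleteSpace Z]

theorem Q_smoothingConv [CompleteSpace X] {t₀ t : ℝ} (ht : t₀ ≤ t) {g : ℝ → X}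
    (hg : ContinuousOn g (Ici t₀)) :
    𝓡.Q (smoothingConv 𝓡.R t₀ g t) = ∫ τ in t₀..t, P.S (t - τ) (g τ) := by
  calc 𝓡.Q (smoothingConv 𝓡.R t₀ g t) = ∫ s in (0 : ℝ)..(t - t₀), 𝓡.Q (𝓡.R s (g (t - s))) :=
        (𝓡.isSmoothingKernel hP).map_conv 𝓡.Q ht hg
    _ = ∫ s in (0 : ℝ)..(t - t₀), P.S s (g (t - s)) := by
        refine intervalIntegral.integral_congr_ae (ae_of_all _ fun s hs => ?_)
        rw [uIoc_of_le (sub_nonneg.2 ht)] at hs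
        exact 𝓡.lift s hs.1 _
    _ = ∫ τ in t₀..t, P.S (t - τ) (g τ) := by
        simpa only [sub_sub_cancel, sub_self] using (intervalIntegral.integral_comp_sub_left
          (a := t₀) (b := t) (fun s => P.S s (g (t - s))) t).symm

theorem Q_restart [CompleteSpace X] {z₀ : Z} {g : ℝ → X} {z : ℝ → Z}
    (hz : P.IsMildSolution z₀ g z) (hg : ContinuousOn g (Ioi 0)) {t₀ t : ℝ} (ht₀ : 0 < t₀)
    (ht : t₀ < t) :
    𝓡.Q (𝓡.R (t - t₀) (P.ι (z t₀)) + smoothingConv 𝓡.R t₀ g t) = P.ι (z t) := by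
  obtain ⟨M, ω, -, -, -, hM⟩ := hP.stable_β.exists_bound
  rw [map_add, 𝓡.lift _ (sub_pos.2 ht), 𝓡.Q_smoothingConv hP ht.le
      (hg.mono (Ici_subset_Ioi.2 ht₀)), hz.eq t (ht₀.trans ht).le, hz.eq t₀ ht₀.le]
  exact (hP.semigroup_β.apply_add_integral_restart hM ht₀.le ht.le hg
    (hz.integrable t (ht₀.trans ht).le) _).symm

theorem exists_restart [CompleteSpace X] {z₀ : Z} {g : ℝ → X} {z : ℝ → Z}
    (hz : P.IsMildSolution z₀ g z) (hg : ContinuousOn g (Ioi 0)) :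
    ∃ v : ℝ → Z, ContinuousOn v (Ioi 0) ∧ (∀ t, 0 < t → 𝓡.Q (v t) = P.ι (z t)) ∧
      ∀ t₀ t, 0 < t₀ → t₀ < t →
        v t = 𝓡.R (t - t₀) (P.ι (z t₀)) + smoothingConv 𝓡.R t₀ g t := by
  let v (t : ℝ) : Z := 𝓡.R (t - t / 2) (P.ι (z (t / 2))) + smoothingConv 𝓡.R (t / 2) g t
  have Q_v (t : ℝ) (ht : 0 < t) : 𝓡.Q (v t) = P.ι (z t) :=
    𝓡.Q_restart hP hz hg (half_pos ht) (half_lt_self ht)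
  have v_eq (t₀ t : ℝ) (ht₀ : 0 < t₀) (ht : t₀ < t) :
      v t = 𝓡.R (t - t₀) (P.ι (z t₀)) + smoothingConv 𝓡.R t₀ g t :=
    𝓡.Q_injective (by rw [Q_v t (ht₀.trans ht), 𝓡.Q_restart hP hz hg ht₀ ht])
  refine ⟨v, fun t (ht : 0 < t) => ContinuousAt.continuousWithinAt ?_, Q_v, v_eq⟩
  have continuousAt := (𝓡.continuousOn_restart hP (hg.mono (Ici_subset_Ioi.2 (half_pos ht)))
    (P.ι (z (t / 2)))).continuousAt (Ioi_mem_nhds (half_lt_self ht))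
  refine continuousAt.congr ?_
  filter_upwards [Ioi_mem_nhds (half_lt_self ht)] with s hs
  exact (v_eq _ _ (half_pos ht) hs).symm

/-! ### The output of a convolution with a scalar signal -/

theorem c_smoothingConv_smul {t₀ t : ℝ} (ht : t₀ ≤ t) {p p' : ℝ → ℝ}
    (hp : ContinuousOn p (Ici t₀)) (hp' : ContinuousOn p' (Ici t₀))
    (hd : ∀ τ, t₀ < τ → HasDerivAt p (p' τ) τ) (x : X) :
    𝓡.c (smoothingConv 𝓡.R t₀ (fun τ => p τ • x) t) =
      P.β * 𝓡.ℓ x * p t - P.β * 𝓡.ℓ (P.S (t - t₀) x) * p t₀ -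
        ∫ s in (0 : ℝ)..(t - t₀), P.β * 𝓡.ℓ (P.S s x) * p' (t - s) := by
  have hR := 𝓡.isSmoothingKernel hP
  have maps : MapsTo (fun s => t - s) (uIcc 0 (t - t₀)) (Ici t₀) := fun s hs => by
    rw [uIcc_of_le (sub_nonneg.2 ht)] at hs
    exact mem_Ici.2 (by linarith [hs.2])
  have boundary_cont : ContinuousOn (fun s => P.β * 𝓡.ℓ (P.S s x)) (uIcc 0 (t - t₀)) := by
    rw [uIcc_of_le (sub_nonneg.2 ht)]
    exact (𝓡.continuousOn_boundary_semigroup hP x).mono Icc_subset_Ici_self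
  have boundary_deriv (s : ℝ) (hs : s ∈ Ioo (min 0 (t - t₀)) (max 0 (t - t₀))) :
      HasDerivWithinAt (fun s => P.β * 𝓡.ℓ (P.S s x)) (-𝓡.c (𝓡.R s x)) (Ioi s) s := by
    rw [min_eq_left (sub_nonneg.2 ht)] at hs
    exact 𝓡.deriv s hs.1 x
  have signal_deriv (s : ℝ) (hs : s ∈ Ioo (min 0 (t - t₀)) (max 0 (t - t₀))) :
      HasDerivWithinAt (fun s => p (t - s)) (-p' (t - s)) (Ioi s) s := by
    rw [max_eq_right (sub_nonneg.2 ht)] at hs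
    exact (HasDerivAt.comp_const_sub t s (hd (t - s) (by linarith [hs.2]))).hasDerivWithinAt
  have output_integrable : IntervalIntegrable (fun s => 𝓡.c (𝓡.R s x)) volume 0 (t - t₀) :=
    have integrable := hR.intervalIntegrable (g := fun _ => x) ht continuousOn_const
    ⟨𝓡.c.integrable_comp integrable.1, 𝓡.c.integrable_comp integrable.2⟩
  have by_parts := intervalIntegral.integral_mul_deriv_eq_deriv_mul_of_hasDeriv_right
    boundary_cont (hp.comp (by fun_prop) maps) boundary_deriv signal_deriv output_integrable.neg
    ((hp'.comp (by fun_prop) maps).intervalIntegrable).neg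
  simp only [mul_neg, neg_mul, intervalIntegral.integral_neg, Function.comp_apply, sub_sub_cancel,
    sub_zero, hP.semigroup_β.map_zero_apply] at by_parts
  rw [hR.map_conv 𝓡.c ht (g := fun τ => p τ • x) (hp.smul continuousOn_const)]
  simp only [map_smul, smul_eq_mul, mul_comm (p _)]
  linarith

end RegulatedSystem.Realization

/-! ### Trajectories and their asymptotic bounds -/

theorem volterraIntegral_le_const_mul {k φ ψ : ℝ → ℝ≥0∞} {c : ℝ≥0∞} {t₀ t : ℝ}
    (hφ : ∀ τ, t₀ ≤ τ → φ τ ≤ c * ψ τ) :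
    volterraIntegral k t₀ φ t ≤ volterraIntegral (fun s => c * k s) t₀ ψ t :=
  setLIntegral_mono' measurableSet_Ioc fun s hs => by
    calc k s * φ (t - s) ≤ k s * (c * ψ (t - s)) := by
          gcongr
          exact hφ _ (by linarith [hs.2])
      _ = c * k s * ψ (t - s) := by rw [mul_left_comm, mul_assoc]

/-- `p` is continuous on `[t₀, ∞)` and continuously differentiable inside, and the upper limit of
`|p'|` at infinity is at most `L`. -/
structure HasLimsupDerivLE (p : ℝ → ℝ) (t₀ : ℝ) (L : ℝ≥0∞) : Prop where
  continuousOn : ContinuousOn p (Ici t₀)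
  exists_deriv : ∃ p' : ℝ → ℝ, ContinuousOn p' (Ici t₀) ∧
    (∀ τ, t₀ < τ → HasDerivAt p (p' τ) τ) ∧ limsup (fun t => ‖p' t‖ₑ) atTop ≤ L

theorem hasLimsupDerivLE_zero (t₀ : ℝ) : HasLimsupDerivLE (fun _ => 0) t₀ 0 where
  continuousOn := continuousOn_const
  exists_deriv := ⟨fun _ => 0, continuousOn_const, fun τ _ => hasDerivAt_const τ 0, by simp⟩

namespace RegulatedSystem.Realization

variable {Z X : Type*} [NormedAddCommGroup Z] [InnerProductSpace ℝ Z]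
  [NormedAddCommGroup X] [NormedSpace ℝ X] {P : RegulatedSystem Z X} (hP : P.Standing)
  (𝓡 : P.Realization)

/-- `v` is the lift to `Z` of a mild solution of `y' = A_β y + I₀ (F + B_d δ) + (1/β) B ρ` on
`[t₀, ∞)` with `y(t₀) = x₀`. -/
structure IsTrajectory (t₀ : ℝ) (x₀ : X) (F : ℝ → Z) (ρ δ : ℝ → ℝ) (v : ℝ → Z) : Prop where
  F_cont : ContinuousOn F (Ici t₀)
  ρ_cont : ContinuousOn ρ (Ici t₀)
  δ_cont : ContinuousOn δ (Ici t₀)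
  v_cont : ContinuousOn v (Ici t₀)
  eq : ∀ t, t₀ < t → v t = 𝓡.R (t - t₀) x₀ + smoothingConv 𝓡.R t₀ (fun τ =>
    𝓡.I₀L.comp P.ι (F τ) + (disturbanceL P (δ τ) + controlL P (ρ τ))) t

variable {𝓡}

include hP in
theorem limsup_sub_c_smoothingConv_le [CompleteSpace Z] {t₀ : ℝ} {p : ℝ → ℝ} {L : ℝ≥0∞}
    (hp : HasLimsupDerivLE p t₀ L) (hL : L ≠ ⊤) (x : X) :
    limsup (fun t => ‖P.β * 𝓡.ℓ x * p t - 𝓡.c (smoothingConv 𝓡.R t₀ (fun τ => p τ • x) t)‖ₑ)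
        atTop ≤
      (∫⁻ s in Ioi 0, gainDensity 𝓡.boundary 𝓡.R (ContinuousLinearMap.toSpanSingleton ℝ x) s) *
        L := by
  obtain ⟨hp_cont, p', hp'_cont, hd, hp'_le⟩ := hp
  have hR := 𝓡.isSmoothingKernel hP
  have initial : limsup (fun t => ‖p t₀‖ₑ * ‖𝓡.boundary (𝓡.R (t - t₀) x)‖ₑ) atTop ≤ ‖p t₀‖ₑ * 0 :=
    limsup_enn_const_mul_le_of_le enorm_ne_top
      (hR.tendsto_enorm_apply_sub 𝓡.boundary x t₀).limsup_eq.le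
  have bound := limsup_enn_add_le_of_le initial (limsup_volterraIntegral_enorm_le
    (hR.lintegral_gainDensity_ne_top 𝓡.boundary (ContinuousLinearMap.toSpanSingleton ℝ x))
    hp'_cont hp'_le hL)
  rw [mul_zero, zero_add] at bound
  refine limsup_le_of_eventually_le_of_le ?_ bound
  filter_upwards [eventually_gt_atTop t₀] with t ht
  rw [𝓡.c_smoothingConv_smul hP ht.le hp_cont hp'_cont hd, sub_sub, sub_sub_cancel,
    ← 𝓡.boundary_R (sub_pos.2 ht), mul_comm _ (p t₀)]
  refine (enorm_add_le _ _).trans ?_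
  rw [enorm_mul, intervalIntegral.integral_of_le (sub_nonneg.2 ht.le)]
  gcongr
  refine (enorm_integral_le_lintegral_enorm _).trans_eq ?_
  refine setLIntegral_congr_fun measurableSet_Ioc fun s hs => ?_
  simp only [gainDensity_toSpanSingleton, 𝓡.boundary_R hs.1, enorm_mul]

namespace IsTrajectory

variable {t₀ : ℝ} {x₀ : X} {F : ℝ → Z} {ρ δ : ℝ → ℝ} {v : ℝ → Z}
  (h : 𝓡.IsTrajectory t₀ x₀ F ρ δ v)

include hP h

theorem eq_add {t : ℝ} (ht : t₀ < t) : v t = 𝓡.R (t - t₀) x₀ +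
    (smoothingConv 𝓡.R t₀ (fun τ => 𝓡.I₀L.comp P.ι (F τ)) t +
      (smoothingConv 𝓡.R t₀ (fun τ => disturbanceL P (δ τ)) t +
        smoothingConv 𝓡.R t₀ (fun τ => controlL P (ρ τ)) t)) := by
  have hR := 𝓡.isSmoothingKernel hP
  have hF : ContinuousOn (fun τ => 𝓡.I₀L.comp P.ι (F τ)) (Ici t₀) :=
    (𝓡.I₀L.comp P.ι).continuous.comp_continuousOn h.F_cont
  have hδ : ContinuousOn (fun τ => disturbanceL P (δ τ)) (Ici t₀) :=
    (disturbanceL P).continuous.comp_continuousOn h.δ_cont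
  have hρ : ContinuousOn (fun τ => controlL P (ρ τ)) (Ici t₀) :=
    (controlL P).continuous.comp_continuousOn h.ρ_cont
  rw [h.eq t ht, hR.conv_add (h := fun τ => disturbanceL P (δ τ) + controlL P (ρ τ)) ht.le hF
    (hδ.add hρ), hR.conv_add ht.le hδ hρ]

/-- The output error splits into the tracking errors of `p` and `δ`, which integration by parts
controls by the derivatives, and terms that decay or are controlled by `F` and `ρ - p`. -/
theorem error_eq {p : ℝ → ℝ} (hp : ContinuousOn p (Ici t₀)) {t : ℝ} (ht : t₀ < t) :
    ρ t - 𝓡.c (v t) =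
      (P.β * 𝓡.ℓ ((1 / P.β) • P.b) * p t -
        𝓡.c (smoothingConv 𝓡.R t₀ (fun τ => controlL P (p τ)) t)) +
      ((P.β * 𝓡.ℓ (P.I₀ P.bd) * δ t -
        𝓡.c (smoothingConv 𝓡.R t₀ (fun τ => disturbanceL P (δ τ)) t)) +
      ((ρ t - p t) + -(𝓡.c (𝓡.R (t - t₀) x₀) +
        (𝓡.c (smoothingConv 𝓡.R t₀ (fun τ => 𝓡.I₀L.comp P.ι (F τ)) t) +
          𝓡.c (smoothingConv 𝓡.R t₀ (fun τ => controlL P (ρ τ - p τ)) t))))) := by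
  have control_split : smoothingConv 𝓡.R t₀ (fun τ => controlL P (ρ τ)) t =
      smoothingConv 𝓡.R t₀ (fun τ => controlL P (p τ)) t +
        smoothingConv 𝓡.R t₀ (fun τ => controlL P (ρ τ - p τ)) t := by
    have hp' : ContinuousOn (fun τ => controlL P (p τ)) (Ici t₀) :=
      (controlL P).continuous.comp_continuousOn hp
    have hsub : ContinuousOn (fun τ => controlL P (ρ τ - p τ)) (Ici t₀) :=
      (controlL P).continuous.comp_continuousOn (h.ρ_cont.sub hp)
    rw [← (𝓡.isSmoothingKernel hP).conv_add ht.le hp' hsub]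
    simp only [map_sub, add_sub_cancel]
  rw [h.eq_add hP ht, control_split, 𝓡.ℓ_I₀, map_smul, 𝓡.ℓ_b, smul_eq_mul, mul_one,
    mul_one_div_cancel hP.β_pos.ne']
  simp only [map_add]
  ring

variable [CompleteSpace Z]

theorem enorm_le {Y : Type*} [NormedAddCommGroup Y] [NormedSpace ℝ Y] [CompleteSpace Y]
    (Φ : Z →L[ℝ] Y) {t : ℝ} (ht : t₀ < t) : ‖Φ (v t)‖ₑ ≤
    ‖Φ (𝓡.R (t - t₀) x₀)‖ₑ +
      (volterraIntegral (gainDensity Φ 𝓡.R (𝓡.I₀L.comp P.ι)) t₀ (fun τ => ‖F τ‖ₑ) t +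
        (volterraIntegral (gainDensity Φ 𝓡.R (disturbanceL P)) t₀ (fun τ => ‖δ τ‖ₑ) t +
          volterraIntegral (gainDensity Φ 𝓡.R (controlL P)) t₀ (fun τ => ‖ρ τ‖ₑ) t)) := by
  have hR := 𝓡.isSmoothingKernel hP
  rw [h.eq_add hP ht, map_add, map_add, map_add]
  refine (enorm_add_le _ _).trans (add_le_add le_rfl ?_)
  refine (enorm_add_le _ _).trans (add_le_add (hR.enorm_map_conv_le Φ _ ht.le h.F_cont) ?_)
  exact (enorm_add_le _ _).trans (add_le_add (hR.enorm_map_conv_le Φ _ ht.le h.δ_cont)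
    (hR.enorm_map_conv_le Φ _ ht.le h.ρ_cont))

theorem limsup_state_le (hε : P.ε * P.DA < 1)
    (hF : ∀ τ, t₀ ≤ τ → ‖F τ‖ₑ ≤ P.ε * ‖𝓡.E (v τ)‖ₑ) {Lρ Lδ : ℝ≥0∞}
    (hρ : limsup (fun t => ‖ρ t‖ₑ) atTop ≤ Lρ) (hδ : limsup (fun t => ‖δ t‖ₑ) atTop ≤ Lδ)
    (hLρ : Lρ ≠ ⊤) (hLδ : Lδ ≠ ⊤) :
    limsup (fun t => ‖𝓡.E (v t)‖ₑ) atTop ≤ (P.DBd * Lδ + P.DB * Lρ) / (1 - P.ε * P.DA) := by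
  have hR := 𝓡.isSmoothingKernel hP
  have gain_eq : ∫⁻ s in Ioi 0, P.ε * gainDensity 𝓡.E 𝓡.R (𝓡.I₀L.comp P.ι) s = P.ε * P.DA := by
    rw [lintegral_const_mul' _ _ ENNReal.coe_ne_top, 𝓡.DA_eq hP]
  have forcing_le : limsup (fun t => ‖𝓡.E (𝓡.R (t - t₀) x₀)‖ₑ +
      (volterraIntegral (gainDensity 𝓡.E 𝓡.R (disturbanceL P)) t₀ (fun τ => ‖δ τ‖ₑ) t +
        volterraIntegral (gainDensity 𝓡.E 𝓡.R (controlL P)) t₀ (fun τ => ‖ρ τ‖ₑ) t)) atTop ≤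
      0 + (P.DBd * Lδ + P.DB * Lρ) := by
    rw [𝓡.DBd_eq hP, 𝓡.DB_eq hP]
    exact limsup_enn_add_le_of_le (hR.tendsto_enorm_apply_sub 𝓡.E x₀ t₀).limsup_eq.le
      (limsup_enn_add_le_of_le
        (limsup_volterraIntegral_enorm_le (hR.lintegral_gainDensity_ne_top _ _) h.δ_cont hδ hLδ)
        (limsup_volterraIntegral_enorm_le (hR.lintegral_gainDensity_ne_top _ _) h.ρ_cont hρ hLρ))
  rw [zero_add] at forcing_le
  have forcing_ne_top := ne_top_of_le_ne_top (ENNReal.add_ne_top.2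
    ⟨ENNReal.mul_ne_top (𝓡.DBd_ne_top hP) hLδ, ENNReal.mul_ne_top (𝓡.DB_ne_top hP) hLρ⟩) forcing_le
  have small_gain := limsup_le_of_le_add_volterraIntegral (gain_eq ▸ hε)
    (exists_enorm_bound_Icc_of_continuousOn (𝓡.E.continuous.comp_continuousOn h.v_cont))
    (fun t ht => ((h.enorm_le hP 𝓡.E ht).trans_eq (add_left_comm _ _ _)).trans
      ((add_comm _ _).trans_le (add_le_add le_rfl (volterraIntegral_le_const_mul hF))))
    forcing_ne_top
  rw [gain_eq] at small_gain
  exact small_gain.trans (ENNReal.div_le_div_right forcing_le _)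

theorem limsup_error_le {p : ℝ → ℝ} {Lp Lδ LF Lρ : ℝ≥0∞} (hp : HasLimsupDerivLE p t₀ Lp)
    (hδ : HasLimsupDerivLE δ t₀ Lδ) (hF : limsup (fun t => ‖F t‖ₑ) atTop ≤ LF)
    (hρ : limsup (fun t => ‖ρ t - p t‖ₑ) atTop ≤ Lρ) (hLp : Lp ≠ ⊤) (hLδ : Lδ ≠ ⊤) (hLF : LF ≠ ⊤)
    (hLρ : Lρ ≠ ⊤) :
    limsup (fun t => ‖ρ t - 𝓡.c (v t)‖ₑ) atTop ≤
      P.D * Lp + (P.Dd * Lδ + (Lρ +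
        (0 + (P.DH * LF + (∫⁻ s in Ioi 0, gainDensity 𝓡.c 𝓡.R (controlL P) s) * Lρ)))) := by
  have hR := 𝓡.isSmoothingKernel hP
  have sub_cont : ContinuousOn (fun τ => ρ τ - p τ) (Ici t₀) := h.ρ_cont.sub hp.continuousOn
  rw [𝓡.D_eq hP, 𝓡.Dd_eq, 𝓡.DH_eq]
  refine limsup_le_of_eventually_le_of_le ?_
    (limsup_enn_add_le_of_le (limsup_sub_c_smoothingConv_le hP hp hLp _)
      (limsup_enn_add_le_of_le (limsup_sub_c_smoothingConv_le hP hδ hLδ _)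
        (limsup_enn_add_le_of_le hρ
          (limsup_enn_add_le_of_le (hR.tendsto_enorm_apply_sub 𝓡.c x₀ t₀).limsup_eq.le
            (limsup_enn_add_le_of_le (limsup_volterraIntegral_enorm_le
                (hR.lintegral_gainDensity_ne_top _ _) h.F_cont hF hLF)
              (limsup_volterraIntegral_enorm_le
                (hR.lintegral_gainDensity_ne_top _ _) sub_cont hρ hLρ))))))
  filter_upwards [eventually_gt_atTop t₀] with t ht
  rw [h.error_eq hP hp.continuousOn ht]
  refine (enorm_add_le _ _).trans (add_le_add le_rfl ?_)
  refine (enorm_add_le _ _).trans (add_le_add le_rfl ?_)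
  refine (enorm_add_le _ _).trans (add_le_add le_rfl ?_)
  rw [enorm_neg]
  refine (enorm_add_le _ _).trans (add_le_add le_rfl ?_)
  exact (enorm_add_le _ _).trans (add_le_add (hR.enorm_map_conv_le 𝓡.c _ ht.le h.F_cont)
    (hR.enorm_map_conv_le 𝓡.c _ ht.le sub_cont))

end IsTrajectory

end RegulatedSystem.Realization

/-! ### Difference quotients and averages -/

/-- The forward difference quotient `t ↦ (f (t + h) - f t) / h`. It serves as a derivative of
signals that are only known to be continuous. -/
def differenceQuotient {E : Type*} [AddCommGroup E] [Module ℝ E] (h : ℝ) (f : ℝ → E) (t : ℝ) : E :=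
  h⁻¹ • (f (t + h) - f t)

theorem exists_differenceQuotient_eq {f f' : ℝ → ℝ} {t h : ℝ} (hh : 0 < h)
    (hf : ContinuousOn f (Ici t)) (hf' : ∀ τ, t < τ → HasDerivAt f (f' τ) τ) :
    ∃ ξ, t < ξ ∧ differenceQuotient h f t = f' ξ := by
  obtain ⟨ξ, hξ, slope_eq⟩ := exists_hasDerivAt_eq_slope f f' (lt_add_of_pos_right t hh)
    (hf.mono Icc_subset_Ici_self) fun τ hτ => hf' τ hτ.1
  exact ⟨ξ, hξ.1, by
    rw [slope_eq, add_sub_cancel_left, differenceQuotient, smul_eq_mul, div_eq_inv_mul]⟩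

theorem continuousOn_differenceQuotient {E : Type*} [NormedAddCommGroup E] [NormedSpace ℝ E]
    {f : ℝ → E} {t₀ h : ℝ} (hh : 0 < h) (hf : ContinuousOn f (Ici t₀)) :
    ContinuousOn (differenceQuotient h f) (Ici t₀) := by
  have hshift : MapsTo (fun τ => τ + h) (Ici t₀) (Ici t₀) := fun τ hτ =>
    (mem_Ici.1 hτ).trans (le_add_of_nonneg_right hh.le)
  exact ((hf.comp (by fun_prop) hshift).sub hf).const_smul h⁻¹

theorem HasLimsupDerivLE.limsup_differenceQuotient_le {p : ℝ → ℝ} {t₀ h : ℝ} {L : ℝ≥0∞}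
    (hp : HasLimsupDerivLE p t₀ L) (hh : 0 < h) :
    limsup (fun t => ‖differenceQuotient h p t‖ₑ) atTop ≤ L := by
  obtain ⟨hcont, p', -, hderiv, hle⟩ := hp
  rw [limsup_enn_le_iff_forall_pos] at hle ⊢
  intro δ hδ
  obtain ⟨T, hT⟩ := eventually_atTop.1 (hle δ hδ)
  filter_upwards [eventually_ge_atTop T, eventually_ge_atTop t₀] with t hTt ht
  obtain ⟨ξ, hξ, hξ_eq⟩ := exists_differenceQuotient_eq hh (hcont.mono (Ici_subset_Ici.2 ht))
    fun τ hτ => hderiv τ (ht.trans_lt hτ)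
  rw [hξ_eq]
  exact hT ξ (hTt.trans hξ.le)

theorem hasLimsupDerivLE_differenceQuotient {p p' : ℝ → ℝ} {t₀ h : ℝ} {L : ℝ≥0∞} (hh : 0 < h)
    (hp : ContinuousOn p (Ici t₀)) (hd : ∀ τ, t₀ < τ → HasDerivAt p (p' τ) τ)
    (hp' : HasLimsupDerivLE p' t₀ L) : HasLimsupDerivLE (differenceQuotient h p) t₀ L where
  continuousOn := continuousOn_differenceQuotient hh hp
  exists_deriv := ⟨differenceQuotient h p', continuousOn_differenceQuotient hh hp'.continuousOn,
    fun τ hτ => (((hd (τ + h) (by linarith)).comp_add_const τ h).sub (hd τ hτ)).const_smul h⁻¹,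
    hp'.limsup_differenceQuotient_le hh⟩

/-- The average of `e` over `[t, t + h]`, whose derivative is the difference quotient of `e`. -/
def movingAverage (h : ℝ) (e : ℝ → ℝ) (t : ℝ) : ℝ := h⁻¹ * ∫ s in t..(t + h), e s

theorem hasDerivAt_movingAverage {e : ℝ → ℝ} (he : Continuous e) (h t : ℝ) :
    HasDerivAt (movingAverage h e) (differenceQuotient h e t) t := by
  have hprim : ∀ x, HasDerivAt (fun y => ∫ s in (0 : ℝ)..y, e s) (e x) x := fun x =>
    intervalIntegral.integral_hasDerivAt_right (he.intervalIntegrable _ _)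
      (he.stronglyMeasurableAtFilter _ _) he.continuousAt
  have average_eq : movingAverage h e = fun t =>
      h⁻¹ * ((∫ s in (0 : ℝ)..(t + h), e s) - ∫ s in (0 : ℝ)..t, e s) := by
    funext t
    rw [movingAverage, intervalIntegral.integral_interval_sub_left (he.intervalIntegrable _ _)
      (he.intervalIntegrable _ _)]
  rw [average_eq]
  exact (((hprim (t + h)).comp_add_const t h).sub (hprim t)).const_mul _

theorem enorm_sub_movingAverage_le {e : ℝ → ℝ} (he : Continuous e) {h : ℝ} (hh : 0 < h) (t : ℝ) :
    ‖e t - movingAverage h e t‖ₑ ≤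
      ENNReal.ofReal h⁻¹ * ∫⁻ s in Ioc 0 h, ‖e (t + s) - e t‖ₑ := by
  have sub_eq : e t - movingAverage h e t = -(h⁻¹ * ∫ s in (0 : ℝ)..h, (e (t + s) - e t)) := by
    have he_shift : Continuous fun s => e (t + s) := by fun_prop
    rw [intervalIntegral.integral_sub (he_shift.intervalIntegrable _ _)
      (continuous_const.intervalIntegrable _ _), intervalIntegral.integral_comp_add_left, add_zero,
      movingAverage, intervalIntegral.integral_const, smul_eq_mul, sub_zero]
    field_simp
    ring
  rw [sub_eq, enorm_neg, enorm_mul, Real.enorm_eq_ofReal (inv_nonneg.2 hh.le),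
    intervalIntegral.integral_of_le hh.le]
  gcongr
  exact enorm_integral_le_lintegral_enorm _

theorem limsup_sub_movingAverage_le {e : ℝ → ℝ} (he : Continuous e) {B : ℝ≥0}
    (hB : ∀ τ, ‖e τ‖ₑ ≤ B) {L : ℝ≥0∞}
    (hL : ∀ h, 0 < h → limsup (fun t => ‖differenceQuotient h e t‖ₑ) atTop ≤ L)
    {h : ℝ} (hh : 0 < h) :
    limsup (fun t => ‖e t - movingAverage h e t‖ₑ) atTop ≤ L * ENNReal.ofReal h := by
  have increment_le : ∀ s ∈ Ioc 0 h,
      limsup (fun t => ‖e (t + s) - e t‖ₑ) atTop ≤ ENNReal.ofReal h * L := fun s hs => by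
    have increment_eq : ∀ t, ‖e (t + s) - e t‖ₑ = ‖s‖ₑ * ‖differenceQuotient s e t‖ₑ := fun t => by
      rw [← enorm_smul, differenceQuotient, smul_inv_smul₀ hs.1.ne']
    simp only [increment_eq]
    refine (limsup_enn_const_mul_le_of_le enorm_ne_top (hL s hs.1)).trans ?_
    rw [Real.enorm_eq_ofReal hs.1.le]
    gcongr
    exact hs.2
  have integral_le : limsup (fun t => ∫⁻ s in Ioc 0 h, ‖e (t + s) - e t‖ₑ) atTop ≤
      ENNReal.ofReal h * L * ENNReal.ofReal h :=
    limsup_setLIntegral_le (B := B + B) (T := 0)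
      (fun t => ((he.comp (by fun_prop)).sub continuous_const).enorm.measurable)
      (fun t _ s _ => enorm_sub_le.trans (add_le_add (hB _) (hB _))) increment_le
  refine limsup_le_of_eventually_le_of_le
    (Eventually.of_forall fun t => enorm_sub_movingAverage_le he hh t)
    ((limsup_enn_const_mul_le_of_le ENNReal.ofReal_ne_top integral_le).trans_eq ?_)
  rw [← mul_assoc, ← mul_assoc, ← ENNReal.ofReal_mul (inv_nonneg.2 hh.le),
    inv_mul_cancel₀ hh.ne', ENNReal.ofReal_one, one_mul]

theorem exists_hasLimsupDerivLE_approx {e : ℝ → ℝ} {t₀ : ℝ} (he : ContinuousOn e (Ici t₀))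
    (hlim : limsup (fun t => ‖e t‖ₑ) atTop ≠ ⊤) {L : ℝ≥0∞}
    (hL : ∀ h, 0 < h → limsup (fun t => ‖differenceQuotient h e t‖ₑ) atTop ≤ L)
    {h : ℝ} (hh : 0 < h) :
    ∃ p, HasLimsupDerivLE p t₀ L ∧
      limsup (fun t => ‖e t - p t‖ₑ) atTop ≤ L * ENNReal.ofReal h := by
  obtain ⟨B, hB⟩ := exists_enorm_bound_of_limsup_ne_top he hlim
  set ē : ℝ → ℝ := fun τ => e (max τ t₀) with ē_def
  have ē_eq : ∀ τ, t₀ ≤ τ → ē τ = e τ := fun τ hτ => by simp only [ē_def, max_eq_left hτ]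
  have ē_cont : Continuous ē :=
    he.comp_continuous (by fun_prop) fun τ => mem_Ici.2 (le_max_right _ _)
  have ē_quotient : ∀ h, 0 < h → limsup (fun t => ‖differenceQuotient h ē t‖ₑ) atTop ≤ L := by
    intro h hh
    refine limsup_le_of_eventually_le_of_le ?_ (hL h hh)
    filter_upwards [eventually_ge_atTop t₀] with t ht
    rw [differenceQuotient, differenceQuotient, ē_eq t ht, ē_eq _ (by linarith)]
  have hderiv := hasDerivAt_movingAverage ē_cont h
  refine ⟨movingAverage h ē, ⟨fun τ _ => (hderiv τ).continuousAt.continuousWithinAt,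
    differenceQuotient h ē, continuousOn_differenceQuotient hh ē_cont.continuousOn,
    fun τ _ => hderiv τ, ē_quotient h hh⟩, ?_⟩
  refine limsup_le_of_eventually_le_of_le ?_
    (limsup_sub_movingAverage_le ē_cont (fun τ => hB _ (le_max_right _ _)) ē_quotient hh)
  filter_upwards [eventually_ge_atTop t₀] with t ht
  rw [ē_eq t ht]

namespace RegulatedSystem

variable {Z X : Type*} [NormedAddCommGroup Z] [InnerProductSpace ℝ Z]
  [NormedAddCommGroup X] [NormedSpace ℝ X] {P : RegulatedSystem Z X} (𝓡 : P.Realization)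

theorem DH_mul_state_bound_eq (P : RegulatedSystem Z X) (Lr Ld : ℝ≥0∞) :
    P.DH * (P.ε * ((P.DBd * Ld + P.DB * Lr) / (1 - P.ε * P.DA))) =
      P.calDd * Ld + P.calD * Lr := by
  simp only [calD, calDd, div_eq_mul_inv]
  ring

namespace Realization

theorem continuousOn_forcing {U : Set ℝ} {F : ℝ → Z} {ρ δ : ℝ → ℝ} (hF : ContinuousOn F U)
    (hρ : ContinuousOn ρ U) (hδ : ContinuousOn δ U) : ContinuousOn
      (fun τ => 𝓡.I₀L.comp P.ι (F τ) + (disturbanceL P (δ τ) + controlL P (ρ τ))) U :=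
  ((𝓡.I₀L.comp P.ι).continuous.comp_continuousOn hF).add
    (((disturbanceL P).continuous.comp_continuousOn hδ).add
      ((controlL P).continuous.comp_continuousOn hρ))

namespace IsTrajectory

variable (hP : P.Standing) {𝓡} {t₀ : ℝ} {x₀ : X} {F : ℝ → Z} {ρ δ : ℝ → ℝ}
  {v : ℝ → Z}

theorem shift {h : ℝ} (H : 𝓡.IsTrajectory (t₀ + h) x₀ F ρ δ v) :
    𝓡.IsTrajectory t₀ x₀ (fun τ => F (τ + h)) (fun τ => ρ (τ + h)) (fun τ => δ (τ + h))
      (fun τ => v (τ + h)) := by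
  have hmaps : MapsTo (fun τ => τ + h) (Ici t₀) (Ici (t₀ + h)) := fun τ hτ =>
    add_le_add_left (mem_Ici.1 hτ) h
  have hcont : ContinuousOn (fun τ : ℝ => τ + h) (Ici t₀) := by fun_prop
  refine ⟨H.F_cont.comp hcont hmaps, H.ρ_cont.comp hcont hmaps, H.δ_cont.comp hcont hmaps,
    H.v_cont.comp hcont hmaps, fun t ht => ?_⟩
  rw [H.eq (t + h) (by linarith), add_sub_add_right_eq_sub, smoothingConv_comp_add_right t₀ h
    (fun τ => 𝓡.I₀L.comp P.ι (F τ) + (disturbanceL P (δ τ) + controlL P (ρ τ)))]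

include hP in
theorem smul_sub {x₁ : X} {F₁ : ℝ → Z} {ρ₁ δ₁ : ℝ → ℝ} {v₁ : ℝ → Z}
    (H₁ : 𝓡.IsTrajectory t₀ x₁ F₁ ρ₁ δ₁ v₁) (H : 𝓡.IsTrajectory t₀ x₀ F ρ δ v) (a : ℝ) :
    𝓡.IsTrajectory t₀ (a • (x₁ - x₀)) (fun τ => a • (F₁ τ - F τ)) (fun τ => a • (ρ₁ τ - ρ τ))
      (fun τ => a • (δ₁ τ - δ τ)) (fun τ => a • (v₁ τ - v τ)) where
  F_cont := (H₁.F_cont.sub H.F_cont).const_smul a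
  ρ_cont := (H₁.ρ_cont.sub H.ρ_cont).const_smul a
  δ_cont := (H₁.δ_cont.sub H.δ_cont).const_smul a
  v_cont := (H₁.v_cont.sub H.v_cont).const_smul a
  eq t ht := by
    have forcing_eq : (fun τ => 𝓡.I₀L.comp P.ι (a • (F₁ τ - F τ)) +
        (disturbanceL P (a • (δ₁ τ - δ τ)) + controlL P (a • (ρ₁ τ - ρ τ)))) = fun τ => a •
        ((𝓡.I₀L.comp P.ι (F₁ τ) + (disturbanceL P (δ₁ τ) + controlL P (ρ₁ τ))) -
          (𝓡.I₀L.comp P.ι (F τ) + (disturbanceL P (δ τ) + controlL P (ρ τ)))) := by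
      funext τ
      simp only [map_smul, map_sub]
      module
    rw [forcing_eq, (𝓡.isSmoothingKernel hP).conv_smul_sub ht.le a
      (𝓡.continuousOn_forcing H₁.F_cont H₁.ρ_cont H₁.δ_cont)
      (𝓡.continuousOn_forcing H.F_cont H.ρ_cont H.δ_cont), H₁.eq t ht, H.eq t ht, map_smul, map_sub]
    module

include hP in
protected theorem differenceQuotient {x₁ : X} {h : ℝ} (H₁ : 𝓡.IsTrajectory (t₀ + h) x₁ F ρ δ v)
    (H : 𝓡.IsTrajectory t₀ x₀ F ρ δ v) :
    𝓡.IsTrajectory t₀ (h⁻¹ • (x₁ - x₀)) (differenceQuotient h F) (differenceQuotient h ρ)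
      (differenceQuotient h δ) (differenceQuotient h v) :=
  H₁.shift.smul_sub hP H h⁻¹

variable [CompleteSpace Z]

include hP in
/-- The state bound comes from the small-gain condition and is fed into the error bound through
`‖F‖ ≤ ε ‖v‖`. -/
theorem limsup_error_le_of_approx (H : 𝓡.IsTrajectory t₀ x₀ F ρ δ v) (hε : P.ε * P.DA < 1)
    (hF : ∀ τ, t₀ ≤ τ → ‖F τ‖ₑ ≤ P.ε * ‖𝓡.E (v τ)‖ₑ) {p : ℝ → ℝ} {Lr Ld Lρ : ℝ≥0∞}
    (hρ : limsup (fun t => ‖ρ t‖ₑ) atTop ≤ Lr) (hδ : limsup (fun t => ‖δ t‖ₑ) atTop ≤ Ld)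
    (hp : HasLimsupDerivLE p t₀ Lr) (hδ' : HasLimsupDerivLE δ t₀ Ld)
    (happrox : limsup (fun t => ‖ρ t - p t‖ₑ) atTop ≤ Lρ) (hLr : Lr ≠ ⊤) (hLd : Ld ≠ ⊤)
    (hLρ : Lρ ≠ ⊤) :
    limsup (fun t => ‖ρ t - 𝓡.c (v t)‖ₑ) atTop ≤
      (P.D + P.calD) * Lr + (P.Dd + P.calDd) * Ld +
        (1 + ∫⁻ s in Ioi 0, gainDensity 𝓡.c 𝓡.R (controlL P) s) * Lρ := by
  have state_bound_ne_top : (P.DBd * Ld + P.DB * Lr) / (1 - P.ε * P.DA) ≠ ⊤ :=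
    ENNReal.div_ne_top (ENNReal.add_ne_top.2 ⟨ENNReal.mul_ne_top (𝓡.DBd_ne_top hP) hLd,
      ENNReal.mul_ne_top (𝓡.DB_ne_top hP) hLr⟩) (tsub_pos_of_lt hε).ne'
  have F_le : limsup (fun t => ‖F t‖ₑ) atTop ≤
      P.ε * ((P.DBd * Ld + P.DB * Lr) / (1 - P.ε * P.DA)) :=
    limsup_le_of_eventually_le_of_le (eventually_atTop.2 ⟨t₀, hF⟩)
      (limsup_enn_const_mul_le_of_le ENNReal.coe_ne_top
        (H.limsup_state_le hP hε hF hρ hδ hLr hLd))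
  refine (H.limsup_error_le hP hp hδ' F_le happrox hLr hLd
    (ENNReal.mul_ne_top ENNReal.coe_ne_top state_bound_ne_top) hLρ).trans_eq ?_
  rw [DH_mul_state_bound_eq]
  ring

include hP in
theorem limsup_error_le_of_deriv (H : 𝓡.IsTrajectory t₀ x₀ F ρ δ v) (hε : P.ε * P.DA < 1)
    (hF : ∀ τ, t₀ ≤ τ → ‖F τ‖ₑ ≤ P.ε * ‖𝓡.E (v τ)‖ₑ) {Lr Ld : ℝ≥0∞}
    (hρ : limsup (fun t => ‖ρ t‖ₑ) atTop ≤ Lr) (hδ : limsup (fun t => ‖δ t‖ₑ) atTop ≤ Ld)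
    (hρ' : HasLimsupDerivLE ρ t₀ Lr) (hδ' : HasLimsupDerivLE δ t₀ Ld) (hLr : Lr ≠ ⊤)
    (hLd : Ld ≠ ⊤) :
    limsup (fun t => ‖ρ t - 𝓡.c (v t)‖ₑ) atTop ≤
      (P.D + P.calD) * Lr + (P.Dd + P.calDd) * Ld := by
  have sub_self_le : limsup (fun t => ‖ρ t - ρ t‖ₑ) atTop ≤ 0 := by simp
  simpa only [mul_zero, add_zero] using H.limsup_error_le_of_approx hP hε hF hρ hδ hρ' hδ'
    sub_self_le hLr hLd ENNReal.zero_ne_top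

include hP in
theorem limsup_error_le_of_differenceQuotient (H : 𝓡.IsTrajectory t₀ x₀ F ρ (fun _ => 0) v)
    (hε : P.ε * P.DA < 1) (hF : ∀ τ, t₀ ≤ τ → ‖F τ‖ₑ ≤ P.ε * ‖𝓡.E (v τ)‖ₑ) {L : ℝ≥0∞}
    (hLtop : L ≠ ⊤) (hL : limsup (fun t => ‖ρ t‖ₑ) atTop ≤ L)
    (hLq : ∀ h, 0 < h → limsup (fun t => ‖differenceQuotient h ρ t‖ₑ) atTop ≤ L) :
    limsup (fun t => ‖ρ t - 𝓡.c (v t)‖ₑ) atTop ≤ (P.D + P.calD) * L := by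
  set κ := 1 + ∫⁻ s in Ioi 0, gainDensity 𝓡.c 𝓡.R (controlL P) s
  have κ_ne_top : κ ≠ ⊤ := ENNReal.add_ne_top.2
    ⟨ENNReal.one_ne_top, (𝓡.isSmoothingKernel hP).lintegral_gainDensity_ne_top _ _⟩
  have averaged_bound : ∀ h : ℝ, 0 < h → limsup (fun t => ‖ρ t - 𝓡.c (v t)‖ₑ) atTop ≤
      (P.D + P.calD) * L + κ * (L * ENNReal.ofReal h) := by
    intro h hh
    obtain ⟨p, hp, happrox⟩ := exists_hasLimsupDerivLE_approx H.ρ_cont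
      (ne_top_of_le_ne_top hLtop hL) hLq hh
    have zero_le_zero : limsup (fun _ : ℝ => ‖(0 : ℝ)‖ₑ) atTop ≤ 0 := by simp
    simpa only [mul_zero, add_zero] using H.limsup_error_le_of_approx hP hε hF hL zero_le_zero hp
      (hasLimsupDerivLE_zero t₀) happrox hLtop ENNReal.zero_ne_top
      (ENNReal.mul_ne_top hLtop ENNReal.ofReal_ne_top)
  have bound_tendsto : Tendsto
      (fun h : ℝ => (P.D + P.calD) * L + κ * (L * ENNReal.ofReal h)) (𝓝[>] 0)
      (𝓝 ((P.D + P.calD) * L + κ * (L * ENNReal.ofReal 0))) :=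
    (tendsto_const_nhds.add (ENNReal.Tendsto.const_mul (ENNReal.Tendsto.const_mul
      (ENNReal.continuous_ofReal.tendsto 0) (Or.inr hLtop)) (Or.inr κ_ne_top))).mono_left
      nhdsWithin_le_nhds
  rw [ENNReal.ofReal_zero, mul_zero, mul_zero, add_zero] at bound_tendsto
  exact ge_of_tendsto bound_tendsto (eventually_mem_nhdsWithin.mono averaged_bound)

end IsTrajectory

end Realization

end RegulatedSystem

/-! ### Signals with bounded derivatives -/

theorem limsup_enorm_iteratedDerivWithin_le (φ : ℝ → ℝ) {j N : ℕ} (hj : j ≤ N) :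
    limsup (fun t => ‖iteratedDerivWithin j φ (Ici 0) t‖ₑ) atTop ≤ limsupNorm N φ :=
  limsup_le_limsup (Eventually.of_forall fun t =>
    Finset.le_sup (f := fun j => ‖iteratedDerivWithin j φ (Ici 0) t‖ₑ)
      (Finset.mem_range.2 (Nat.lt_succ_of_le hj)))

theorem limsup_enorm_le_limsupNorm (N : ℕ) (φ : ℝ → ℝ) :
    limsup (fun t => ‖φ t‖ₑ) atTop ≤ limsupNorm N φ := by
  simpa only [iteratedDerivWithin_zero] using limsup_enorm_iteratedDerivWithin_le φ N.zero_le

namespace IsCb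

variable {N : ℕ} {φ : ℝ → ℝ} (hφ : IsCb N φ)

include hφ

theorem continuousOn_iteratedDerivWithin {j : ℕ} (hj : j ≤ N) :
    ContinuousOn (iteratedDerivWithin j φ (Ici 0)) (Ici 0) :=
  hφ.1.continuousOn_iteratedDerivWithin (by exact_mod_cast hj) (uniqueDiffOn_Ici 0)

theorem continuousOn : ContinuousOn φ (Ioi 0) := hφ.1.continuousOn.mono Ioi_subset_Ici_self

theorem hasDerivAt_iteratedDerivWithin {j : ℕ} (hj : j < N) {t : ℝ} (ht : 0 < t) :
    HasDerivAt (iteratedDerivWithin j φ (Ici 0)) (iteratedDerivWithin (j + 1) φ (Ici 0) t) t := by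
  rw [iteratedDerivWithin_succ]
  exact (hφ.1.differentiableOn_iteratedDerivWithin (m := j) (by exact_mod_cast hj)
    (uniqueDiffOn_Ici 0) t ht.le).hasDerivWithinAt.hasDerivAt (Ici_mem_nhds ht)

theorem limsupNorm_ne_top : limsupNorm N φ ≠ ⊤ := by
  obtain ⟨M, hM⟩ := hφ.2
  refine ne_top_of_le_ne_top (ENNReal.ofReal_ne_top (r := M)) (limsup_le_of_le (h := ?_))
  filter_upwards [eventually_ge_atTop 0] with t ht
  refine Finset.sup_le fun j hj => ?_
  rw [← ofReal_norm]
  exact ENNReal.ofReal_le_ofReal (hM j (Finset.mem_range_succ_iff.1 hj) t ht)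

theorem hasLimsupDerivLE_iteratedDerivWithin {j : ℕ} (hj : j < N) {t₀ : ℝ} (ht₀ : 0 < t₀) :
    HasLimsupDerivLE (iteratedDerivWithin j φ (Ici 0)) t₀ (limsupNorm N φ) where
  continuousOn := (hφ.continuousOn_iteratedDerivWithin hj.le).mono (Ici_subset_Ici.2 ht₀.le)
  exists_deriv := ⟨iteratedDerivWithin (j + 1) φ (Ici 0),
    (hφ.continuousOn_iteratedDerivWithin hj).mono (Ici_subset_Ici.2 ht₀.le),
    fun _ hτ => hφ.hasDerivAt_iteratedDerivWithin hj (ht₀.trans hτ),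
    limsup_enorm_iteratedDerivWithin_le φ hj⟩

theorem hasLimsupDerivLE (hN : 0 < N) {t₀ : ℝ} (ht₀ : 0 < t₀) :
    HasLimsupDerivLE φ t₀ (limsupNorm N φ) := by
  simpa only [iteratedDerivWithin_zero] using hφ.hasLimsupDerivLE_iteratedDerivWithin hN ht₀

theorem hasLimsupDerivLE_differenceQuotient (hN : 1 < N) {t₀ h : ℝ} (ht₀ : 0 < t₀) (hh : 0 < h) :
    HasLimsupDerivLE (differenceQuotient h φ) t₀ (limsupNorm N φ) := by
  refine _root_.hasLimsupDerivLE_differenceQuotient hh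
    (hφ.continuousOn.mono (Ici_subset_Ioi.2 ht₀)) (fun τ hτ => ?_)
    (hφ.hasLimsupDerivLE_iteratedDerivWithin hN ht₀)
  simpa only [iteratedDerivWithin_zero] using
    hφ.hasDerivAt_iteratedDerivWithin (one_pos.trans hN) (ht₀.trans hτ)

end IsCb

/-! ### The iteration -/

namespace RegulatedSystem

variable {Z X : Type*} [NormedAddCommGroup Z] [InnerProductSpace ℝ Z] [CompleteSpace Z]
  [NormedAddCommGroup X] [NormedSpace ℝ X] {P : RegulatedSystem Z X} (hP : P.Standing)

namespace Standing

include hP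

theorem enorm_f_sub_le (x y : Z) :
    ‖P.f (negPow P.T P.s₁ x) - P.f (negPow P.T P.s₁ y)‖ₑ ≤ P.ε * ‖x - y‖ₑ := by
  refine (hP.f_lipschitz (negPow P.T P.s₁ x) (negPow P.T P.s₁ y) ⟨x, rfl⟩ ⟨y, rfl⟩).trans_eq ?_
  rw [← map_sub, snorm, posNorm_apply hP.ι_negPow_s₁_injective]

theorem enorm_f_le (x : Z) : ‖P.f (negPow P.T P.s₁ x)‖ₑ ≤ P.ε * ‖x‖ₑ := by
  simpa only [map_zero, hP.f_zero, sub_zero] using hP.enorm_f_sub_le x 0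

theorem continuousOn_f_comp {U : Set ℝ} {u : ℝ → Z} (hu : ContinuousOn u U) :
    ContinuousOn (fun t => P.f (negPow P.T P.s₁ (u t))) U := by
  have f_lipschitz : LipschitzWith P.ε fun y => P.f (negPow P.T P.s₁ y) := fun x y => by
    simpa only [edist_eq_enorm_sub] using hP.enorm_f_sub_le x y
  exact f_lipschitz.continuous.comp_continuousOn hu

end Standing

namespace IsMildSolution

include hP

theorem exists_continuousOn {z₀ : Z} {g : ℝ → X} {z : ℝ → Z} (hz : P.IsMildSolution z₀ g z) :
    ∃ u : ℝ → Z, ContinuousOn u (Ioi 0) ∧ ∀ t, 0 < t → z t = negPow P.T P.s₁ (u t) := by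
  have pointwise : ∀ t, ∃ y : Z, 0 < t → z t = negPow P.T P.s₁ y := fun t => by
    by_cases ht : 0 < t
    · obtain ⟨y, hy⟩ := hz.mem t ht
      exact ⟨y, fun _ => (hP.ι_injective hy).symm⟩
    · exact ⟨0, fun h => absurd h ht⟩
  choose u hu using pointwise
  refine ⟨u, fun t (ht : 0 < t) => ContinuousAt.continuousWithinAt ?_, hu⟩
  rw [ContinuousAt, tendsto_iff_edist_tendsto_0]
  refine (hz.continuous t ht).congr' ?_
  filter_upwards [Ioi_mem_nhds ht] with τ hτ
  rw [hu τ hτ, hu t ht, ← map_sub, snorm, posNorm_apply hP.ι_negPow_s₁_injective,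
    edist_eq_enorm_sub]

theorem exists_isTrajectory [CompleteSpace X] (𝓡 : P.Realization) {z₀ : Z} {z F : ℝ → Z}
    {ρ δ : ℝ → ℝ} (hz : P.IsMildSolution z₀
      (fun τ => P.I₀ (P.ι (F τ) + δ τ • P.bd) + (1 / P.β) • (ρ τ • P.b)) z)
    (hF : ContinuousOn F (Ioi 0)) (hρ : ContinuousOn ρ (Ioi 0)) (hδ : ContinuousOn δ (Ioi 0)) :
    ∃ v : ℝ → Z, ContinuousOn v (Ioi 0) ∧ (∀ t, 0 < t → z t = negPow P.T P.s₁ (𝓡.E (v t))) ∧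
      (∀ t, 0 < t → P.Cx (P.ι (z t)) = 𝓡.c (v t)) ∧
      ∀ t₀, 0 < t₀ → 𝓡.IsTrajectory t₀ (P.ι (z t₀)) F ρ δ v := by
  have forcing_eq : (fun τ => P.I₀ (P.ι (F τ) + δ τ • P.bd) + (1 / P.β) • (ρ τ • P.b)) =
      fun τ => 𝓡.I₀L.comp P.ι (F τ) +
        (Realization.disturbanceL P (δ τ) + Realization.controlL P (ρ τ)) := by
    funext τ
    simp only [Realization.disturbanceL, Realization.controlL, ← 𝓡.I₀L_apply, map_add, map_smul,
      ContinuousLinearMap.comp_apply, ContinuousLinearMap.toSpanSingleton_apply, add_assoc,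
      smul_comm (1 / P.β)]
  rw [forcing_eq] at hz
  obtain ⟨v, hv, hQ, hv_eq⟩ := 𝓡.exists_restart hP hz (𝓡.continuousOn_forcing hF hρ hδ)
  refine ⟨v, hv, fun t ht => hP.ι_injective ?_, fun t ht => ?_, fun t₀ ht₀ => ?_⟩
  · rw [𝓡.Q_eq, hQ t ht]
  · rw [← hQ t ht, 𝓡.Cx_Q]
  · have hsub : Ici t₀ ⊆ Ioi 0 := Ici_subset_Ioi.2 ht₀
    exact ⟨hF.mono hsub, hρ.mono hsub, hδ.mono hsub, hv.mono hsub, fun t ht => hv_eq t₀ t ht₀ ht⟩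

end IsMildSolution

variable [CompleteSpace X]

namespace Standing

include hP

theorem D_add_calD_pos : 0 < P.D + P.calD := by
  obtain ⟨𝓡⟩ := hP.nonempty_realization
  exact add_pos_of_pos_of_nonneg (𝓡.D_pos hP) zero_le

theorem D_add_calD_ne_top (hε : P.ε * P.DA < 1) : P.D + P.calD ≠ ⊤ := by
  obtain ⟨𝓡⟩ := hP.nonempty_realization
  exact ENNReal.add_ne_top.2 ⟨𝓡.D_ne_top hP, ENNReal.mul_ne_top (𝓡.DH_ne_top hP)
    (ENNReal.div_ne_top (ENNReal.mul_ne_top (𝓡.DB_ne_top hP) ENNReal.coe_ne_top)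
      (tsub_pos_of_lt hε).ne')⟩

theorem Dd_add_calDd_ne_top (hε : P.ε * P.DA < 1) : P.Dd + P.calDd ≠ ⊤ := by
  obtain ⟨𝓡⟩ := hP.nonempty_realization
  exact ENNReal.add_ne_top.2 ⟨𝓡.Dd_ne_top hP, ENNReal.mul_ne_top (𝓡.DH_ne_top hP)
    (ENNReal.div_ne_top (ENNReal.mul_ne_top (𝓡.DBd_ne_top hP) ENNReal.coe_ne_top)
      (tsub_pos_of_lt hε).ne')⟩

end Standing

namespace IsStepZero

variable {r d : ℝ → ℝ} {z₀ : Z} {z : ℝ → Z} (hz : P.IsStepZero r d z₀ z)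

include hP hz

theorem exists_isTrajectory (𝓡 : P.Realization) (hr : ContinuousOn r (Ioi 0))
    (hd : ContinuousOn d (Ioi 0)) :
    ∃ v : ℝ → Z, ContinuousOn v (Ioi 0) ∧ (∀ t, 0 < t → z t = negPow P.T P.s₁ (𝓡.E (v t))) ∧
      (∀ t, 0 < t → P.e₀ r z t = r t - 𝓡.c (v t)) ∧
      ∀ t₀, 0 < t₀ → 𝓡.IsTrajectory t₀ (P.ι (z t₀)) (fun t => P.f (z t)) r d v := by
  obtain ⟨u, hu, hzu⟩ := IsMildSolution.exists_continuousOn hP hz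
  have hF : ContinuousOn (fun t => P.f (z t)) (Ioi 0) :=
    (hP.continuousOn_f_comp hu).congr fun t ht => by rw [hzu t ht]
  obtain ⟨v, hv, hzv, hcv, trajectory⟩ := IsMildSolution.exists_isTrajectory hP 𝓡 hz hF hr hd
  exact ⟨v, hv, hzv, fun t ht => by rw [e₀, hcv t ht], trajectory⟩

theorem continuousOn_e₀ (hr : ContinuousOn r (Ioi 0)) (hd : ContinuousOn d (Ioi 0)) :
    ContinuousOn (P.e₀ r z) (Ioi 0) := by
  obtain ⟨𝓡⟩ := hP.nonempty_realization
  obtain ⟨v, hv, -, he₀, -⟩ := hz.exists_isTrajectory hP 𝓡 hr hd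
  exact (hr.sub (𝓡.c.continuous.comp_continuousOn hv)).congr he₀

theorem limsup_e₀_le (hε : P.ε * P.DA < 1) {N : ℕ} (hN : 0 < N) (hr : IsCb N r)
    (hd : IsCb N d) :
    limsup (fun t => ‖P.e₀ r z t‖ₑ) atTop ≤
      (P.D + P.calD) * limsupNorm N r + (P.Dd + P.calDd) * limsupNorm N d := by
  obtain ⟨𝓡⟩ := hP.nonempty_realization
  obtain ⟨v, -, hzv, he₀, trajectory⟩ := hz.exists_isTrajectory hP 𝓡 hr.continuousOn hd.continuousOn
  have gain_le : ∀ τ, 1 ≤ τ → ‖P.f (z τ)‖ₑ ≤ P.ε * ‖𝓡.E (v τ)‖ₑ := fun τ hτ => by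
    rw [hzv τ (one_pos.trans_le hτ)]
    exact hP.enorm_f_le _
  refine limsup_le_of_eventually_le_of_le ?_ ((trajectory 1 one_pos).limsup_error_le_of_deriv hP hε
    gain_le (limsup_enorm_le_limsupNorm N r) (limsup_enorm_le_limsupNorm N d)
    (hr.hasLimsupDerivLE hN one_pos) (hd.hasLimsupDerivLE hN one_pos)
    hr.limsupNorm_ne_top hd.limsupNorm_ne_top)
  filter_upwards [eventually_gt_atTop 0] with t ht
  rw [he₀ t ht]

/-- The difference quotient of `z⁰` is again a trajectory, and `f` enters it through increments. -/
theorem limsup_differenceQuotient_e₀_le (hε : P.ε * P.DA < 1) {N : ℕ} (hN : 1 < N)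
    (hr : IsCb N r) (hd : IsCb N d) {h : ℝ} (hh : 0 < h) :
    limsup (fun t => ‖differenceQuotient h (P.e₀ r z) t‖ₑ) atTop ≤
      (P.D + P.calD) * limsupNorm N r + (P.Dd + P.calDd) * limsupNorm N d := by
  obtain ⟨𝓡⟩ := hP.nonempty_realization
  obtain ⟨v, -, hzv, he₀, trajectory⟩ := hz.exists_isTrajectory hP 𝓡 hr.continuousOn hd.continuousOn
  have gain_le : ∀ τ, 1 ≤ τ → ‖differenceQuotient h (fun t => P.f (z t)) τ‖ₑ ≤
      P.ε * ‖𝓡.E (differenceQuotient h v τ)‖ₑ := fun τ hτ => by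
    have increment_le := hP.enorm_f_sub_le (𝓡.E (v (τ + h))) (𝓡.E (v τ))
    rw [← hzv (τ + h) (by linarith), ← hzv τ (by linarith), ← map_sub] at increment_le
    rw [differenceQuotient, differenceQuotient, map_smul, enorm_smul, enorm_smul, mul_left_comm]
    gcongr
  have hr_quotient := hr.hasLimsupDerivLE_differenceQuotient hN one_pos hh
  have hd_quotient := hd.hasLimsupDerivLE_differenceQuotient hN one_pos hh
  have quotient_trajectory :=
    (trajectory (1 + h) (by positivity)).differenceQuotient hP (trajectory 1 one_pos)
  refine limsup_le_of_eventually_le_of_le ?_ (quotient_trajectory.limsup_error_le_of_deriv hP hε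
    gain_le ((hr.hasLimsupDerivLE (one_pos.trans hN) one_pos).limsup_differenceQuotient_le hh)
    ((hd.hasLimsupDerivLE (one_pos.trans hN) one_pos).limsup_differenceQuotient_le hh)
    hr_quotient hd_quotient hr.limsupNorm_ne_top hd.limsupNorm_ne_top)
  filter_upwards [eventually_gt_atTop 0] with t ht
  refine le_of_eq (congrArg _ ?_)
  simp only [differenceQuotient, he₀ t ht, he₀ (t + h) (by linarith), map_smul, map_sub]
  module

end IsStepZero

include hP in
theorem IsStepOne.limsup_e₁_le (hε : P.ε * P.DA < 1) {r d : ℝ → ℝ} {z₀ : Z} {z w : ℝ → Z}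
    (hz : P.IsStepZero r d z₀ z) (hw : P.IsStepOne r z w) (hr : ContinuousOn r (Ioi 0))
    (hd : ContinuousOn d (Ioi 0)) {L : ℝ≥0∞} (hLtop : L ≠ ⊤)
    (hL : limsup (fun t => ‖P.e₀ r z t‖ₑ) atTop ≤ L)
    (hLq : ∀ h, 0 < h → limsup (fun t => ‖differenceQuotient h (P.e₀ r z) t‖ₑ) atTop ≤ L) :
    limsup (fun t => ‖P.e₁ r z w t‖ₑ) atTop ≤ (P.D + P.calD) * L := by
  obtain ⟨𝓡⟩ := hP.nonempty_realization
  obtain ⟨u, hu, hzu⟩ := IsMildSolution.exists_continuousOn hP hz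
  obtain ⟨y, hy, hwy⟩ := IsMildSolution.exists_continuousOn hP hw
  have hF : ContinuousOn (fun t => P.f (z t + w t) - P.f (z t)) (Ioi 0) :=
    ((hP.continuousOn_f_comp (hu.add hy)).sub (hP.continuousOn_f_comp hu)).congr fun t ht => by
      simp only [hzu t ht, hwy t ht, Pi.sub_apply, Pi.add_apply, map_add]
  have hw_disturbance : P.IsMildSolution 0 (fun t => P.I₀ (P.ι (P.f (z t + w t) - P.f (z t)) +
      (0 : ℝ) • P.bd) + (1 / P.β) • (P.e₀ r z t • P.b)) w := by
    simp only [zero_smul, add_zero]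
    exact hw
  obtain ⟨v, -, hwv, hcv, trajectory⟩ := IsMildSolution.exists_isTrajectory hP 𝓡 hw_disturbance hF
    (hz.continuousOn_e₀ hP hr hd) continuousOn_const
  have gain_le : ∀ τ, 1 ≤ τ → ‖P.f (z τ + w τ) - P.f (z τ)‖ₑ ≤ P.ε * ‖𝓡.E (v τ)‖ₑ :=
    fun τ hτ => by
      have increment_le := hP.enorm_f_sub_le (u τ + 𝓡.E (v τ)) (u τ)
      rwa [add_sub_cancel_left, map_add, ← hzu τ (one_pos.trans_le hτ),
        ← hwv τ (one_pos.trans_le hτ)] at increment_le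
  refine limsup_le_of_eventually_le_of_le ?_
    ((trajectory 1 one_pos).limsup_error_le_of_differenceQuotient hP hε gain_le hLtop hL hLq)
  filter_upwards [eventually_gt_atTop 0] with t ht
  rw [e₁, hcv t ht]

end RegulatedSystem

end

theorem mainTheorem5 {Z X : Type*}
    [NormedAddCommGroup Z] [InnerProductSpace ℝ Z] [CompleteSpace Z]
    [NormedAddCommGroup X] [NormedSpace ℝ X] [CompleteSpace X]
    (P : RegulatedSystem Z X) (hP : P.Standing)
    (hε : (P.ε : ENNReal) * P.DA < 1)
    (r d : ℝ → ℝ) (hr : IsCb 2 r) (hd : IsCb 2 d)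
    (z₀ : Z) (z w : ℝ → Z) (hz : P.IsStepZero r d z₀ z) (hw : P.IsStepOne r z w) :
    0 < P.D + P.calD ∧ P.D + P.calD < ⊤ ∧ P.Dd + P.calDd < ⊤ ∧
    Filter.limsup (fun t : ℝ => ‖P.e₁ r z w t‖ₑ) Filter.atTop ≤
      (P.D + P.calD) ^ 2 *
        (limsupNorm 2 r + (P.Dd + P.calDd) / (P.D + P.calD) * limsupNorm 2 d) := by
  have D_pos := hP.D_add_calD_pos
  have D_ne_top := hP.D_add_calD_ne_top hε
  have Dd_ne_top := hP.Dd_add_calDd_ne_top hε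
  refine ⟨D_pos, D_ne_top.lt_top, Dd_ne_top.lt_top, ?_⟩
  have bound_ne_top :
      (P.D + P.calD) * limsupNorm 2 r + (P.Dd + P.calDd) * limsupNorm 2 d ≠ ⊤ :=
    ENNReal.add_ne_top.2 ⟨ENNReal.mul_ne_top D_ne_top hr.limsupNorm_ne_top,
      ENNReal.mul_ne_top Dd_ne_top hd.limsupNorm_ne_top⟩
  calc limsup (fun t => ‖P.e₁ r z w t‖ₑ) atTop
      ≤ (P.D + P.calD) *
          ((P.D + P.calD) * limsupNorm 2 r + (P.Dd + P.calDd) * limsupNorm 2 d) :=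
        hw.limsup_e₁_le hP hε hz hr.continuousOn hd.continuousOn bound_ne_top
          (hz.limsup_e₀_le hP hε two_pos hr hd)
          fun _ hh => hz.limsup_differenceQuotient_e₀_le hP hε one_lt_two hr hd hh
    _ = (P.D + P.calD) ^ 2 *
          (limsupNorm 2 r + (P.Dd + P.calDd) / (P.D + P.calD) * limsupNorm 2 d) := by
        rw [pow_two, mul_assoc, mul_add (P.D + P.calD) (limsupNorm 2 r),
          ← mul_assoc (P.D + P.calD) (_ / _), ENNReal.mul_div_cancel D_pos.ne' D_ne_top]
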